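/- Let $\mathbb G$ be a Carnot group of step two: the simply connected Lie group whose Lie algebra is stratified as $\mathfrak g=V_1\oplus V_2$, with $[V_1,V_1]=V_2\neq\{0\}$ and $[V_1,V_2]=\{0\}$. Let $e_1,\dots,e_m$ and $\epsilon_1,\dots,\epsilon_k$ be bases of $V_1$ and $V_2$ which together form an orthonormal basis of $\mathfrak g$ for a given inner product. Let $X_1,\dots,X_m$ be the left-invariant vector fields with $X_i(0)=e_i$, endow $\mathbb G$ with the left-invariant Riemannian metric that extends the inner product, and let $dg$ be the Haar measure which is the image of Lebesgue measure on $\mathfrak g$ under $\exp$. Let $\Omega\subset\mathbb G$ be a bounded open set of class $C^2$, with Riemannian outer unit normal $\nu$ and Riemannian surface measure $\sigma$ on $\partial\Omega$. Put $N^H=\sum_{j}\langle\nu,X_j\rangle X_j$, $W=|N^H|$, $d\sigma_H=W\,d\sigma$, and $\nu^H=N^H/W$ where $W\ne0$. At the points of $\partial\Omega$ with $W\neq 0$ let $$\mathcal H=-\sum_{a=1}^{m-1}\langle\nabla^H_{\boldsymbol e_a}\boldsymbol e_a,\nu^H\rangle$$ be the horizontal mean curvature, where $\boldsymbol e_1,\dots,\boldsymbol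 e_{m-1}$ is a $C^1$ orthonormal frame of $T\partial\Omega\cap H\mathbb G$, $H\mathbb G$ being the bundle spanned by $X_1,\dots,X_m$, and $\nabla^H_Y\big(\sum_l Z_lX_l\big)=\sum_l Y(Z_l)X_l$. Equivalently, $|\nabla_H\phi|^3\mathcal H=|\nabla_H\phi|^2\Delta_H\phi-\sum_{i,j}\phi_{,ij}X_i\phi X_j\phi$ for a local defining function $\phi$ of $\Omega=\{\phi<0\}$. At points with $W=0$ (a $\sigma_H$-null set), $\mathcal H$ is the limit of its values at points with $W\neq 0$ if this exists, and arbitrary otherwise. For a function $u$ write $u_{,ij}=\frac12(X_iX_ju+X_jX_iu)$, $\|\nabla_H^2u\|^2=\sum_{i,j=1}^m u_{,ij}^2$, $\Delta_Hu=\sum_{i=1}^m X_i^2u$, $[X_i,X_j]u=X_iX_ju-X_jX_iu$ and $|\nabla_Hu|^2=\sum_{i=1}^m(X_iu)^2$. (i) Let $u\in\Gamma^2(\overline\Omega)$, that is, $u\in C(\overline\Omega)$ and the derivatives $X_iu$, $X_jX_iu$ exist in $\Omega$ and extend continuously to $\overline\Omega$. Suppose that $u\le0$ in $\Omega$ and $u=0$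 on $\partial\Omega$. Then all the integrands below are integrable, and $$\int_\Omega\|\nabla^2_Hu\|^2\,dg=\int_\Omega(\Delta_Hu)^2\,dg+\frac34\sum_{i,j=1}^m\int_\Omega([X_i,X_j]u)^2\,dg-\int_{\partial\Omega}\mathcal H\,|\nabla_Hu|^2\,d\sigma_H .$$ (ii) Let $u\in\Gamma^2_0(\Omega)$, that is, $u$ has compact support in $\Omega$ and $u$, $X_iu$, $X_jX_iu$ exist and are continuous in $\Omega$. Then $$\int_\Omega\|\nabla^2_Hu\|^2\,dg=\int_\Omega(\Delta_Hu)^2\,dg+\frac34\sum_{i,j=1}^m\int_\Omega([X_i,X_j]u)^2\,dg .$$ -/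

import Mathlib

open MeasureTheory Set Filter Topology

noncomputable section

/-- The data of a Carnot group of step two: a real Lie algebra `𝔤` with a stratification
`𝔤 = V₁ ⊕ V₂`, `[V₁, V₁] = V₂ ≠ 0`, `[V₁, V₂] = 0`, and an orthonormal basis of `𝔤`
(`e₁, …, e_m` of `V₁` and `ε₁, …, ε_k` of `V₂`) adapted to it.

The simply connected Lie group with Lie algebra `𝔤` is realised, in exponential coordinates
(so that `exp = id`), on the space `𝔤` itself with the Baker-Campbell-Hausdorff product,
see `StepTwoCarnot.mul`. -/
structure StepTwoCarnot (𝔤 : Type*) [NormedAddCommGroup 𝔤] [InnerProductSpace ℝ 𝔤]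
    (m k : ℕ) where
  /-- the Lie bracket of `𝔤` -/
  bracket : 𝔤 →ₗ[ℝ] 𝔤 →ₗ[ℝ] 𝔤
  bracket_self : ∀ x, bracket x x = 0
  jacobi : ∀ x y z,
    bracket x (bracket y z) + bracket y (bracket z x) + bracket z (bracket x y) = 0
  /-- the orthonormal basis `e₁, …, e_m, ε₁, …, ε_k` -/
  basis : OrthonormalBasis (Fin m ⊕ Fin k) ℝ 𝔤
  /-- the horizontal layer -/
  V₁ : Submodule ℝ 𝔤
  /-- the second layer -/
  V₂ : Submodule ℝ 𝔤
  V₁_eq : V₁ = Submodule.span ℝ (range fun i : Fin m => basis (Sum.inl i))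
  V₂_eq : V₂ = Submodule.span ℝ (range fun s : Fin k => basis (Sum.inr s))
  bracket_V₁_V₁ : Submodule.span ℝ {z | ∃ x ∈ V₁, ∃ y ∈ V₁, z = bracket x y} = V₂
  bracket_V₁_V₂ : ∀ x ∈ V₁, ∀ y ∈ V₂, bracket x y = 0
  V₂_ne_bot : V₂ ≠ ⊥

/-- `φ` is a local `C²` defining function of `Ω` at `p`: near `p` the set `Ω` is `{φ < 0}`, and
`φ(p) = 0`, `dφ(p) ≠ 0`. -/
def IsLocalDefining {E : Type*} [NormedAddCommGroup E] [NormedSpace ℝ E]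
    (Ω : Set E) (p : E) (φ : E → ℝ) : Prop :=
  ContDiffAt ℝ 2 φ p ∧ φ p = 0 ∧ fderiv ℝ φ p ≠ 0 ∧ ∀ᶠ x in 𝓝 p, (x ∈ Ω ↔ φ x < 0)

/-- `Ω` is of class `C²`: it has a local `C²` defining function at each boundary point. -/
def IsC2Domain {E : Type*} [NormedAddCommGroup E] [NormedSpace ℝ E] (Ω : Set E) : Prop :=
  ∀ p ∈ frontier Ω, ∃ φ : E → ℝ, IsLocalDefining Ω p φ

namespace StepTwoCarnot

variable {𝔤 : Type*} [NormedAddCommGroup 𝔤] [InnerProductSpace ℝ 𝔤] {m k : ℕ}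

section Group

/-- The group law `g h = g + h + ½ [g, h]` (Baker-Campbell-Hausdorff formula in step two). -/
def mul (C : StepTwoCarnot 𝔤 m k) (g h : 𝔤) : 𝔤 :=
  g + h + (1 / 2 : ℝ) • C.bracket g h

theorem bracket_skew (C : StepTwoCarnot 𝔤 m k) (x y : 𝔤) :
    C.bracket x y = -C.bracket y x := by
  have h := C.bracket_self (x + y)
  simp only [map_add, LinearMap.add_apply, C.bracket_self, zero_add, add_zero] at h
  exact eq_neg_of_add_eq_zero_right h

theorem V₁_sup_V₂ (C : StepTwoCarnot 𝔤 m k) : C.V₁ ⊔ C.V₂ = ⊤ := by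
  rw [C.V₁_eq, C.V₂_eq, ← Submodule.span_union, eq_top_iff]
  have h := C.basis.toBasis.span_eq
  rw [← h]
  apply Submodule.span_mono
  rintro _ ⟨a | b, rfl⟩
  · left; exact ⟨a, by simp⟩
  · right; exact ⟨b, by simp⟩

theorem bracket_V₂ (C : StepTwoCarnot 𝔤 m k) (x : 𝔤) {z : 𝔤} (hz : z ∈ C.V₂) :
    C.bracket x z = 0 := by
  have hx : x ∈ C.V₁ ⊔ C.V₂ := by rw [C.V₁_sup_V₂]; trivial
  obtain ⟨a, ha, b, hb, rfl⟩ := Submodule.mem_sup.1 hx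
  have key : C.V₂ ≤ LinearMap.ker (C.bracket b) := by
    conv_lhs => rw [← C.bracket_V₁_V₁]
    rw [Submodule.span_le]
    rintro _ ⟨c, hc, d, hd, rfl⟩
    have hj := C.jacobi b c d
    have hbc := C.bracket_skew b c
    rw [C.bracket_V₁_V₂ c hc b hb] at hbc
    rw [hbc, C.bracket_V₁_V₂ d hd b hb] at hj
    simpa using hj
  have h2 : C.bracket b z = 0 := key hz
  rw [map_add, LinearMap.add_apply, C.bracket_V₁_V₂ a ha z hz, h2, add_zero]

theorem bracket_mem (C : StepTwoCarnot 𝔤 m k) (x y : 𝔤) : C.bracket x y ∈ C.V₂ := by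
  have hx : x ∈ C.V₁ ⊔ C.V₂ := by rw [C.V₁_sup_V₂]; trivial
  have hy : y ∈ C.V₁ ⊔ C.V₂ := by rw [C.V₁_sup_V₂]; trivial
  obtain ⟨a, ha, b, hb, rfl⟩ := Submodule.mem_sup.1 hx
  obtain ⟨c, hc, d, hd, rfl⟩ := Submodule.mem_sup.1 hy
  have h : C.bracket a c ∈ C.V₂ := by
    rw [← C.bracket_V₁_V₁]
    exact Submodule.subset_span ⟨a, ha, c, hc, rfl⟩
  rw [map_add (C.bracket (a + b)), C.bracket_V₂ _ hd, map_add, LinearMap.add_apply,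
    C.bracket_skew b c, C.bracket_V₂ c hb]
  simpa using h

theorem bracket_bracket (C : StepTwoCarnot 𝔤 m k) (x y z : 𝔤) :
    C.bracket x (C.bracket y z) = 0 :=
  C.bracket_V₂ x (C.bracket_mem y z)

theorem mul_zero (C : StepTwoCarnot 𝔤 m k) (g : 𝔤) : C.mul g 0 = g := by simp [mul]

theorem zero_mul (C : StepTwoCarnot 𝔤 m k) (g : 𝔤) : C.mul 0 g = g := by simp [mul]

theorem mul_neg (C : StepTwoCarnot 𝔤 m k) (g : 𝔤) : C.mul g (-g) = 0 := by
  simp [mul, C.bracket_self]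

theorem neg_mul (C : StepTwoCarnot 𝔤 m k) (g : 𝔤) : C.mul (-g) g = 0 := by
  simp [mul, C.bracket_self]

theorem mul_assoc (C : StepTwoCarnot 𝔤 m k) (g h l : 𝔤) :
    C.mul (C.mul g h) l = C.mul g (C.mul h l) := by
  have h1 : C.bracket (C.bracket g h) l = 0 := by
    rw [C.bracket_skew, C.bracket_bracket, neg_zero]
  simp only [mul, map_add, map_smul, LinearMap.add_apply, LinearMap.smul_apply, h1,
    C.bracket_bracket, smul_zero, add_zero, smul_add]
  abel

end Group

section Frame

/-- The differential at the point `h` of the left translation by `g`. -/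
def dLeft (C : StepTwoCarnot 𝔤 m k) (g h v : 𝔤) : 𝔤 := fderiv ℝ (C.mul g) h v

/-- The left-invariant orthonormal frame `X₁, …, X_m, T₁, …, T_k`: the value at `g` is the image
of the basis vector under the differential at the identity of the left translation by `g`. -/
def frame (C : StepTwoCarnot 𝔤 m k) (a : Fin m ⊕ Fin k) (g : 𝔤) : 𝔤 :=
  C.dLeft g 0 (C.basis a)

/-- The horizontal left-invariant vector fields `X₁, …, X_m`. -/
def X (C : StepTwoCarnot 𝔤 m k) (i : Fin m) (g : 𝔤) : 𝔤 := C.frame (Sum.inl i) g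

/-- The left-invariant Riemannian metric `⟨v, w⟩_g` which is the given inner product at the
identity. -/
def metric (C : StepTwoCarnot 𝔤 m k) (g v w : 𝔤) : ℝ :=
  inner ℝ (C.dLeft (-g) g v) (C.dLeft (-g) g w)

theorem dLeft_eq (C : StepTwoCarnot 𝔤 m k) (g h v : 𝔤) :
    C.dLeft g h v = v + (1 / 2 : ℝ) • C.bracket g v := by
  have : FiniteDimensional ℝ 𝔤 := C.basis.toBasis.finiteDimensional_of_finite
  have hb : HasFDerivAt (fun x => C.bracket g x)
      (LinearMap.toContinuousLinearMap (C.bracket g)) h :=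
    (LinearMap.toContinuousLinearMap (C.bracket g)).hasFDerivAt
  have h2 : HasFDerivAt (C.mul g) (ContinuousLinearMap.id ℝ 𝔤 +
      (1 / 2 : ℝ) • LinearMap.toContinuousLinearMap (C.bracket g)) h :=
    ((hasFDerivAt_id h).const_add g).add (hb.const_smul (1 / 2 : ℝ))
  rw [dLeft, h2.fderiv]
  rfl

theorem metric_frame (C : StepTwoCarnot 𝔤 m k) (g : 𝔤) (a b : Fin m ⊕ Fin k) :
    C.metric g (C.frame a g) (C.frame b g) = if a = b then 1 else 0 := by
  have h : ∀ c, C.dLeft (-g) g (C.frame c g) = C.basis c := by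
    intro c
    simp [frame, dLeft_eq, C.bracket_bracket]
  rw [metric, h, h]
  exact orthonormal_iff_ite.1 C.basis.orthonormal a b

/-- The Riemannian gradient `∇φ`, expressed in the orthonormal frame. -/
def gradient (C : StepTwoCarnot 𝔤 m k) (φ : 𝔤 → ℝ) (g : 𝔤) : 𝔤 :=
  ∑ a, fderiv ℝ φ g (C.frame a g) • C.frame a g

end Frame

section Functions

/-- The derivative `X_i u (g) = d/dt u(g exp(t e_i))` at `t = 0`. -/
def D (C : StepTwoCarnot 𝔤 m k) (i : Fin m) (u : 𝔤 → ℝ) (g : 𝔤) : ℝ :=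
  deriv (fun t : ℝ => u (C.mul g (t • C.basis (Sum.inl i)))) 0

/-- `u` is differentiable at `g` in the direction of `X_i`. -/
def DiffAt (C : StepTwoCarnot 𝔤 m k) (i : Fin m) (u : 𝔤 → ℝ) (g : 𝔤) : Prop :=
  DifferentiableAt ℝ (fun t : ℝ => u (C.mul g (t • C.basis (Sum.inl i)))) 0

/-- The Folland-Stein class `Γⁿ(Ω)`, `Ω` open: the horizontal derivatives of `u` of order at most
`n` exist and are continuous in `Ω`. -/
def Gamma (C : StepTwoCarnot 𝔤 m k) (Ω : Set 𝔤) : ℕ → (𝔤 → ℝ) → Prop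
  | 0, u => ContinuousOn u Ω
  | n + 1, u => ContinuousOn u Ω ∧ ∀ i, (∀ g ∈ Ω, C.DiffAt i u g) ∧ C.Gamma Ω n (C.D i u)

/-- The horizontal derivatives of `u` of order at most `n` exist in `Ω` and extend continuously
to the closure of `Ω`. -/
def ExtendsUpTo (C : StepTwoCarnot 𝔤 m k) (Ω : Set 𝔤) : ℕ → (𝔤 → ℝ) → Prop
  | 0, u => ∃ v, ContinuousOn v (closure Ω) ∧ EqOn v u Ω
  | n + 1, u => (∃ v, ContinuousOn v (closure Ω) ∧ EqOn v u Ω) ∧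
      ∀ i, (∀ g ∈ Ω, C.DiffAt i u g) ∧ C.ExtendsUpTo Ω n (C.D i u)

/-- The Folland-Stein class `Γⁿ` of the closure of the open set `Ω`. -/
def GammaClosure (C : StepTwoCarnot 𝔤 m k) (Ω : Set 𝔤) (n : ℕ) (u : 𝔤 → ℝ) : Prop :=
  ContinuousOn u (closure Ω) ∧ C.ExtendsUpTo Ω n u

/-- The class `Γⁿ₀(Ω)` of the functions in `Γⁿ(Ω)` with compact support in `Ω`. -/
def GammaCompact (C : StepTwoCarnot 𝔤 m k) (Ω : Set 𝔤) (n : ℕ) (u : 𝔤 → ℝ) : Prop :=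
  C.Gamma Ω n u ∧ HasCompactSupport u ∧ tsupport u ⊆ Ω

/-- The horizontal Laplacian `Δ_H u = ∑ X_i X_i u`. -/
def laplacian (C : StepTwoCarnot 𝔤 m k) (u : 𝔤 → ℝ) (g : 𝔤) : ℝ :=
  ∑ i, C.D i (C.D i u) g

/-- The entries `u_{,ij} = (X_i X_j u + X_j X_i u) / 2` of the symmetrized horizontal Hessian. -/
def hessian (C : StepTwoCarnot 𝔤 m k) (u : 𝔤 → ℝ) (g : 𝔤) : Matrix (Fin m) (Fin m) ℝ :=
  fun i j => (C.D i (C.D j u) g + C.D j (C.D i u) g) / 2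

/-- The squared Hilbert-Schmidt norm `‖∇²_H u‖²`. -/
def hessianNormSq (C : StepTwoCarnot 𝔤 m k) (u : 𝔤 → ℝ) (g : 𝔤) : ℝ :=
  ∑ i, ∑ j, (C.hessian u g i j) ^ 2

/-- The commutator `[X_i, X_j] u`. -/
def comm (C : StepTwoCarnot 𝔤 m k) (i j : Fin m) (u : 𝔤 → ℝ) (g : 𝔤) : ℝ :=
  C.D i (C.D j u) g - C.D j (C.D i u) g

/-- The squared length `|∇_H u|²` on the closure of `Ω`; at boundary points the derivatives
`X_i u` are the limits of their values in `Ω`. -/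
def horizontalGradientSq (C : StepTwoCarnot 𝔤 m k) (Ω : Set 𝔤) (u : 𝔤 → ℝ) (g : 𝔤) : ℝ :=
  ∑ i, (extendFrom Ω (C.D i u) g) ^ 2

end Functions

section Boundary

open Classical in
/-- The Riemannian outer unit normal `ν = ∇φ / |∇φ|` of a `C²` domain, `φ` being a local defining
function (the result does not depend on which one). -/
def normal (C : StepTwoCarnot 𝔤 m k) (Ω : Set 𝔤) (p : 𝔤) : 𝔤 :=
  if h : ∃ φ : 𝔤 → ℝ, IsLocalDefining Ω p φ then
    (Real.sqrt (C.metric p (C.gradient h.choose p) (C.gradient h.choose p)))⁻¹ •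
      C.gradient h.choose p
  else 0

/-- The components `⟨ν, X_j⟩` of the horizontal normal `N^H = ∑ ⟨ν, X_j⟩ X_j`. -/
def horizontalNormal (C : StepTwoCarnot 𝔤 m k) (Ω : Set 𝔤) (p : 𝔤) :
    EuclideanSpace ℝ (Fin m) :=
  WithLp.toLp 2 fun j => C.metric p (C.normal Ω p) (C.X j p)

/-- The angle function `W = |N^H|`. -/
def angle (C : StepTwoCarnot 𝔤 m k) (Ω : Set 𝔤) (p : 𝔤) : ℝ := ‖C.horizontalNormal Ω p‖

/-- The characteristic set of `Ω`. -/
def characteristicSet (C : StepTwoCarnot 𝔤 m k) (Ω : Set 𝔤) : Set 𝔤 :=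
  {p ∈ frontier Ω | C.angle Ω p = 0}

/-- The components of the horizontal Gauss map `ν^H = N^H / |N^H|`. -/
def gaussMap (C : StepTwoCarnot 𝔤 m k) (Ω : Set 𝔤) (p : 𝔤) : EuclideanSpace ℝ (Fin m) :=
  (C.angle Ω p)⁻¹ • C.horizontalNormal Ω p

/-- The horizontal Levi-Civita connection: a horizontal vector field `∑ Y_j X_j` is given by its
components, and `∇^H_Y Z` has the components `Y(Z_l)`. -/
def connection (C : StepTwoCarnot 𝔤 m k) (Y Z : 𝔤 → EuclideanSpace ℝ (Fin m)) (g : 𝔤) :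
    EuclideanSpace ℝ (Fin m) :=
  fderiv ℝ Z g (∑ j, Y g j • C.X j g)

/-- Horizontal vector fields `e₁, …, e_{m-1}` of class `C¹` near `p` which on `∂Ω`, near `p`, form
an orthonormal basis of the horizontal tangent bundle `T∂Ω ∩ HG`. -/
def IsTangentFrame (C : StepTwoCarnot 𝔤 m k) (Ω : Set 𝔤) (p : 𝔤)
    (e : Fin (m - 1) → 𝔤 → EuclideanSpace ℝ (Fin m)) : Prop :=
  (∀ a, ContDiffAt ℝ 1 (e a) p) ∧
    ∀ᶠ g in 𝓝[frontier Ω] p, Orthonormal ℝ (fun a => e a g) ∧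
      ∀ a, C.metric g (C.normal Ω g) (∑ j, e a g j • C.X j g) = 0

open Classical in
/-- The `H`-mean curvature off the characteristic set, `-∑ ⟨∇^H_{e_a} e_a, ν^H⟩` for an
orthonormal frame `e₁, …, e_{m-1}` of the horizontal tangent bundle (the result does not depend
on which one). As `ν^H` points outwards, the sign makes it nonnegative for convex sets. -/
def meanCurvatureAux (C : StepTwoCarnot 𝔤 m k) (Ω : Set 𝔤) (p : 𝔤) : ℝ :=
  if h : ∃ e, C.IsTangentFrame Ω p e then
    -∑ a, inner ℝ (C.connection (h.choose a) (h.choose a) p) (C.gaussMap Ω p)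
  else 0

open Classical in
/-- The `H`-mean curvature of `∂Ω`; at characteristic points it is the limit of the values at
noncharacteristic points (arbitrary if there is no limit). -/
def meanCurvature (C : StepTwoCarnot 𝔤 m k) (Ω : Set 𝔤) (p : 𝔤) : ℝ :=
  if p ∈ C.characteristicSet Ω then
    limUnder (𝓝[frontier Ω \ C.characteristicSet Ω] p) (C.meanCurvatureAux Ω)
  else C.meanCurvatureAux Ω p

/-- `ψ : U → S` is an injective `C¹` immersion from an open subset of `ℝ^(N-1)`, `N = m + k`. -/
def IsParametrization (_C : StepTwoCarnot 𝔤 m k) (S : Set 𝔤)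
    (U : Set (EuclideanSpace ℝ (Fin (m + k - 1))))
    (ψ : EuclideanSpace ℝ (Fin (m + k - 1)) → 𝔤) : Prop :=
  IsOpen U ∧ ContDiffOn ℝ 1 ψ U ∧ InjOn ψ U ∧ MapsTo ψ U S ∧
    ∀ x ∈ U, Function.Injective (fderiv ℝ ψ x)

/-- The Riemannian area element `√det ⟨∂_a ψ, ∂_b ψ⟩` of a parametrization. -/
def areaElement (C : StepTwoCarnot 𝔤 m k)
    (ψ : EuclideanSpace ℝ (Fin (m + k - 1)) → 𝔤)
    (x : EuclideanSpace ℝ (Fin (m + k - 1))) : ℝ :=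
  Real.sqrt (Matrix.det (Matrix.of fun a b : Fin (m + k - 1) =>
    C.metric (ψ x) (fderiv ℝ ψ x (EuclideanSpace.single a 1))
      (fderiv ℝ ψ x (EuclideanSpace.single b 1))))

/-- The Riemannian surface measure of a hypersurface `S`: the measure which on the image of each
parametrization is the push-forward of the area element. It is written as the least measure that
dominates these push-forwards, each of which is its restriction to the image. -/
def surfaceMeasure (C : StepTwoCarnot 𝔤 m k) [MeasurableSpace 𝔤] (S : Set 𝔤) : Measure 𝔤 :=
  ⨆ (U : Set (EuclideanSpace ℝ (Fin (m + k - 1))))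
    (ψ : EuclideanSpace ℝ (Fin (m + k - 1)) → 𝔤) (_ : C.IsParametrization S U ψ),
    Measure.map ψ
      ((volume.restrict U).withDensity fun x => ENNReal.ofReal (C.areaElement ψ x))

/-- The `H`-perimeter measure `dσ_H = W dσ` on `∂Ω`. -/
def perimeterMeasure (C : StepTwoCarnot 𝔤 m k) [MeasurableSpace 𝔤] (Ω : Set 𝔤) : Measure 𝔤 :=
  (C.surfaceMeasure (frontier Ω)).withDensity fun p => ENNReal.ofReal (C.angle Ω p)

end Boundary

end StepTwoCarnot

end

namespace StepTwoCarnot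

variable {𝔤 : Type*} [NormedAddCommGroup 𝔤] [InnerProductSpace ℝ 𝔤] {m k : ℕ}

/-! ### Left-invariant fields in exponential coordinates. -/

section Frame

/-! Write A_ij = X_i X_j u. Splitting A into its symmetric and skew parts shows that the Hessian
term minus the Laplacian and commutator terms is `divSource`, that is, Σ A_ij A_ji − (tr A)² − ½ Σ
(A_ij − A_ji)². For smooth u this is the horizontal divergence of `flux`, with components Σ_i X_i u
(X_i X_j u + [X_i,X_j]u) − X_j u Δ_H u. Step two enters here: a commutator is a derivative in a
constant central direction, so it commutes with every X_l. Hence X_j maps the factor in parentheses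
to X_i X_j X_j u, and after summation all third-order terms cancel (`sum_D_flux`).

A function of class Γ² has no third derivatives, so the identity is used in the weak form
`integral_divSource_eq_zero`. It passes to Γ² by cutoff and group convolution: the latter averages
left translates, hence commutes with the X_i, and only the convergence of second derivatives is
needed. Statement (ii) follows by testing with a function equal to one near the support of u
(`integral_divSource_of_compact`).

For (i), the flux is continuous up to the boundary, and the weak identity becomes a Gauss-Green
formula (`integral_gaussGreen`): test with χ Θ(−φ/ε), φ a local defining function, and let ε tend to
zero. The layer integrals converge to integrals over the graph {φ = 0}, which
`surfaceMeasure_restrict` identifies with integrals against σ. Characteristic points need no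
estimate, because the boundary integrand Σ ⟨ν,X_j⟩ flux_j is continuous and vanishes where W = 0.

It remains to see that this integrand is −W H |∇_H u|² where W ≠ 0
(`sum_horizontalNormal_mul_flux`). Since u = 0 on the boundary, ∇_H u = l N^H there; the commutators
drop out by skew symmetry, and what is left is −l W² times the trace of A over the horizontal
tangent space. Differentiating Σ_j e_j X_j u = 0 along a tangent field e turns that trace into −l
Σ_a ⟨∇^H_{e_a} e_a, N^H⟩. Derivatives along the boundary are justified by
`Gamma.hasDerivAt_of_push`: a horizontal curve in the boundary is pushed into Ω by small left
translations, which preserve its horizontal components; there the fundamental theorem of calculus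
`Gamma.integral_along` applies, and its limit lives on the boundary. -/

theorem X_eq (C : StepTwoCarnot 𝔤 m k) (j : Fin m) (g : 𝔤) :
    C.X j g = C.basis (Sum.inl j) + (1 / 2 : ℝ) • C.bracket g (C.basis (Sum.inl j)) := by
  rw [X, frame, dLeft_eq]

theorem mul_smul_basis (C : StepTwoCarnot 𝔤 m k) (j : Fin m) (g : 𝔤) (t : ℝ) :
    C.mul g (t • C.basis (Sum.inl j)) = g + t • C.X j g := by
  rw [mul, X_eq, map_smul, smul_add, smul_comm t, add_assoc]

theorem bracket_left_of_mem_V₂ (C : StepTwoCarnot 𝔤 m k) {z : 𝔤} (hz : z ∈ C.V₂) (x : 𝔤) :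
    C.bracket z x = 0 := by
  rw [C.bracket_skew, C.bracket_V₂ x hz, neg_zero]

theorem bracket_X (C : StepTwoCarnot 𝔤 m k) (i : Fin m) (g x : 𝔤) :
    C.bracket (C.X i g) x = C.bracket (C.basis (Sum.inl i)) x := by
  rw [X_eq, map_add, LinearMap.add_apply, map_smul, LinearMap.smul_apply,
    C.bracket_left_of_mem_V₂ (C.bracket_mem _ _), smul_zero, add_zero]

/-- Moving along X_j changes the bracket term of X_j by [e_j, e_j] = 0 up to brackets with the
second layer, which vanish. So the integral curves of X_j are straight lines, and derivatives along
them can be taken at any time. -/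
theorem X_flow (C : StepTwoCarnot 𝔤 m k) (j : Fin m) (g : 𝔤) (t : ℝ) :
    C.X j (g + t • C.X j g) = C.X j g := by
  rw [X_eq, map_add, LinearMap.add_apply, map_smul, LinearMap.smul_apply, bracket_X,
    C.bracket_self, smul_zero, add_zero, X_eq]

/-- Both sides reduce to e_j + ½[h, e_j] + ½[g, e_j], all iterated brackets being zero. This left
invariance is what keeps translated horizontal curves horizontal. -/
theorem X_mul (C : StepTwoCarnot 𝔤 m k) (j : Fin m) (h g : 𝔤) :
    C.X j (C.mul h g) = C.dLeft h g (C.X j g) := by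
  rw [dLeft_eq, X_eq, X_eq, mul]
  simp only [map_add, map_smul, LinearMap.add_apply, LinearMap.smul_apply, C.bracket_bracket,
    C.bracket_left_of_mem_V₂ (C.bracket_mem h g), smul_zero, add_zero, smul_add]
  abel

variable [FiniteDimensional ℝ 𝔤]

/-- The bracket as a continuous bilinear map. -/
noncomputable def bracketL (C : StepTwoCarnot 𝔤 m k) : 𝔤 →L[ℝ] 𝔤 →L[ℝ] 𝔤 :=
  LinearMap.toContinuousLinearMap
    ((LinearMap.toContinuousLinearMap : (𝔤 →ₗ[ℝ] 𝔤) ≃ₗ[ℝ] 𝔤 →L[ℝ] 𝔤).toLinearMap ∘ₗ C.bracket)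

theorem bracketL_apply (C : StepTwoCarnot 𝔤 m k) (x y : 𝔤) :
    C.bracketL x y = C.bracket x y := rfl

theorem contDiff_mul (C : StepTwoCarnot 𝔤 m k) {n : WithTop ℕ∞} :
    ContDiff ℝ n fun p : 𝔤 × 𝔤 => C.mul p.1 p.2 := by
  simp only [mul, ← bracketL_apply]
  fun_prop

theorem continuous_mul (C : StepTwoCarnot 𝔤 m k) :
    Continuous fun p : 𝔤 × 𝔤 => C.mul p.1 p.2 :=
  (C.contDiff_mul (n := 0)).continuous

theorem contDiff_X (C : StepTwoCarnot 𝔤 m k) (j : Fin m) {n : WithTop ℕ∞} :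
    ContDiff ℝ n (C.X j) := by
  simp only [funext (C.X_eq j), ← bracketL_apply]
  fun_prop

theorem hasFDerivAt_X (C : StepTwoCarnot 𝔤 m k) (j : Fin m) (g : 𝔤) :
    HasFDerivAt (C.X j) ((1 / 2 : ℝ) • C.bracketL.flip (C.basis (Sum.inl j))) g := by
  simp only [funext (C.X_eq j), ← bracketL_apply]
  exact ((C.bracketL.flip (C.basis (Sum.inl j))).hasFDerivAt.const_smul (1 / 2 : ℝ)).const_add _

end Frame

/-! ### Calculus of horizontal derivatives and commutators. -/

section Derivatives

theorem diffAt_iff (C : StepTwoCarnot 𝔤 m k) {j : Fin m} {u : 𝔤 → ℝ} {g : 𝔤} :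
    C.DiffAt j u g ↔ DifferentiableAt ℝ (fun t : ℝ => u (g + t • C.X j g)) 0 := by
  simp only [DiffAt, mul_smul_basis]

theorem D_eq (C : StepTwoCarnot 𝔤 m k) (j : Fin m) (u : 𝔤 → ℝ) (g : 𝔤) :
    C.D j u g = deriv (fun t : ℝ => u (g + t • C.X j g)) 0 := by
  simp only [D, mul_smul_basis]

theorem DiffAt.hasDerivAt {C : StepTwoCarnot 𝔤 m k} {j : Fin m} {u : 𝔤 → ℝ} {g : 𝔤}
    (h : C.DiffAt j u g) : HasDerivAt (fun t : ℝ => u (g + t • C.X j g)) (C.D j u g) 0 := by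
  rw [D_eq]
  exact (C.diffAt_iff.1 h).hasDerivAt

theorem diffAt_of_hasDerivAt (C : StepTwoCarnot 𝔤 m k) {j : Fin m} {u : 𝔤 → ℝ} {g : 𝔤} {d : ℝ}
    (h : HasDerivAt (fun t : ℝ => u (g + t • C.X j g)) d 0) :
    C.DiffAt j u g ∧ C.D j u g = d :=
  ⟨C.diffAt_iff.2 h.differentiableAt, by rw [D_eq, h.deriv]⟩

theorem DiffAt.hasDerivAt_flow {C : StepTwoCarnot 𝔤 m k} {j : Fin m} {u : 𝔤 → ℝ} {g : 𝔤} {t : ℝ}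
    (h : C.DiffAt j u (g + t • C.X j g)) :
    HasDerivAt (fun t : ℝ => u (g + t • C.X j g)) (C.D j u (g + t • C.X j g)) t := by
  have h1 := h.hasDerivAt
  rw [X_flow] at h1
  have h2 : HasDerivAt (fun s : ℝ => s - t) 1 t := (hasDerivAt_id t).sub_const t
  have h3 := HasDerivAt.comp (h₂ := fun s : ℝ => u (g + t • C.X j g + s • C.X j g)) t
    (by simpa using h1) h2
  simp only [mul_one] at h3
  refine h3.congr_of_eventuallyEq (Eventually.of_forall fun s => ?_)
  simp only [Function.comp]
  congr 1
  rw [sub_smul]; abel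

theorem tendsto_flow (C : StepTwoCarnot 𝔤 m k) (j : Fin m) (g : 𝔤) :
    Tendsto (fun t : ℝ => g + t • C.X j g) (𝓝 0) (𝓝 g) := by
  have : Continuous fun t : ℝ => g + t • C.X j g := by fun_prop
  simpa using this.tendsto 0

theorem DiffAt.congr {C : StepTwoCarnot 𝔤 m k} {j : Fin m} {u v : 𝔤 → ℝ} {g : 𝔤}
    (h : C.DiffAt j u g) (huv : u =ᶠ[𝓝 g] v) : C.DiffAt j v g ∧ C.D j v g = C.D j u g := by
  apply C.diffAt_of_hasDerivAt
  exact h.hasDerivAt.congr_of_eventuallyEq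
    ((C.tendsto_flow j g).eventually (huv.mono fun _ h => h.symm))

theorem D_congr (C : StepTwoCarnot 𝔤 m k) {j : Fin m} {u v : 𝔤 → ℝ} {g : 𝔤}
    (huv : u =ᶠ[𝓝 g] v) : C.D j u g = C.D j v g := by
  rw [D_eq, D_eq]
  exact Filter.EventuallyEq.deriv_eq ((C.tendsto_flow j g).eventually huv)

theorem D_eventuallyEq (C : StepTwoCarnot 𝔤 m k) (j : Fin m) {u v : 𝔤 → ℝ} {g : 𝔤}
    (huv : u =ᶠ[𝓝 g] v) : C.D j u =ᶠ[𝓝 g] C.D j v :=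
  huv.eventuallyEq_nhds.mono fun _ h => C.D_congr h

theorem tsupport_D_subset (C : StepTwoCarnot 𝔤 m k) (j : Fin m) (u : 𝔤 → ℝ) :
    tsupport (C.D j u) ⊆ tsupport u := by
  refine closure_minimal (fun g hg => ?_) (isClosed_tsupport u)
  by_contra h
  apply hg
  rw [C.D_congr (v := fun _ => 0) (notMem_tsupport_iff_eventuallyEq.1 h), D_eq]
  simp

theorem DiffAt.add {C : StepTwoCarnot 𝔤 m k} {j : Fin m} {u v : 𝔤 → ℝ} {g : 𝔤}
    (hu : C.DiffAt j u g) (hv : C.DiffAt j v g) :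
    C.DiffAt j (fun x => u x + v x) g ∧
      C.D j (fun x => u x + v x) g = C.D j u g + C.D j v g :=
  C.diffAt_of_hasDerivAt (hu.hasDerivAt.add hv.hasDerivAt)

theorem DiffAt.mul {C : StepTwoCarnot 𝔤 m k} {j : Fin m} {u v : 𝔤 → ℝ} {g : 𝔤}
    (hu : C.DiffAt j u g) (hv : C.DiffAt j v g) :
    C.DiffAt j (fun x => u x * v x) g ∧
      C.D j (fun x => u x * v x) g = C.D j u g * v g + u g * C.D j v g := by
  have h := hu.hasDerivAt.mul hv.hasDerivAt
  simp only [zero_smul, add_zero] at h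
  exact C.diffAt_of_hasDerivAt h

theorem diffAt_of_differentiableAt (C : StepTwoCarnot 𝔤 m k) (j : Fin m) {f : 𝔤 → ℝ} {g : 𝔤}
    (hf : DifferentiableAt ℝ f g) : C.DiffAt j f g ∧ C.D j f g = fderiv ℝ f g (C.X j g) := by
  apply C.diffAt_of_hasDerivAt
  have h1 : HasDerivAt (fun t : ℝ => g + t • C.X j g) (C.X j g) 0 := by
    simpa using ((hasDerivAt_id (0 : ℝ)).smul_const (C.X j g)).const_add g
  have h2 : HasFDerivAt f (fderiv ℝ f g) (g + (0 : ℝ) • C.X j g) := by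
    simpa using hf.hasFDerivAt
  exact h2.comp_hasDerivAt 0 h1

theorem D_eq_fderiv (C : StepTwoCarnot 𝔤 m k) (j : Fin m) {f : 𝔤 → ℝ} {g : 𝔤}
    (hf : DifferentiableAt ℝ f g) : C.D j f g = fderiv ℝ f g (C.X j g) :=
  (C.diffAt_of_differentiableAt j hf).2

theorem symm_fderiv_fderiv {f : 𝔤 → ℝ} (hf : ContDiff ℝ 2 f) (g v w : 𝔤) :
    fderiv ℝ (fderiv ℝ f) g v w = fderiv ℝ (fderiv ℝ f) g w v :=
  (hf.contDiffAt.isSymmSndFDerivAt (by simp)) v w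

variable [FiniteDimensional ℝ 𝔤]

theorem contDiff_D (C : StepTwoCarnot 𝔤 m k) (j : Fin m) {n : ℕ} {f : 𝔤 → ℝ}
    (hf : ContDiff ℝ (n + 1 : ℕ) f) : ContDiff ℝ n (C.D j f) := by
  have h : C.D j f = fun g => fderiv ℝ f g (C.X j g) :=
    funext fun g => C.D_eq_fderiv j (hf.differentiable (by simp) g)
  rw [h]
  exact (hf.fderiv_right (by norm_cast)).clm_apply (C.contDiff_X j)

theorem fderiv_D (C : StepTwoCarnot 𝔤 m k) (j : Fin m) {f : 𝔤 → ℝ} (hf : ContDiff ℝ 2 f)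
    (g v : 𝔤) : fderiv ℝ (C.D j f) g v = fderiv ℝ (fderiv ℝ f) g v (C.X j g) +
      fderiv ℝ f g ((1 / 2 : ℝ) • C.bracket v (C.basis (Sum.inl j))) := by
  have h : C.D j f = fun g => fderiv ℝ f g (C.X j g) :=
    funext fun g => C.D_eq_fderiv j (hf.differentiable (by simp) g)
  have h1 : HasFDerivAt (fderiv ℝ f) (fderiv ℝ (fderiv ℝ f) g) g :=
    ((hf.fderiv_right (m := 1) (by norm_num)).differentiable (by simp) g).hasFDerivAt
  rw [h, (h1.clm_apply (C.hasFDerivAt_X j g)).fderiv]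
  simp [bracketL_apply, add_comm]

/-- The second differential of f cancels by symmetry. Only the derivatives of the coefficients of
the fields remain, two halves which add up to a full bracket by skew symmetry. -/
theorem comm_eq (C : StepTwoCarnot 𝔤 m k) (i j : Fin m) {f : 𝔤 → ℝ} (hf : ContDiff ℝ 2 f) (g : 𝔤) :
    C.D i (C.D j f) g - C.D j (C.D i f) g =
      fderiv ℝ f g (C.bracket (C.basis (Sum.inl i)) (C.basis (Sum.inl j))) := by
  have hd : ∀ l, Differentiable ℝ (C.D l f) := fun l =>
    (C.contDiff_D (n := 1) l hf).differentiable (by simp)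
  rw [C.D_eq_fderiv i (hd j g), C.D_eq_fderiv j (hd i g), C.fderiv_D _ hf, C.fderiv_D _ hf,
    C.bracket_X, C.bracket_X, symm_fderiv_fderiv hf g (C.X i g) (C.X j g),
    C.bracket_skew (C.basis (Sum.inl j)) (C.basis (Sum.inl i))]
  simp only [map_smul, map_neg, smul_eq_mul]
  ring

/-- A constant field with value in the second layer commutes with X_l, since X_l does not vary in
central directions. -/
theorem D_fderiv_apply (C : StepTwoCarnot 𝔤 m k) (l : Fin m) {f : 𝔤 → ℝ} (hf : ContDiff ℝ 2 f)
    {z : 𝔤} (hz : z ∈ C.V₂) (g : 𝔤) :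
    C.D l (fun x => fderiv ℝ f x z) g = fderiv ℝ (C.D l f) g z := by
  have h1 : HasFDerivAt (fderiv ℝ f) (fderiv ℝ (fderiv ℝ f) g) g :=
    ((hf.fderiv_right (m := 1) (by norm_num)).differentiable (by simp) g).hasFDerivAt
  have h2 := h1.clm_apply (hasFDerivAt_const z g)
  rw [C.D_eq_fderiv l h2.differentiableAt, h2.fderiv, C.fderiv_D _ hf,
    C.bracket_left_of_mem_V₂ hz, symm_fderiv_fderiv hf g z]
  simp

/-- Commutators are derivatives in constant central directions, so X_l passes through them. This is
the only identity between third derivatives used in the proof. -/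
theorem D_comm (C : StepTwoCarnot 𝔤 m k) (i j l : Fin m) {f : 𝔤 → ℝ} (hf : ContDiff ℝ 3 f) (g : 𝔤) :
    C.D l (fun x => C.D i (C.D j f) x - C.D j (C.D i f) x) g =
      C.D i (C.D j (C.D l f)) g - C.D j (C.D i (C.D l f)) g := by
  have hf2 : ContDiff ℝ 2 f := hf.of_le (by norm_num)
  rw [C.comm_eq i j (C.contDiff_D (n := 2) l hf), ← C.D_fderiv_apply l hf2 (C.bracket_mem _ _)]
  congr 1
  exact funext fun x => C.comm_eq i j hf2 x

end Derivatives

/-! ### Invariance of Lebesgue measure. -/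

section HaarMeasure

variable [FiniteDimensional ℝ 𝔤]

/-- With P the orthogonal projection onto the second layer, N² = 0 and P N = N give (1 + P)(1 + N) =
(1 + N)²(1 + P). Both factors are invertible, with inverses 1 − P/2 and 1 − N, so the determinant d
of 1 + N satisfies d = d² ≠ 0. No triangular matrix has to be written down. -/
theorem det_one_add (C : StepTwoCarnot 𝔤 m k) {N : 𝔤 →ₗ[ℝ] 𝔤} (h1 : ∀ x, N x ∈ C.V₂)
    (h2 : ∀ z ∈ C.V₂, N z = 0) : LinearMap.det (LinearMap.id + N) = 1 := by
  let P : 𝔤 →ₗ[ℝ] 𝔤 := (C.V₂.starProjection : 𝔤 →L[ℝ] 𝔤)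
  have hP : ∀ x, P x ∈ C.V₂ := fun x => C.V₂.starProjection_apply_mem x
  have hP2 : ∀ z ∈ C.V₂, P z = z := fun z hz => Submodule.starProjection_eq_self_iff.2 hz
  have hS : LinearMap.det (LinearMap.id + P) ≠ 0 := by
    intro h0
    have : (LinearMap.id + P) ∘ₗ (LinearMap.id - (1 / 2 : ℝ) • P) = LinearMap.id := by
      ext x
      simp [hP2 _ (hP x)]
      module
    have h := congrArg LinearMap.det this
    rw [LinearMap.det_comp, h0, LinearMap.det_id, MulZeroClass.zero_mul] at h
    exact zero_ne_one h
  have hI : LinearMap.det (LinearMap.id + N) ≠ 0 := by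
    intro h0
    have : (LinearMap.id + N) ∘ₗ (LinearMap.id - N) = LinearMap.id := by
      ext x
      simp [h2 _ (h1 x)]
    have h := congrArg LinearMap.det this
    rw [LinearMap.det_comp, h0, LinearMap.det_id, MulZeroClass.zero_mul] at h
    exact zero_ne_one h
  have key : (LinearMap.id + P) ∘ₗ (LinearMap.id + N) =
      (LinearMap.id + N) ∘ₗ (LinearMap.id + N) ∘ₗ (LinearMap.id + P) := by
    ext x
    simp [hP2 _ (h1 x), h2 _ (h1 x), h2 _ (hP x)]
    abel
  have h := congrArg LinearMap.det key
  simp only [LinearMap.det_comp] at h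
  have h' : LinearMap.det (LinearMap.id + N) * LinearMap.det (LinearMap.id + P) *
      (LinearMap.det (LinearMap.id + N) - 1) = 0 := by linear_combination -h
  rcases mul_eq_zero.1 h' with h | h
  · rcases mul_eq_zero.1 h with h | h
    · exact absurd h hI
    · exact absurd h hS
  · linarith

variable [MeasurableSpace 𝔤] [BorelSpace 𝔤]

theorem measurePreserving_add_id_add (C : StepTwoCarnot 𝔤 m k) {N : 𝔤 →ₗ[ℝ] 𝔤}
    (h1 : ∀ x, N x ∈ C.V₂) (h2 : ∀ z ∈ C.V₂, N z = 0) (c : 𝔤) :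
    MeasurePreserving (fun x => c + (x + N x)) (volume : Measure 𝔤) volume := by
  have hN : MeasurePreserving (LinearMap.id + N : 𝔤 →ₗ[ℝ] 𝔤) (volume : Measure 𝔤) volume := by
    refine ⟨(LinearMap.continuous_of_finiteDimensional _).measurable, ?_⟩
    rw [Measure.map_linearMap_addHaar_eq_smul_addHaar _ (by simp [C.det_one_add h1 h2]),
      C.det_one_add h1 h2]
    simp
  exact (measurePreserving_add_left volume c).comp hN

theorem measurePreserving_flow (C : StepTwoCarnot 𝔤 m k) (j : Fin m) (t : ℝ) :
    MeasurePreserving (fun g => g + t • C.X j g) (volume : Measure 𝔤) volume := by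
  have h := C.measurePreserving_add_id_add
    (N := (t / 2) • C.bracket.flip (C.basis (Sum.inl j)))
    (fun x => C.V₂.smul_mem _ (C.bracket_mem _ _))
    (fun z hz => by simp [C.bracket_left_of_mem_V₂ hz]) (t • C.basis (Sum.inl j))
  convert h using 2 with g
  rw [X_eq]
  simp
  module

/-- The substitution h ↦ g h⁻¹ exchanges the two forms of the group convolution. -/
theorem measurePreserving_mul_neg (C : StepTwoCarnot 𝔤 m k) (g : 𝔤) :
    MeasurePreserving (fun h => C.mul g (-h)) (volume : Measure 𝔤) volume := by
  have h := (C.measurePreserving_add_id_add (N := (1 / 2 : ℝ) • C.bracket g)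
    (fun x => C.V₂.smul_mem _ (C.bracket_mem _ _))
    (fun z hz => by simp [C.bracket_V₂ _ hz]) g).comp (Measure.measurePreserving_neg volume)
  convert h using 2 with x
  simp [mul]
  module

end HaarMeasure

end StepTwoCarnot

/-! ### Cutoff functions and the classes Γⁿ. -/

/-- Having the value one on a neighbourhood of K, and not only on K, makes all derivatives of ζ u
and u agree on K. -/
theorem exists_contDiff_cutoff {E : Type*} [NormedAddCommGroup E] [NormedSpace ℝ E]
    [FiniteDimensional ℝ E] {K Ω : Set E} (hK : IsCompact K) (hΩ : IsOpen Ω) (hKΩ : K ⊆ Ω) :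
    ∃ ζ : E → ℝ, (∀ n : ℕ, ContDiff ℝ n ζ) ∧ HasCompactSupport ζ ∧ tsupport ζ ⊆ Ω ∧
      ∃ O, IsOpen O ∧ K ⊆ O ∧ EqOn ζ 1 O := by
  obtain ⟨L, hL, hKL, hLΩ⟩ := exists_compact_between hK hΩ hKΩ
  obtain ⟨L', hL', hKL', hL'L⟩ := exists_compact_between hK isOpen_interior hKL
  obtain ⟨f, h0, h1, -⟩ := exists_contMDiffMap_zero_one_of_isClosed (n := (⊤ : ℕ∞))
    (modelWithCornersSelf ℝ E)
    (isOpen_interior (s := L)).isClosed_compl hL'.isClosed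
    (disjoint_compl_left_iff_subset.2 hL'L)
  have hsupp : tsupport f ⊆ L :=
    closure_minimal (fun x hx => by
      by_contra hxL
      exact hx (h0 fun h => hxL (interior_subset h))) hL.isClosed
  refine ⟨f, fun n => f.contMDiff.contDiff.of_le (by exact_mod_cast le_top),
    hL.of_isClosed_subset (isClosed_tsupport _) hsupp, hsupp.trans hLΩ,
    interior L', isOpen_interior, hKL', fun x hx => h1 (interior_subset hx)⟩

namespace StepTwoCarnot

variable {𝔤 : Type*} [NormedAddCommGroup 𝔤] [InnerProductSpace ℝ 𝔤] {m k : ℕ}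

theorem mul_neg_cancel (C : StepTwoCarnot 𝔤 m k) (g h : 𝔤) :
    C.mul (-C.mul g (-h)) g = h := by
  have : -C.mul g (-h) = C.mul h (-g) := by
    simp only [mul, map_neg, C.bracket_skew h g]
    module
  rw [this, mul_assoc, neg_mul, mul_zero]

theorem mul_neg_mul_cancel (C : StepTwoCarnot 𝔤 m k) (g h : 𝔤) :
    C.mul (-g) (C.mul g h) = h := by
  rw [← mul_assoc, neg_mul, zero_mul]

section Gamma

theorem Gamma.continuousOn {C : StepTwoCarnot 𝔤 m k} {Ω : Set 𝔤} {n : ℕ} {u : 𝔤 → ℝ}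
    (h : C.Gamma Ω n u) : ContinuousOn u Ω := by
  cases n with
  | zero => exact h
  | succ n => exact h.1

theorem Gamma.of_succ {C : StepTwoCarnot 𝔤 m k} {Ω : Set 𝔤} {n : ℕ} {u : 𝔤 → ℝ}
    (h : C.Gamma Ω (n + 1) u) : C.Gamma Ω n u := by
  induction n generalizing u with
  | zero => exact h.1
  | succ n ih => exact ⟨h.1, fun i => ⟨(h.2 i).1, ih (h.2 i).2⟩⟩

theorem Gamma.add {C : StepTwoCarnot 𝔤 m k} {n : ℕ} {u v : 𝔤 → ℝ}
    (hu : C.Gamma univ n u) (hv : C.Gamma univ n v) : C.Gamma univ n fun x => u x + v x := by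
  induction n generalizing u v with
  | zero => exact ContinuousOn.add hu hv
  | succ n ih =>
    refine ⟨hu.1.add hv.1, fun i => ⟨fun g hg => (((hu.2 i).1 g hg).add ((hv.2 i).1 g hg)).1, ?_⟩⟩
    have : C.D i (fun x => u x + v x) = fun x => C.D i u x + C.D i v x :=
      funext fun g => (((hu.2 i).1 g trivial).add ((hv.2 i).1 g trivial)).2
    rw [this]
    exact ih (hu.2 i).2 (hv.2 i).2

theorem continuous_mul_of_tsupport_subset {X : Type*} [TopologicalSpace X] {Ω : Set X}
    (hΩ : IsOpen Ω) {ζ u : X → ℝ} (hζ : Continuous ζ) (hs : tsupport ζ ⊆ Ω)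
    (hu : ContinuousOn u Ω) : Continuous fun x => ζ x * u x := by
  rw [continuous_iff_continuousAt]
  intro x
  by_cases hx : x ∈ Ω
  · exact hζ.continuousAt.mul (hu.continuousAt (hΩ.mem_nhds hx))
  · have h0 := notMem_tsupport_iff_eventuallyEq.1 fun h => hx (hs h)
    refine (continuousAt_const (y := (0 : ℝ))).congr (h0.mono fun y hy => ?_)
    simp [hy]

variable [FiniteDimensional ℝ 𝔤]

/-- Induction with the Leibniz rule. Off Ω nothing is known about u, but there ζ, and with it the
product, vanishes on a neighbourhood. -/
theorem Gamma.cutoff {C : StepTwoCarnot 𝔤 m k} {Ω : Set 𝔤} (hΩ : IsOpen Ω) {n : ℕ} {u ζ : 𝔤 → ℝ}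
    (hu : C.Gamma Ω n u) (hζ : ContDiff ℝ n ζ) (hs : tsupport ζ ⊆ Ω) :
    C.Gamma univ n fun x => ζ x * u x := by
  induction n generalizing u ζ with
  | zero =>
    exact (continuous_mul_of_tsupport_subset hΩ hζ.continuous hs hu.continuousOn).continuousOn
  | succ n ih =>
    refine ⟨(continuous_mul_of_tsupport_subset hΩ hζ.continuous hs hu.continuousOn).continuousOn,
      fun i => ?_⟩
    have key : ∀ g, C.DiffAt i (fun x => ζ x * u x) g ∧
        C.D i (fun x => ζ x * u x) g = C.D i ζ g * u g + ζ g * C.D i u g := by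
      intro g
      by_cases hg : g ∈ Ω
      · exact (C.diffAt_of_differentiableAt i
          (hζ.differentiable (by simp) g)).1.mul ((hu.2 i).1 g hg)
      · have h0 := notMem_tsupport_iff_eventuallyEq.1 fun h => hg (hs h)
        have h1 : (fun _ => (0 : ℝ)) =ᶠ[𝓝 g] fun x => ζ x * u x := by
          filter_upwards [h0] with y hy
          simp [hy]
        have h2 := (C.diffAt_of_differentiableAt i
          (differentiableAt_const (0 : ℝ) : DifferentiableAt ℝ (fun _ : 𝔤 => (0 : ℝ)) g))
        have h3 := h2.1.congr h1
        refine ⟨h3.1, ?_⟩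
        rw [h3.2, h2.2, C.D_congr h0, C.D_eq_fderiv i (by exact differentiableAt_const _)]
        simp [h0.eq_of_nhds]
    refine ⟨fun g _ => (key g).1, ?_⟩
    rw [funext fun g => (key g).2]
    exact (ih hu.of_succ (C.contDiff_D i hζ) ((C.tsupport_D_subset i ζ).trans hs)).add
      (ih (hu.2 i).2 (hζ.of_le (by norm_cast; simp)) hs)

end Gamma

/-! ### Mollification by group convolution. -/

section Mollify

variable [MeasurableSpace 𝔤] [BorelSpace 𝔤] [FiniteDimensional ℝ 𝔤]

/-- The group convolution `∫ ρ(k) v(k⁻¹ g) dk`. -/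
noncomputable def mollify (C : StepTwoCarnot 𝔤 m k) (ρ v : 𝔤 → ℝ) (g : 𝔤) : ℝ :=
  ∫ h, ρ h * v (C.mul (-h) g)

/-- In this form the variable g enters through the smooth kernel only, which yields the regularity
of the mollified function. -/
theorem mollify_eq (C : StepTwoCarnot 𝔤 m k) {ρ v : 𝔤 → ℝ} (hρ : Continuous ρ) (hv : Continuous v)
    (g : 𝔤) : C.mollify ρ v g = ∫ h, v h * ρ (C.mul g (-h)) := by
  have hc : Continuous fun h => ρ h * v (C.mul (-h) g) :=
    hρ.mul (hv.comp (C.continuous_mul.comp (by fun_prop : Continuous fun h : 𝔤 => (-h, g))))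
  have hp := C.measurePreserving_mul_neg g
  have h := integral_map (μ := volume) hp.aemeasurable
    (hp.map_eq.symm ▸ hc.aestronglyMeasurable (μ := volume))
  rw [hp.map_eq] at h
  rw [mollify, h]
  simp only [mul_neg_cancel, mul_comm]

theorem contDiff_mollify (C : StepTwoCarnot 𝔤 m k) {ρ v : 𝔤 → ℝ} {n : ℕ} (hρ : ContDiff ℝ n ρ)
    (hρc : HasCompactSupport ρ) (hv : Continuous v) : ContDiff ℝ n (C.mollify ρ v) := by
  rw [contDiff_iff_contDiffAt]
  intro g₀
  -- For p in the unit ball about g₀, the kernel x ↦ ρ(p x) is supported in the set p⁻¹ · supp ρ;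
  -- these sets lie in one compact image.
  have hK : IsCompact ((fun p : 𝔤 × 𝔤 => C.mul (-p.1) p.2) ''
      (Metric.closedBall g₀ 1 ×ˢ tsupport ρ)) :=
    ((isCompact_closedBall g₀ 1).prod hρc).image
      (C.continuous_mul.comp (by fun_prop : Continuous fun p : 𝔤 × 𝔤 => (-p.1, p.2)))
  -- The integral is an ordinary convolution of v with the parameter-dependent kernel x ↦ ρ(p x),
  -- evaluated at the fixed point 0, where the argument of the kernel is −h.
  have h := contDiffOn_convolution_right_with_param_comp (n := n) (μ := (volume : Measure 𝔤))
    (ContinuousLinearMap.mul ℝ ℝ)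
    (s := Metric.ball g₀ 1) (v := fun _ => (0 : 𝔤)) contDiffOn_const (f := v)
    (g := fun p x => ρ (C.mul p x)) Metric.isOpen_ball hK
    (fun p x hp hx => by
      by_contra h0
      exact hx ⟨(p, C.mul p x), ⟨Metric.ball_subset_closedBall hp, subset_tsupport _ h0⟩,
        C.mul_neg_mul_cancel p x⟩)
    hv.locallyIntegrable (hρ.comp C.contDiff_mul).contDiffOn
  refine (h.contDiffAt (Metric.ball_mem_nhds g₀ one_pos)).congr_of_eventuallyEq
    (Eventually.of_forall fun g => ?_)
  rw [C.mollify_eq hρ.continuous hv]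
  simp [convolution_def]

/-- The convolution averages the left translates v(h⁻¹ ·), and X_j commutes with left translations
by associativity of the group law. So the derivative falls on v, and the kernel need only be
continuous with compact support. -/
theorem D_mollify (C : StepTwoCarnot 𝔤 m k) (j : Fin m) {ρ v : 𝔤 → ℝ} (hρ : Continuous ρ)
    (hρc : HasCompactSupport ρ) (hv : Continuous v) (hvc : HasCompactSupport v)
    (hd : ∀ g, C.DiffAt j v g) (hD : Continuous (C.D j v)) (g : 𝔤) :
    C.D j (C.mollify ρ v) g = C.mollify ρ (C.D j v) g := by
  have hDc : HasCompactSupport (C.D j v) :=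
    hvc.of_isClosed_subset (isClosed_tsupport _) (C.tsupport_D_subset j v)
  obtain ⟨M, hM⟩ := hDc.exists_bound_of_continuous hD
  have hflow : ∀ (h : 𝔤) (t : ℝ), C.mul (-h) (g + t • C.X j g) =
      C.mul (-h) g + t • C.X j (C.mul (-h) g) := by
    intro h t
    rw [← mul_smul_basis, ← mul_smul_basis, mul_assoc]
  have hc : ∀ w : 𝔤 → ℝ, Continuous w → ∀ t : ℝ,
      Continuous fun h => ρ h * w (C.mul (-h) (g + t • C.X j g)) := fun w hw t =>
    hρ.mul (hw.comp (C.continuous_mul.comp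
      (by fun_prop : Continuous fun h : 𝔤 => (-h, g + t • C.X j g))))
  have key := (hasDerivAt_integral_of_dominated_loc_of_deriv_le (μ := (volume : Measure 𝔤))
    (F := fun t h => ρ h * v (C.mul (-h) (g + t • C.X j g))) (x₀ := (0 : ℝ)) (s := univ)
    (F' := fun t h => ρ h * C.D j v (C.mul (-h) (g + t • C.X j g)))
    (bound := fun h => ‖ρ h‖ * M) univ_mem
    (Eventually.of_forall fun t => (hc v hv t).aestronglyMeasurable)
    ((hc v hv 0).integrable_of_hasCompactSupport hρc.mul_right)
    (hc _ hD 0).aestronglyMeasurable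
    (Eventually.of_forall fun h t _ => by
      rw [norm_mul]
      exact mul_le_mul_of_nonneg_left (hM _) (norm_nonneg _))
    (((hρ.integrable_of_hasCompactSupport hρc).norm).mul_const M)
    (Eventually.of_forall fun h t _ => by
      simp only [hflow]
      exact (hd _).hasDerivAt_flow.const_mul (ρ h))).2
  have h2 := (C.diffAt_of_hasDerivAt (j := j) (u := C.mollify ρ v) (g := g) key).2
  rw [h2]
  simp [mollify]

/-- A sequence of mollifiers. -/
noncomputable def bump (𝔤 : Type*) [NormedAddCommGroup 𝔤] [InnerProductSpace ℝ 𝔤] (n : ℕ) :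
    ContDiffBump (0 : 𝔤) where
  rIn := 1 / (2 * (n + 1))
  rOut := 1 / (n + 1)
  rIn_pos := by positivity
  rIn_lt_rOut := by
    apply one_div_lt_one_div_of_lt <;> linarith [(Nat.cast_nonneg n : (0 : ℝ) ≤ n)]

/-- The mollification of a function at the scale `1 / (n + 1)`. -/
noncomputable def smoothing (C : StepTwoCarnot 𝔤 m k) (n : ℕ) (v : 𝔤 → ℝ) : 𝔤 → ℝ :=
  C.mollify ((bump 𝔤 n).normed volume) v

theorem contDiff_smoothing (C : StepTwoCarnot 𝔤 m k) (n l : ℕ) {v : 𝔤 → ℝ} (hv : Continuous v) :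
    ContDiff ℝ l (C.smoothing n v) :=
  C.contDiff_mollify (bump 𝔤 n).contDiff_normed (bump 𝔤 n).hasCompactSupport_normed hv

theorem D_smoothing (C : StepTwoCarnot 𝔤 m k) (n : ℕ) (j : Fin m) {v : 𝔤 → ℝ}
    (hvc : HasCompactSupport v) (hv : C.Gamma univ 1 v) :
    C.D j (C.smoothing n v) = C.smoothing n (C.D j v) :=
  funext fun g => C.D_mollify j (bump 𝔤 n).continuous_normed (bump 𝔤 n).hasCompactSupport_normed
    (continuousOn_univ.1 hv.1) hvc (fun g => (hv.2 j).1 g trivial)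
    (continuousOn_univ.1 (hv.2 j).2) g

theorem norm_smoothing_le (C : StepTwoCarnot 𝔤 m k) (n : ℕ) {v : 𝔤 → ℝ} {M : ℝ}
    (hM : ∀ g, ‖v g‖ ≤ M) (g : 𝔤) : ‖C.smoothing n v g‖ ≤ M := by
  have h := norm_integral_le_of_norm_le (μ := (volume : Measure 𝔤))
    (f := fun h => (bump 𝔤 n).normed volume h * v (C.mul (-h) g))
    (g := fun h => (bump 𝔤 n).normed volume h * M)
    (((bump 𝔤 n).integrable_normed).mul_const M) (Eventually.of_forall fun h => by
      rw [norm_mul, Real.norm_of_nonneg ((bump 𝔤 n).nonneg_normed h)]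
      exact mul_le_mul_of_nonneg_left (hM _) ((bump 𝔤 n).nonneg_normed h))
  rw [integral_mul_const, (bump 𝔤 n).integral_normed, one_mul] at h
  exact h

theorem tendsto_smoothing (C : StepTwoCarnot 𝔤 m k) {v : 𝔤 → ℝ} (hv : Continuous v) (g : 𝔤) :
    Tendsto (fun n => C.smoothing n v g) atTop (𝓝 (v g)) := by
  -- For fixed g, this is a Euclidean convolution of z ↦ v(z g) evaluated at z = 0.
  have h := ContDiffBump.convolution_tendsto_right_of_continuous (μ := (volume : Measure 𝔤))
    (φ := bump 𝔤) (l := atTop) (g := fun z => v (C.mul z g))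
    (tendsto_one_div_add_atTop_nhds_zero_nat (𝕜 := ℝ))
    (hv.comp (C.continuous_mul.comp (by fun_prop : Continuous fun z : 𝔤 => (z, g)))) 0
  rw [C.zero_mul] at h
  refine h.congr fun n => ?_
  simp [convolution_def, smoothing, mollify]

end Mollify

end StepTwoCarnot

/-! ### The divergence identity and its weak form. -/

namespace StepTwoCarnot

variable {𝔤 : Type*} [NormedAddCommGroup 𝔤] [InnerProductSpace ℝ 𝔤] {m k : ℕ}

/-- The components of the vector field whose horizontal divergence is `divSource`, in terms of the
values `a i = X_i u` and `A i j = X_i X_j u`. -/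
def flux (a : Fin m → ℝ) (A : Fin m → Fin m → ℝ) (j : Fin m) : ℝ :=
  ∑ i, a i * (2 * A i j - A j i) - a j * ∑ i, A i i

/-- The difference `‖∇²_H u‖² - (Δ_H u)² - ¾ ∑ ([X_i, X_j] u)²` in terms of `A i j = X_i X_j u`. -/
noncomputable def divSource (A : Fin m → Fin m → ℝ) : ℝ :=
  ∑ i, ∑ j, A i j * A j i - (∑ i, A i i) ^ 2 - 1 / 2 * ∑ i, ∑ j, (A i j - A j i) ^ 2

/-- The horizontal gradient `(X_i u)`. -/
noncomputable def grad (C : StepTwoCarnot 𝔤 m k) (u : 𝔤 → ℝ) (g : 𝔤) : Fin m → ℝ :=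
  fun i => C.D i u g

/-- The second horizontal derivatives `(X_i X_j u)`. -/
noncomputable def hess (C : StepTwoCarnot 𝔤 m k) (u : 𝔤 → ℝ) (g : 𝔤) : Fin m → Fin m → ℝ :=
  fun i j => C.D i (C.D j u) g

theorem continuous_flux (j : Fin m) :
    Continuous fun p : (Fin m → ℝ) × (Fin m → Fin m → ℝ) => flux p.1 p.2 j := by
  unfold flux
  fun_prop

theorem continuous_divSource : Continuous (divSource (m := m)) := by
  unfold divSource
  fun_prop

/-- Squaring the symmetrized entries gives Σ A_ij A_ji + ¼ Σ (A_ij − A_ji)². The coefficient ¾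
arises as ¼ + ½, the ½ compensating the skew term built into `divSource`. -/
theorem hessianNormSq_eq (C : StepTwoCarnot 𝔤 m k) (u : 𝔤 → ℝ) (g : 𝔤) :
    C.hessianNormSq u g = divSource (C.hess u g) + C.laplacian u g ^ 2 +
      3 / 4 * ∑ i, ∑ j, C.comm i j u g ^ 2 := by
  have h : C.hessianNormSq u g = ∑ i, ∑ j, C.hess u g i j * C.hess u g j i +
      1 / 4 * ∑ i, ∑ j, (C.hess u g i j - C.hess u g j i) ^ 2 := by
    simp only [Finset.mul_sum, ← Finset.sum_add_distrib, hessianNormSq, hessian, hess]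
    refine Finset.sum_congr rfl fun i _ => Finset.sum_congr rfl fun j _ => ?_
    ring
  rw [h]
  simp only [divSource, laplacian, comm, hess]
  ring

variable [FiniteDimensional ℝ 𝔤]

/-- The factor 2 A_ij − A_ji is X_i X_j u plus the commutator. By centrality its X_j-derivative is
X_i X_j X_j u, so the third-order terms form Σ X_i u X_i(Δ_H u) twice, with opposite signs. -/
theorem sum_D_flux (C : StepTwoCarnot 𝔤 m k) {u : 𝔤 → ℝ} (hu : ContDiff ℝ 3 u) (g : 𝔤) :
    ∑ j, C.D j (fun x => flux (C.grad u x) (C.hess u x) j) g = divSource (C.hess u g) := by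
  have h1 : ∀ i, ContDiff ℝ 2 (C.D i u) := fun i => C.contDiff_D (n := 2) i hu
  have h2 : ∀ i j, ContDiff ℝ 1 (C.D i (C.D j u)) := fun i j => C.contDiff_D (n := 1) i (h1 j)
  have d1 : ∀ i j, C.DiffAt j (C.D i u) g := fun i j =>
    (C.diffAt_of_differentiableAt j ((h1 i).differentiable (by simp) g)).1
  have d2 : ∀ i j l, HasDerivAt (fun t : ℝ => C.D i (C.D j u) (g + t • C.X l g))
      (C.D l (C.D i (C.D j u)) g) 0 := fun i j l =>
    (C.diffAt_of_differentiableAt l ((h2 i j).differentiable (by simp) g)).1.hasDerivAt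
  have key : ∀ j, C.D j (fun x => flux (C.grad u x) (C.hess u x) j) g =
      ∑ i, (C.D j (C.D i u) g * (2 * C.D i (C.D j u) g - C.D j (C.D i u) g) +
        C.D i u g * (2 * C.D j (C.D i (C.D j u)) g - C.D j (C.D j (C.D i u)) g)) -
      (C.D j (C.D j u) g * ∑ i, C.D i (C.D i u) g +
        C.D j u g * ∑ i, C.D j (C.D i (C.D i u)) g) := by
    intro j
    have hs : HasDerivAt (fun t : ℝ => ∑ i, C.D i (C.D i u) (g + t • C.X j g))
        (∑ i, C.D j (C.D i (C.D i u)) g) 0 := HasDerivAt.fun_sum fun i _ => d2 i i j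
    have hf := (HasDerivAt.fun_sum (u := Finset.univ) fun i _ =>
      (d1 i j).hasDerivAt.mul (((d2 i j j).const_mul 2).sub (d2 j i j))).sub
        ((d1 j j).hasDerivAt.mul hs)
    have := (C.diffAt_of_hasDerivAt (j := j) (g := g)
      (u := fun x => flux (C.grad u x) (C.hess u x) j) hf).2
    simpa using this
  have hc : ∀ i j, C.D j (C.D i (C.D j u)) g - C.D j (C.D j (C.D i u)) g =
      C.D i (C.D j (C.D j u)) g - C.D j (C.D i (C.D j u)) g := by
    intro i j
    rw [← C.D_comm i j j hu g]
    exact ((C.diffAt_of_hasDerivAt (j := j) (g := g)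
      (u := fun x => C.D i (C.D j u) x - C.D j (C.D i u) x) ((d2 i j j).sub (d2 j i j))).2).symm
  have h3 : ∀ i j, 2 * C.D j (C.D i (C.D j u)) g - C.D j (C.D j (C.D i u)) g =
      C.D i (C.D j (C.D j u)) g := fun i j => by linarith [hc i j]
  simp only [key, h3]
  simp only [divSource, hess]
  simp only [Finset.sum_sub_distrib, Finset.sum_add_distrib, Finset.mul_sum]
  have e1 : ∑ j, ∑ i, C.D i u g * C.D i (C.D j (C.D j u)) g =
      ∑ j, ∑ i, C.D j u g * C.D j (C.D i (C.D i u)) g := Finset.sum_comm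
  -- The products of second derivatives: after symmetrizing in i and j, Σ A_ji² is half of Σ (A_ij²
  -- + A_ji²), which completes the square.
  have e2 : ∑ j, ∑ i, C.D j (C.D i u) g * (2 * C.D i (C.D j u) g - C.D j (C.D i u) g) =
      ∑ i, ∑ j, C.D i (C.D j u) g * C.D j (C.D i u) g -
        ∑ i, ∑ j, 1 / 2 * (C.D i (C.D j u) g - C.D j (C.D i u) g) ^ 2 := by
    have e3 : ∑ i, ∑ j, C.D i (C.D j u) g ^ 2 = ∑ i, ∑ j, C.D j (C.D i u) g ^ 2 :=
      Finset.sum_comm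
    have e4 : ∀ i j, 1 / 2 * (C.D i (C.D j u) g - C.D j (C.D i u) g) ^ 2 =
        1 / 2 * C.D i (C.D j u) g ^ 2 + 1 / 2 * C.D j (C.D i u) g ^ 2 -
          C.D i (C.D j u) g * C.D j (C.D i u) g := fun i j => by ring
    have e5 : ∀ i j, C.D j (C.D i u) g * (2 * C.D i (C.D j u) g - C.D j (C.D i u) g) =
        2 * (C.D i (C.D j u) g * C.D j (C.D i u) g) - C.D j (C.D i u) g ^ 2 := fun i j => by ring
    rw [Finset.sum_comm]
    simp only [e4, e5, Finset.sum_sub_distrib, Finset.sum_add_distrib, ← Finset.mul_sum, e3]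
    ring
  have e6 : ∑ j, ∑ i, C.D j (C.D j u) g * C.D i (C.D i u) g = (∑ i, C.D i (C.D i u) g) ^ 2 := by
    rw [sq, Finset.sum_mul_sum]
  rw [e1, e2, e6]
  ring

variable [MeasurableSpace 𝔤] [BorelSpace 𝔤]

/-- The flow of X_j preserves Lebesgue measure, so the integral of w along the flow does not depend
on time; its derivative at time zero is the integral of X_j w. -/
theorem integral_D_eq_zero (C : StepTwoCarnot 𝔤 m k) (j : Fin m) {w : 𝔤 → ℝ} (hw : ContDiff ℝ 1 w)
    (hwc : HasCompactSupport w) : ∫ g, C.D j w g = 0 := by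
  have hD : Continuous (C.D j w) := (C.contDiff_D (n := 0) j hw).continuous
  have hd : ∀ g, C.DiffAt j w g := fun g =>
    (C.diffAt_of_differentiableAt j (hw.differentiable (by simp) g)).1
  have hDc : HasCompactSupport (C.D j w) :=
    hwc.of_isClosed_subset (isClosed_tsupport _) (C.tsupport_D_subset j w)
  obtain ⟨M, hM⟩ := hDc.exists_bound_of_continuous hD
  have hX : Continuous (C.X j) := (C.contDiff_X j (n := 0)).continuous
  -- The set swept out by the support under the flow for times in [−1, 1]; a constant on it
  -- dominates all difference quotients.
  have hK : IsCompact ((fun p : ℝ × 𝔤 => p.2 + (-p.1) • C.X j p.2) ''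
      (Icc (-1) 1 ×ˢ tsupport (C.D j w))) := (isCompact_Icc.prod hDc).image (by fun_prop)
  set K := (fun p : ℝ × 𝔤 => p.2 + (-p.1) • C.X j p.2) '' (Icc (-1) 1 ×ˢ tsupport (C.D j w))
  have hc : ∀ w : 𝔤 → ℝ, Continuous w → ∀ t : ℝ, Continuous fun g => w (g + t • C.X j g) :=
    fun w hw t => by fun_prop
  have key := (hasDerivAt_integral_of_dominated_loc_of_deriv_le (μ := (volume : Measure 𝔤))
    (F := fun t g => w (g + t • C.X j g)) (x₀ := (0 : ℝ)) (s := Icc (-1) 1)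
    (F' := fun t g => C.D j w (g + t • C.X j g))
    (bound := K.indicator fun _ => M) (Icc_mem_nhds (by norm_num) (by norm_num))
    (Eventually.of_forall fun t => (hc w hw.continuous t).aestronglyMeasurable)
    (by simpa using hw.continuous.integrable_of_hasCompactSupport hwc)
    (hc _ hD 0).aestronglyMeasurable
    (Eventually.of_forall fun g t ht => by
      by_cases hg : g ∈ K
      · rw [indicator_of_mem hg]
        exact hM _
      · have : C.D j w (g + t • C.X j g) = 0 := by
          by_contra h0
          refine hg ⟨(t, g + t • C.X j g), ⟨ht, subset_tsupport _ h0⟩, ?_⟩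
          simp [X_flow]
        simp [this, hg])
    ((integrable_indicator_iff hK.measurableSet).2 (integrableOn_const hK.measure_ne_top))
    (Eventually.of_forall fun g t _ => (hd _).hasDerivAt_flow)).2
  have hconst : (fun t : ℝ => ∫ g, w (g + t • C.X j g)) = fun _ => ∫ g, w g := by
    funext t
    have hp := C.measurePreserving_flow j t
    have h := integral_map (μ := volume) hp.aemeasurable
      (hp.map_eq.symm ▸ hw.continuous.aestronglyMeasurable (μ := volume))
    rw [hp.map_eq] at h
    exact h.symm
  rw [hconst] at key
  have := key.unique (hasDerivAt_const _ _)
  simpa using this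

/-- The weak form of the divergence identity. -/
theorem integral_divSource_smooth (C : StepTwoCarnot 𝔤 m k) {u η : 𝔤 → ℝ} (hu : ContDiff ℝ 3 u)
    (hη : ContDiff ℝ 1 η) (hηc : HasCompactSupport η) :
    ∫ g, (η g * divSource (C.hess u g) +
      ∑ j, C.D j η g * flux (C.grad u g) (C.hess u g) j) = 0 := by
  have h1 : ∀ i, ContDiff ℝ 2 (C.D i u) := fun i => C.contDiff_D (n := 2) i hu
  have h1' : ∀ i, ContDiff ℝ 1 (C.D i u) := fun i => (h1 i).of_le (by norm_num)
  have h2 : ∀ i j, ContDiff ℝ 1 (C.D i (C.D j u)) := fun i j => C.contDiff_D (n := 1) i (h1 j)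
  have hF : ∀ j, ContDiff ℝ 1 fun x => flux (C.grad u x) (C.hess u x) j := by
    intro j
    simp only [flux, grad, hess]
    fun_prop
  have key : ∀ g, η g * divSource (C.hess u g) +
      ∑ j, C.D j η g * flux (C.grad u g) (C.hess u g) j =
      ∑ j, C.D j (fun x => η x * flux (C.grad u x) (C.hess u x) j) g := by
    intro g
    rw [← C.sum_D_flux hu, Finset.mul_sum, ← Finset.sum_add_distrib]
    refine Finset.sum_congr rfl fun j _ => ?_
    rw [((C.diffAt_of_differentiableAt j (hη.differentiable (by simp) g)).1.mul
      (C.diffAt_of_differentiableAt j ((hF j).differentiable (by simp) g)).1).2]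
    ring
  have hc : ∀ j, HasCompactSupport fun x => η x * flux (C.grad u x) (C.hess u x) j := fun j =>
    hηc.mul_right
  have hD : ∀ j, ContDiff ℝ 1 fun x => η x * flux (C.grad u x) (C.hess u x) j := fun j =>
    hη.mul (hF j)
  simp only [key]
  rw [integral_finsetSum]
  · exact Finset.sum_eq_zero fun j _ => C.integral_D_eq_zero j (hD j) (hc j)
  · intro j _
    exact (C.contDiff_D (n := 0) j (hD j)).continuous.integrable_of_hasCompactSupport
      ((hc j).of_isClosed_subset (isClosed_tsupport _) (C.tsupport_D_subset j _))

/-- Dominated convergence: the integrands are continuous in the values of the derivatives, which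
stay in one compact set, and these values enter linearly against integrable weights. -/
theorem tendsto_integral_divSource {η : 𝔤 → ℝ} {η' : Fin m → 𝔤 → ℝ} (hηm : Continuous η)
    (hη'm : ∀ j, Continuous (η' j)) (hη : Integrable η) (hη' : ∀ j, Integrable (η' j))
    {p : ℕ → 𝔤 → (Fin m → ℝ) × (Fin m → Fin m → ℝ)} {p₀ : 𝔤 → (Fin m → ℝ) × (Fin m → Fin m → ℝ)}
    (hp : ∀ n, Continuous (p n)) {K : Set ((Fin m → ℝ) × (Fin m → Fin m → ℝ))} (hK : IsCompact K)
    (hmem : ∀ n g, p n g ∈ K) (hlim : ∀ g, Tendsto (fun n => p n g) atTop (𝓝 (p₀ g))) :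
    Tendsto (fun n => ∫ g, (η g * divSource (p n g).2 + ∑ j, η' j g * flux (p n g).1 (p n g).2 j))
      atTop (𝓝 (∫ g, (η g * divSource (p₀ g).2 + ∑ j, η' j g * flux (p₀ g).1 (p₀ g).2 j))) := by
  obtain ⟨B, hB⟩ := hK.exists_bound_of_continuousOn
    (f := fun p : (Fin m → ℝ) × (Fin m → Fin m → ℝ) => divSource p.2)
    (continuous_divSource.comp continuous_snd).continuousOn
  choose B' hB' using fun j => hK.exists_bound_of_continuousOn (continuous_flux j).continuousOn
  refine tendsto_integral_of_dominated_convergence (fun g => ‖η g‖ * B + ∑ j, ‖η' j g‖ * B' j)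
    (fun n => ?_) ((hη.norm.mul_const B).add
      (integrable_finsetSum _ fun j _ => (hη' j).norm.mul_const _))
    (fun n => Eventually.of_forall fun g => ?_) (Eventually.of_forall fun g => ?_)
  · exact ((hηm.mul (continuous_divSource.comp (continuous_snd.comp (hp n)))).add
      (continuous_finsetSum _ fun j _ =>
        (hη'm j).mul ((continuous_flux j).comp (hp n)))).aestronglyMeasurable
  · refine norm_add_le_of_le ?_ (norm_sum_le_of_le _ fun j _ => ?_)
    · rw [norm_mul]
      exact mul_le_mul_of_nonneg_left (hB _ (hmem n g)) (norm_nonneg _)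
    · rw [norm_mul]
      exact mul_le_mul_of_nonneg_left (hB' j _ (hmem n g)) (norm_nonneg _)
  · have hc : Continuous fun q : (Fin m → ℝ) × (Fin m → Fin m → ℝ) =>
        η g * divSource q.2 + ∑ j, η' j g * flux q.1 q.2 j :=
      (continuous_const.mul (continuous_divSource.comp continuous_snd)).add
        (continuous_finsetSum _ fun j _ => continuous_const.mul (continuous_flux j))
    exact (hc.tendsto (p₀ g)).comp (hlim g)

theorem integral_divSource_of_hasCompactSupport (C : StepTwoCarnot 𝔤 m k) {v η : 𝔤 → ℝ}
    (hv : C.Gamma univ 2 v) (hvc : HasCompactSupport v)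
    (hη : ContDiff ℝ 1 η) (hηc : HasCompactSupport η) :
    ∫ g, (η g * divSource (C.hess v g) +
      ∑ j, C.D j η g * flux (C.grad v g) (C.hess v g) j) = 0 := by
  have hcs : ∀ {w : 𝔤 → ℝ}, HasCompactSupport w → ∀ j, HasCompactSupport (C.D j w) :=
    fun h j => h.of_isClosed_subset (isClosed_tsupport _) (C.tsupport_D_subset j _)
  have c1 : ∀ i, Continuous (C.D i v) := fun i => continuousOn_univ.1 (hv.2 i).2.1
  have c2 : ∀ i j, Continuous (C.D i (C.D j v)) := fun i j =>
    continuousOn_univ.1 ((hv.2 j).2.2 i).2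
  have e1 : ∀ n i, C.D i (C.smoothing n v) = C.smoothing n (C.D i v) := fun n i =>
    C.D_smoothing n i hvc hv.of_succ
  -- Both orders of derivatives of the mollified function are mollified derivatives of v, hence
  -- bounded uniformly and convergent pointwise.
  have e2 : ∀ n i j, C.D i (C.D j (C.smoothing n v)) = C.smoothing n (C.D i (C.D j v)) := by
    intro n i j
    rw [e1, C.D_smoothing n i (hcs hvc j) (hv.2 j).2]
  choose M1 hM1 using fun i => (hcs hvc i).exists_bound_of_continuous (c1 i)
  choose M2 hM2 using fun i j => (hcs (hcs hvc j) i).exists_bound_of_continuous (c2 i j)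
  have hDη : ∀ j, Continuous (C.D j η) := fun j => (C.contDiff_D (n := 0) j hη).continuous
  have hlim := tendsto_integral_divSource (η := η) (η' := fun j => C.D j η)
    (p := fun n g => (C.grad (C.smoothing n v) g, C.hess (C.smoothing n v) g))
    (p₀ := fun g => (C.grad v g, C.hess v g))
    (K := (Set.pi univ fun i => Metric.closedBall 0 (M1 i)) ×ˢ
      (Set.pi univ fun i => Set.pi univ fun j => Metric.closedBall 0 (M2 i j)))
    hη.continuous hDη (hη.continuous.integrable_of_hasCompactSupport hηc)
    (fun j => (hDη j).integrable_of_hasCompactSupport (hcs hηc j))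
    (fun n => by
      refine Continuous.prodMk (continuous_pi fun i => ?_)
        (continuous_pi fun i => continuous_pi fun j => ?_)
      · exact (C.contDiff_D (n := 0) i
          (C.contDiff_smoothing n 1 (continuousOn_univ.1 hv.1))).continuous
      · exact (C.contDiff_D (n := 0) i (C.contDiff_D (n := 1) j
          (C.contDiff_smoothing n 2 (continuousOn_univ.1 hv.1)))).continuous)
    ((isCompact_univ_pi fun i => isCompact_closedBall _ _).prod
      (isCompact_univ_pi fun i => isCompact_univ_pi fun j => isCompact_closedBall _ _))
    (fun n g => by
      refine ⟨fun i _ => ?_, fun i _ j _ => ?_⟩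
      · simp only [grad, e1, mem_closedBall_zero_iff]
        exact C.norm_smoothing_le n (hM1 i) g
      · simp only [hess, e2, mem_closedBall_zero_iff]
        exact C.norm_smoothing_le n (hM2 i j) g)
    (fun g => by
      refine Tendsto.prodMk_nhds (tendsto_pi_nhds.2 fun i => ?_)
        (tendsto_pi_nhds.2 fun i => tendsto_pi_nhds.2 fun j => ?_)
      · simp only [grad, e1]
        exact C.tendsto_smoothing (c1 i) g
      · simp only [hess, e2]
        exact C.tendsto_smoothing (c2 i j) g)
  have h0 : ∀ n, ∫ g, (η g * divSource (C.hess (C.smoothing n v) g) +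
      ∑ j, C.D j η g * flux (C.grad (C.smoothing n v) g) (C.hess (C.smoothing n v) g) j) = 0 :=
    fun n => C.integral_divSource_smooth
      (C.contDiff_smoothing n 3 (continuousOn_univ.1 hv.1)) hη hηc
  simp only [h0] at hlim
  exact (tendsto_nhds_unique hlim tendsto_const_nhds)

/-- Multiplying u by a cutoff equal to one near the support of the test function changes nothing
where the integrand lives, and reduces to compact support in the whole group. -/
theorem integral_divSource_eq_zero (C : StepTwoCarnot 𝔤 m k) {Ω : Set 𝔤} (hΩ : IsOpen Ω)
    {u η : 𝔤 → ℝ} (hu : C.Gamma Ω 2 u) (hη : ContDiff ℝ 1 η) (hηc : HasCompactSupport η)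
    (hηΩ : tsupport η ⊆ Ω) :
    ∫ g in Ω, (η g * divSource (C.hess u g) +
      ∑ j, C.D j η g * flux (C.grad u g) (C.hess u g) j) = 0 := by
  have hz : ∀ g, g ∉ tsupport η → η g = 0 ∧ ∀ j, C.D j η g = 0 := fun g hg =>
    ⟨image_eq_zero_of_notMem_tsupport hg, fun j =>
      image_eq_zero_of_notMem_tsupport fun h => hg (C.tsupport_D_subset j η h)⟩
  rw [setIntegral_eq_integral_of_forall_compl_eq_zero fun g hg => by
    have := hz g fun h => hg (hηΩ h)
    simp [this.1, this.2]]
  obtain ⟨ζ, hζ, hζc, hζΩ, O, hO, hKO, hζO⟩ := exists_contDiff_cutoff hηc hΩ hηΩ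
  rw [← C.integral_divSource_of_hasCompactSupport (hu.cutoff hΩ (hζ 2) hζΩ) hζc.mul_right hη hηc]
  congr 1
  funext g
  by_cases hg : g ∈ tsupport η
  · have he : (fun x => ζ x * u x) =ᶠ[𝓝 g] u := by
      filter_upwards [hO.mem_nhds (hKO hg)] with x hx
      simp [hζO hx]
    have e1 : C.grad (fun x => ζ x * u x) g = C.grad u g := funext fun i => C.D_congr he
    have e2 : C.hess (fun x => ζ x * u x) g = C.hess u g :=
      funext fun i => funext fun j => C.D_congr (C.D_eventuallyEq j he)
    rw [e1, e2]
  · have := hz g hg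
    simp [this.1, this.2]

end StepTwoCarnot

/-! ### Differentiation along horizontal curves, up to the boundary. -/

namespace StepTwoCarnot

variable {𝔤 : Type*} [NormedAddCommGroup 𝔤] [InnerProductSpace ℝ 𝔤] {m k : ℕ}
  [FiniteDimensional ℝ 𝔤]

/-- By left invariance the translated curve is horizontal with the same coefficients c. This is why
curves are moved by left translations and not by Euclidean ones. -/
theorem hasDerivAt_mul_left (C : StepTwoCarnot 𝔤 m k) (h : 𝔤) {γ : ℝ → 𝔤} {c : Fin m → ℝ} {t : ℝ}
    (hγ : HasDerivAt γ (∑ j, c j • C.X j (γ t)) t) :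
    HasDerivAt (fun s => C.mul h (γ s)) (∑ j, c j • C.X j (C.mul h (γ t))) t := by
  have h1 := ((hγ.const_add h).add
    (((C.bracketL h).hasFDerivAt.comp_hasDerivAt t hγ).const_smul (1 / 2 : ℝ)))
  refine HasDerivAt.congr_deriv h1 ?_
  simp only [X_mul, dLeft_eq, map_sum, map_smul, smul_add, Finset.sum_add_distrib,
    bracketL_apply, Finset.smul_sum, smul_comm (1 / 2 : ℝ)]

variable [MeasurableSpace 𝔤] [BorelSpace 𝔤]

/-- A function of class Γ¹ need not be differentiable, so the chain rule along a curve is not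
available directly. It holds for the mollified functions, whose horizontal derivatives are bounded
and converge, and the integrated form survives the limit. -/
theorem Gamma.integral_along {C : StepTwoCarnot 𝔤 m k} {Ω : Set 𝔤} (hΩ : IsOpen Ω) {w : 𝔤 → ℝ}
    (hw : C.Gamma Ω 1 w) {γ : ℝ → 𝔤} {c : ℝ → Fin m → ℝ} {a b : ℝ}
    (hγ : ∀ t ∈ uIcc a b, HasDerivAt γ (∑ j, c t j • C.X j (γ t)) t)
    (hc : ContinuousOn c (uIcc a b)) (hmem : ∀ t ∈ uIcc a b, γ t ∈ Ω) :
    ∫ t in a..b, ∑ j, c t j * C.D j w (γ t) = w (γ b) - w (γ a) := by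
  have hγc : ContinuousOn γ (uIcc a b) := fun t ht => (hγ t ht).continuousAt.continuousWithinAt
  obtain ⟨ζ, hζ, hζc, hζΩ, O, hO, hKO, hζO⟩ := exists_contDiff_cutoff
    (isCompact_uIcc.image_of_continuousOn hγc) hΩ (image_subset_iff.2 hmem)
  have hv := hw.cutoff hΩ (hζ 1) hζΩ
  set v : 𝔤 → ℝ := fun x => ζ x * w x
  have hvc : HasCompactSupport v := hζc.mul_right
  have hv0 : Continuous v := continuousOn_univ.1 hv.1
  have hv1 : ∀ j, Continuous (C.D j v) := fun j => continuousOn_univ.1 (hv.2 j).2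
  have hcs : ∀ j, HasCompactSupport (C.D j v) :=
    fun j => hvc.of_isClosed_subset (isClosed_tsupport _) (C.tsupport_D_subset j _)
  have he : ∀ t ∈ uIcc a b, v =ᶠ[𝓝 (γ t)] w := fun t ht => by
    filter_upwards [hO.mem_nhds (hKO (mem_image_of_mem _ ht))] with x hx
    simp [v, hζO hx]
  have hcj : ∀ j, ContinuousOn (fun t => c t j) (uIcc a b) := fun j =>
    (continuous_apply j).comp_continuousOn hc
  have hcont : ∀ f : Fin m → 𝔤 → ℝ, (∀ j, Continuous (f j)) →
      ContinuousOn (fun t => ∑ j, c t j * f j (γ t)) (uIcc a b) := fun f hf =>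
    continuousOn_finsetSum _ fun j _ => (hcj j).mul ((hf j).comp_continuousOn hγc)
  have hD : ∀ n j, C.D j (C.smoothing n v) = C.smoothing n (C.D j v) := fun n j =>
    C.D_smoothing n j hvc hv
  have hn : ∀ n, ∫ t in a..b, ∑ j, c t j * C.smoothing n (C.D j v) (γ t) =
      C.smoothing n v (γ b) - C.smoothing n v (γ a) := by
    intro n
    have hs := C.contDiff_smoothing n 1 hv0
    refine intervalIntegral.integral_eq_sub_of_hasDerivAt
      (f := fun t => C.smoothing n v (γ t)) (fun t ht => ?_) ?_
    · have h1 := (hs.differentiable (by simp) (γ t)).hasFDerivAt.comp_hasDerivAt t (hγ t ht)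
      refine HasDerivAt.congr_deriv h1 ?_
      simp only [map_sum, map_smul, smul_eq_mul, ← hD]
      exact Finset.sum_congr rfl fun j _ => by
        rw [C.D_eq_fderiv j (hs.differentiable (by simp) (γ t))]
    · exact (hcont _ fun j => (C.contDiff_smoothing n 0 (hv1 j)).continuous).intervalIntegrable
  choose M hM using fun j => (hcs j).exists_bound_of_continuous (hv1 j)
  have hlim := intervalIntegral.tendsto_integral_filter_of_dominated_convergence
    (μ := volume) (l := atTop) (a := a) (b := b)
    (F := fun n t => ∑ j, c t j * C.smoothing n (C.D j v) (γ t))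
    (f := fun t => ∑ j, c t j * C.D j v (γ t))
    (fun t => ∑ j, ‖c t j‖ * M j)
    (Eventually.of_forall fun n => ((hcont _ fun j =>
      (C.contDiff_smoothing n 0 (hv1 j)).continuous).mono
        uIoc_subset_uIcc).aestronglyMeasurable measurableSet_uIoc)
    (Eventually.of_forall fun n => Eventually.of_forall fun t _ =>
      norm_sum_le_of_le _ fun j _ => by
        rw [norm_mul]
        exact mul_le_mul_of_nonneg_left (C.norm_smoothing_le n (hM j) _) (norm_nonneg _))
    (continuousOn_finsetSum _ fun j _ => (hcj j).norm.mul continuousOn_const).intervalIntegrable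
    (Eventually.of_forall fun t _ => tendsto_finsetSum _ fun j _ =>
      (C.tendsto_smoothing (hv1 j) (γ t)).const_mul _)
  simp only [hn] at hlim
  have h2 := tendsto_nhds_unique hlim
    ((C.tendsto_smoothing hv0 (γ b)).sub (C.tendsto_smoothing hv0 (γ a)))
  rw [(he b right_mem_uIcc).eq_of_nhds, (he a left_mem_uIcc).eq_of_nhds] at h2
  rw [← h2]
  refine intervalIntegral.integral_congr fun t ht => ?_
  exact Finset.sum_congr rfl fun j _ => by rw [C.D_congr (he t ht)]

/-- Differentiation at the boundary, along a horizontal curve which is pushed into the domain by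
left translations. -/
theorem Gamma.hasDerivAt_of_push {C : StepTwoCarnot 𝔤 m k} {Ω : Set 𝔤} (hΩ : IsOpen Ω) {w : 𝔤 → ℝ}
    (hw : C.Gamma Ω 1 w) {w₀ : 𝔤 → ℝ} {w₁ : Fin m → 𝔤 → ℝ} (hw₀ : Continuous w₀)
    (hw₁ : ∀ j, Continuous (w₁ j)) (e₀ : EqOn w₀ w Ω) (e₁ : ∀ j, EqOn (w₁ j) (C.D j w) Ω)
    {γ : ℝ → 𝔤} {c : ℝ → Fin m → ℝ} {ξ : 𝔤} {δ : ℝ} (hδ : 0 < δ)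
    (hγ : ∀ t ∈ Ioo (-δ) δ, HasDerivAt γ (∑ j, c t j • C.X j (γ t)) t)
    (hc : ContinuousOn c (Ioo (-δ) δ))
    (hmem : ∀ s ∈ Ioo 0 δ, ∀ t ∈ Ioo (-δ) δ, C.mul (s • ξ) (γ t) ∈ Ω) :
    HasDerivAt (fun t => w₀ (γ t)) (∑ j, c 0 j * w₁ j (γ 0)) 0 := by
  have h0 : (0 : ℝ) ∈ Ioo (-δ) δ := ⟨by linarith, hδ⟩
  have hsub : ∀ t ∈ Ioo (-δ) δ, uIcc 0 t ⊆ Ioo (-δ) δ := fun t ht =>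
    ordConnected_Ioo.uIcc_subset h0 ht
  have hcj : ∀ j, ContinuousOn (fun t => c t j) (Ioo (-δ) δ) := fun j =>
    (continuous_apply j).comp_continuousOn hc
  have hγc : ContinuousOn γ (Ioo (-δ) δ) := fun t ht => (hγ t ht).continuousAt.continuousWithinAt
  have hmul : Continuous fun p : ℝ × 𝔤 => C.mul (p.1 • ξ) p.2 :=
    C.continuous_mul.comp (by fun_prop : Continuous fun p : ℝ × 𝔤 => (p.1 • ξ, p.2))
  have hFs : ∀ s, ContinuousOn (fun t => ∑ j, c t j * w₁ j (C.mul (s • ξ) (γ t)))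
      (Ioo (-δ) δ) := fun s => continuousOn_finsetSum _ fun j _ => (hcj j).mul
    (((hw₁ j).comp (hmul.comp (by fun_prop : Continuous fun x : 𝔤 =>
      (s, x)))).comp_continuousOn hγc)
  -- The integrated formula holds on each translate s • ξ of the curve, which lies in Ω. Letting s
  -- decrease to 0 transfers it to the curve itself, where only the continuous extensions have a
  -- meaning.
  have key : ∀ t ∈ Ioo (-δ) δ,
      ∫ r in (0 : ℝ)..t, ∑ j, c r j * w₁ j (γ r) = w₀ (γ t) - w₀ (γ 0) := by
    intro t ht
    have hs : ∀ s ∈ Ioo 0 δ, ∫ r in (0 : ℝ)..t, ∑ j, c r j * w₁ j (C.mul (s • ξ) (γ r)) =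
        w₀ (C.mul (s • ξ) (γ t)) - w₀ (C.mul (s • ξ) (γ 0)) := by
      intro s hs
      have h1 := hw.integral_along hΩ (γ := fun r => C.mul (s • ξ) (γ r)) (c := c) (a := 0) (b := t)
        (fun r hr => C.hasDerivAt_mul_left _ (hγ r (hsub t ht hr))) (hc.mono (hsub t ht))
        (fun r hr => hmem s hs r (hsub t ht hr))
      rw [e₀ (hmem s hs t ht), e₀ (hmem s hs 0 h0), ← h1]
      refine intervalIntegral.integral_congr fun r hr => ?_
      exact Finset.sum_congr rfl fun j _ => by rw [e₁ j (hmem s hs r (hsub t ht hr))]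
    have hcont : ContinuousOn (fun p : ℝ × ℝ => ∑ j, c p.2 j * w₁ j (C.mul (p.1 • ξ) (γ p.2)))
        (Icc 0 1 ×ˢ uIcc 0 t) := by
      have hsnd : ContinuousOn (fun p : ℝ × ℝ => γ p.2) (Icc 0 1 ×ˢ uIcc 0 t) :=
        (hγc.mono (hsub t ht)).comp continuousOn_snd fun p hp => hp.2
      exact continuousOn_finsetSum _ fun j _ => (((hcj j).mono (hsub t ht)).comp continuousOn_snd
        fun p hp => hp.2).mul ((hw₁ j).comp_continuousOn
          (hmul.comp_continuousOn (continuousOn_fst.prodMk hsnd)))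
    obtain ⟨M, hM⟩ := (isCompact_Icc.prod isCompact_uIcc).exists_bound_of_continuousOn hcont
    have hpos : ∀ᶠ s in 𝓝[>] (0 : ℝ), s ∈ Ioo 0 δ ∧ s ∈ Icc (0 : ℝ) 1 := by
      filter_upwards [Ioo_mem_nhdsGT hδ, Ioo_mem_nhdsGT one_pos] with s h1 h2
      exact ⟨h1, Ioo_subset_Icc_self h2⟩
    have hlim := intervalIntegral.tendsto_integral_filter_of_dominated_convergence
      (μ := volume) (l := 𝓝[>] (0 : ℝ)) (a := 0) (b := t)
      (F := fun s r => ∑ j, c r j * w₁ j (C.mul (s • ξ) (γ r)))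
      (f := fun r => ∑ j, c r j * w₁ j (γ r)) (fun _ => M)
      (Eventually.of_forall fun s => ((hFs s).mono
        (uIoc_subset_uIcc.trans (hsub t ht))).aestronglyMeasurable measurableSet_uIoc)
      (hpos.mono fun s hs => Eventually.of_forall fun r hr =>
        hM (s, r) ⟨hs.2, uIoc_subset_uIcc hr⟩)
      intervalIntegrable_const
      (Eventually.of_forall fun r _ => tendsto_finsetSum _ fun j _ => by
        have h2 : Tendsto (fun s : ℝ => w₁ j (C.mul (s • ξ) (γ r))) (𝓝 0) (𝓝 (w₁ j (γ r))) := by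
          have := ((hw₁ j).comp (hmul.comp
            (by fun_prop : Continuous fun s : ℝ => (s, γ r)))).tendsto 0
          simpa [zero_mul, Function.comp_def] using this
        exact (h2.mono_left nhdsWithin_le_nhds).const_mul _)
    have hlim2 : ∀ x : 𝔤, Tendsto (fun s : ℝ => w₀ (C.mul (s • ξ) x)) (𝓝[>] 0) (𝓝 (w₀ x)) := by
      intro x
      have := (hw₀.comp (hmul.comp (by fun_prop : Continuous fun s : ℝ => (s, x)))).tendsto 0
      simp only [Function.comp, zero_smul, zero_mul] at this
      exact this.mono_left nhdsWithin_le_nhds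
    exact tendsto_nhds_unique (hlim.congr' (hpos.mono fun s h => hs s h.1))
      ((hlim2 _).sub (hlim2 _))
  have hF : ContinuousOn (fun t => ∑ j, c t j * w₁ j (γ t)) (Ioo (-δ) δ) := by
    simpa [zero_mul] using hFs 0
  have hd := intervalIntegral.integral_hasDerivAt_right (a := 0) (b := 0)
    (f := fun t => ∑ j, c t j * w₁ j (γ t)) (by simp)
    (hF.stronglyMeasurableAtFilter isOpen_Ioo 0 h0)
    (hF.continuousAt (isOpen_Ioo.mem_nhds h0))
  refine (hd.add_const (w₀ (γ 0))).congr_of_eventuallyEq ?_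
  filter_upwards [isOpen_Ioo.mem_nhds h0] with t ht
  rw [key t ht]
  ring

end StepTwoCarnot

/-! ### Local graphs and comparison of defining functions. -/

section DefiningFunctions

variable {E : Type*} [NormedAddCommGroup E]

/-- On the open set `V` the set `Ω` is the sublevel `{φ < 0}` of a global `C²` function which is
affine with slope one in the direction of the unit vector `v`. -/
structure IsGraphNear [InnerProductSpace ℝ E] (Ω V : Set E) (v : E) (φ : E → ℝ) : Prop where
  norm_eq : ‖v‖ = 1
  contDiff : ContDiff ℝ 2 φ
  add_smul : ∀ x (t : ℝ), φ (x + t • v) = φ x + t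
  isOpen : IsOpen V
  mem_iff : ∀ x ∈ V, x ∈ Ω ↔ φ x < 0

/-- The map replaces the v-component of a vector h by L h. If the image is 0 then L h = 0 and h is a
multiple of v, hence h = 0 because L v ≠ 0. -/
theorem exists_linear_equiv_shear [InnerProductSpace ℝ E] [FiniteDimensional ℝ E] {v : E}
    (hv : ‖v‖ = 1) {L : E →L[ℝ] ℝ} (hL : L v ≠ 0) :
    ∃ T : E ≃L[ℝ] E, (T : E →L[ℝ] E) =
      ContinuousLinearMap.id ℝ E + (L - innerSL ℝ v).smulRight v := by
  have hvv : inner ℝ v v = (1 : ℝ) := by rw [real_inner_self_eq_norm_sq, hv]; norm_num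
  have hinj : Function.Injective
      ((ContinuousLinearMap.id ℝ E + (L - innerSL ℝ v).smulRight v : E →L[ℝ] E) : E →ₗ[ℝ] E) := by
    rw [← LinearMap.ker_eq_bot, LinearMap.ker_eq_bot']
    intro h hh
    have h1 : h + (L h - inner ℝ v h) • v = 0 := by simpa using hh
    have h2 : L h = 0 := by
      have := congrArg (fun x => inner ℝ v x) h1
      simp only [inner_add_right, inner_smul_right, hvv, inner_zero_right] at this
      linarith
    rw [h2, zero_sub, neg_smul, add_neg_eq_zero] at h1
    have h3 : inner ℝ v h * L v = 0 := by
      rw [h1, map_smul, smul_eq_mul] at h2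
      exact h2
    rw [h1, (mul_eq_zero.1 h3).resolve_right hL, zero_smul]
  refine ⟨(LinearEquiv.ofInjectiveEndo _ hinj).toContinuousLinearEquiv, ?_⟩
  ext x
  rfl

/-- The implicit function theorem in a direction v in which φ increases. The new function measures
the signed distance to the zero set in the direction v; its unit slope makes the layer coordinates
of the Gauss-Green formula preserve volume. -/
theorem IsLocalDefining.exists_isGraphNear [InnerProductSpace ℝ E] [FiniteDimensional ℝ E]
    {Ω : Set E} {p : E} {φ : E → ℝ} (h : IsLocalDefining Ω p φ) :
    ∃ V v ψ, IsGraphNear Ω V v ψ ∧ p ∈ V ∧ ψ p = 0 := by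
  obtain ⟨hφ, hp, hd, hΩ⟩ := h
  obtain ⟨v, hv, hpos⟩ : ∃ v : E, ‖v‖ = 1 ∧ 0 < fderiv ℝ φ p v := by
    obtain ⟨w, hw⟩ : ∃ w, 0 < fderiv ℝ φ p w := by
      by_contra! hcon
      refine hd (ContinuousLinearMap.ext fun w => le_antisymm (hcon w) ?_)
      have := hcon (-w)
      rw [map_neg] at this
      simpa using this
    have hw0 : w ≠ 0 := by rintro rfl; simp at hw
    refine ⟨‖w‖⁻¹ • w, norm_smul_inv_norm hw0, ?_⟩
    rw [map_smul, smul_eq_mul]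
    have := norm_pos_iff.2 hw0
    positivity
  have hvv : inner ℝ v v = (1 : ℝ) := by rw [real_inner_self_eq_norm_sq, hv]; norm_num
  obtain ⟨T, hT⟩ := exists_linear_equiv_shear hv hpos.ne'
  -- Replaces the v-coordinate by the value of φ. Its local inverse on the hyperplane orthogonal to
  -- v parametrizes the zero set of φ.
  let Ψ : E → E := fun x => x + (φ x - inner ℝ v x) • v
  have hℓ : ∀ x, HasFDerivAt (fun x => inner ℝ v x : E → ℝ) (innerSL ℝ v) x :=
    fun x => (innerSL ℝ v).hasFDerivAt
  have hΨ : ContDiffAt ℝ 2 Ψ p := by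
    have : ContDiffAt ℝ 2 (fun x => inner ℝ v x : E → ℝ) p := (innerSL ℝ v).contDiff.contDiffAt
    exact contDiffAt_id.add ((hφ.sub this).smul contDiffAt_const)
  have hΨ' : HasFDerivAt Ψ (T : E →L[ℝ] E) p := by
    rw [hT]
    exact (hasFDerivAt_id p).add
      (((hφ.differentiableAt (by simp)).hasFDerivAt.sub (hℓ p)).smul_const v)
  have hs := hΨ.hasStrictFDerivAt' hΨ' (by simp)
  let π : E → E := fun x => x - (inner ℝ v x : ℝ) • v
  have hπc : ContDiff ℝ 2 π := by
    have : ContDiff ℝ 2 (fun x => inner ℝ v x : E → ℝ) := (innerSL ℝ v).contDiff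
    exact contDiff_id.sub (this.smul contDiff_const)
  have hΨp : Ψ p = π p := by simp only [Ψ, π, hp]; module
  let inv : E → E := hΨ.localInverse hΨ' (by simp)
  have hinv : ContDiffAt ℝ 2 inv (π p) := hΨp ▸ hΨ.to_localInverse hΨ' (by simp)
  have hinvp : inv (π p) = p := hΨp ▸ hΨ.localInverse_apply_image hΨ' (by simp)
  have hright : ∀ᶠ y in 𝓝 (π p), Ψ (inv y) = y := hΨp ▸ hs.eventually_right_inverse
  obtain ⟨O, hO, hOo, hpO⟩ := eventually_nhds_iff.1 (hinv.eventually (by simp))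
  obtain ⟨ζ, hζ, -, hζO, O', hO', hpO', hζ1⟩ := exists_contDiff_cutoff (K := {π p})
    isCompact_singleton hOo (singleton_subset_iff.2 hpO)
  have hpO'' : π p ∈ O' := hpO' rfl
  -- The height of the zero set over the hyperplane, cut off so as to be defined and `C²`
  -- everywhere.
  let f : E → ℝ := fun y => ζ y * inner ℝ v (inv y)
  have hf : ContDiff ℝ 2 f := by
    rw [contDiff_iff_contDiffAt]
    intro y
    by_cases hy : y ∈ tsupport ζ
    · have h1 : ContDiffAt ℝ 2 (fun y => inner ℝ v (inv y) : E → ℝ) y :=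
        (innerSL ℝ v).contDiff.contDiffAt.comp y (hO y (hζO hy))
      exact (hζ 2).contDiffAt.mul h1
    · have h0 := notMem_tsupport_iff_eventuallyEq.1 hy
      refine (contDiffAt_const (c := (0 : ℝ))).congr_of_eventuallyEq ?_
      filter_upwards [h0] with z hz
      simp [f, hz]
  let ψ : E → ℝ := fun x => inner ℝ v x - f (π x)
  have hψ : ContDiff ℝ 2 ψ := by
    have : ContDiff ℝ 2 (fun x => inner ℝ v x : E → ℝ) := (innerSL ℝ v).contDiff
    exact this.sub (hf.comp hπc)
  have hψv : ∀ x (t : ℝ), ψ (x + t • v) = ψ x + t := by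
    intro x t
    have : π (x + t • v) = π x := by
      simp only [π, inner_add_right, inner_smul_right, hvv]; module
    simp only [ψ, this, inner_add_right, inner_smul_right, hvv]
    ring
  have hfp : f (π p) = inner ℝ v p := by
    simp [f, hζ1 hpO'', hinvp]
  have hπt : Tendsto π (𝓝 p) (𝓝 (π p)) := hπc.continuous.tendsto p
  have hzt : Tendsto (fun x => inv (π x)) (𝓝 p) (𝓝 p) := by
    have := hinv.continuousAt.tendsto.comp hπt
    rwa [hinvp] at this
  -- The points x and `inv (π x)` differ by ψ(x) v, and φ vanishes at the second. With error at most
  -- half of ∂_v φ(p) times |ψ(x)|, the value φ(x) has the sign of ψ(x).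
  have hstrict := (hφ.hasStrictFDerivAt (by simp)).isLittleO.def
    (c := fderiv ℝ φ p v / 2) (by positivity)
  have hev : ∀ᶠ x in 𝓝 p, (x ∈ Ω ↔ ψ x < 0) := by
    filter_upwards [hΩ, hπt.eventually hright, hπt.eventually (hO'.mem_nhds hpO''),
      (tendsto_id.prodMk_nhds hzt).eventually hstrict] with x h1 h2 h3 h4
    rw [h1]
    have e1 : inv (π x) + (φ (inv (π x)) - inner ℝ v (inv (π x))) • v =
      x - (inner ℝ v x : ℝ) • v := h2
    have e2 : φ (inv (π x)) = 0 := by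
      have := congrArg (fun y => inner ℝ v y) e1
      simp only [inner_add_right, inner_sub_right, inner_smul_right, hvv] at this
      linarith
    have e3 : ψ x = inner ℝ v x - inner ℝ v (inv (π x)) := by
      simp [ψ, f, hζ1 h3]
    have e4 : x - inv (π x) = ψ x • v := by
      rw [e2] at e1
      rw [e3]
      calc x - inv (π x) = (x - (inner ℝ v x : ℝ) • v) - inv (π x) + (inner ℝ v x : ℝ) • v := by
            abel
        _ = _ := by rw [← e1]; module
    simp only [id, e4, e2, map_smul, smul_eq_mul, norm_smul, hv, Real.norm_eq_abs,
      sub_zero, mul_one] at h4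
    have h5 := abs_le.1 h4
    constructor
    · intro hneg
      by_contra! hc
      rw [abs_of_nonneg hc] at h5
      nlinarith [h5.1]
    · intro hneg
      rw [abs_of_neg hneg] at h5
      nlinarith [h5.2]
  obtain ⟨V, hV, hVo, hpV⟩ := eventually_nhds_iff.1 hev
  exact ⟨V, v, ψ, ⟨hv, hψ, hψv, hVo, hV⟩, hpV, by simp [ψ, hfp]⟩

/-- A direction in which φ decreases enters Ω, where ψ is negative as well, so ψ cannot increase
along it to first order. -/
theorem fderiv_le_zero_of_isLocalDefining [NormedSpace ℝ E] {Ω : Set E} {p : E} {φ ψ : E → ℝ}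
    (hφ : IsLocalDefining Ω p φ) (hψ : IsLocalDefining Ω p ψ) {w : E} (hw : fderiv ℝ φ p w < 0) :
    fderiv ℝ ψ p w ≤ 0 := by
  have hline : HasDerivAt (fun t : ℝ => p + t • w) w 0 := by
    simpa using ((hasDerivAt_id (0 : ℝ)).smul_const w).const_add p
  have hd : ∀ {f : E → ℝ}, ContDiffAt ℝ 2 f p →
      HasDerivAt (fun t : ℝ => f (p + t • w)) (fderiv ℝ f p w) 0 := by
    intro f hf
    have h : HasFDerivAt f (fderiv ℝ f p) (p + (0 : ℝ) • w) := by
      simpa using (hf.differentiableAt (by simp)).hasFDerivAt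
    exact h.comp_hasDerivAt 0 hline
  have ht : Tendsto (fun t : ℝ => p + t • w) (𝓝[>] 0) (𝓝 p) := by
    have := hline.continuousAt.tendsto
    simp only [zero_smul, add_zero] at this
    exact this.mono_left nhdsWithin_le_nhds
  have h1 := (hasDerivWithinAt_iff_tendsto_slope' (s := Ioi (0 : ℝ)) self_notMem_Ioi).1
    (hd hφ.1).hasDerivWithinAt
  have h2 := (hasDerivWithinAt_iff_tendsto_slope' (s := Ioi (0 : ℝ)) self_notMem_Ioi).1
    (hd hψ.1).hasDerivWithinAt
  refine le_of_tendsto h2 ?_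
  filter_upwards [h1.eventually (gt_mem_nhds hw), ht.eventually hφ.2.2.2,
    ht.eventually hψ.2.2.2, self_mem_nhdsWithin] with t h3 h4 h5 (h6 : 0 < t)
  simp only [slope_def_field, zero_smul, add_zero, hφ.2.1, hψ.2.1, sub_zero] at h3 ⊢
  have h7 : φ (p + t • w) < 0 := by
    by_contra! hc
    exact absurd h3 (not_lt.2 (div_nonneg hc h6.le))
  exact div_nonpos_of_nonpos_of_nonneg (h5.1 (h4.2 h7)).le h6.le

/-- Adding any multiple of a vector of ker dφ to a descent direction w₀ of φ keeps it one, so dψ is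
bounded above on a whole line and vanishes on ker dφ. Hence the differentials are proportional, and
the normal does not depend on the chosen function. -/
theorem exists_fderiv_eq_smul_of_isLocalDefining [NormedSpace ℝ E] {Ω : Set E} {p : E}
    {φ ψ : E → ℝ} (hφ : IsLocalDefining Ω p φ) (hψ : IsLocalDefining Ω p ψ) :
    ∃ c : ℝ, 0 < c ∧ fderiv ℝ ψ p = c • fderiv ℝ φ p := by
  obtain ⟨w₀, hw₀⟩ : ∃ w, fderiv ℝ φ p w < 0 := by
    by_contra! hcon
    refine hφ.2.2.1 (ContinuousLinearMap.ext fun w => le_antisymm ?_ (hcon w))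
    have := hcon (-w)
    rw [map_neg] at this
    simpa using this
  have hker : ∀ w, fderiv ℝ φ p w = 0 → fderiv ℝ ψ p w = 0 := by
    intro w hw
    have h1 : ∀ s : ℝ, fderiv ℝ ψ p w₀ + s * fderiv ℝ ψ p w ≤ 0 := by
      intro s
      have := fderiv_le_zero_of_isLocalDefining hφ hψ (w := w₀ + s • w) (by simp [hw, hw₀])
      simpa using this
    by_contra hne
    have := h1 ((1 - fderiv ℝ ψ p w₀) / fderiv ℝ ψ p w)
    rw [div_mul_cancel₀ _ hne] at this
    linarith
  have hle := fderiv_le_zero_of_isLocalDefining hφ hψ hw₀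
  have heq : fderiv ℝ ψ p = (fderiv ℝ ψ p w₀ / fderiv ℝ φ p w₀) • fderiv ℝ φ p := by
    ext w
    have h1 := hker (w - (fderiv ℝ φ p w / fderiv ℝ φ p w₀) • w₀) (by
      rw [map_sub, map_smul, smul_eq_mul, div_mul_cancel₀ _ hw₀.ne, sub_self])
    rw [map_sub, map_smul, smul_eq_mul, sub_eq_zero] at h1
    rw [h1]
    simp only [_root_.smul_apply, smul_eq_mul]
    ring
  refine ⟨_, lt_of_le_of_ne (div_nonneg_of_nonpos hle hw₀.le) fun h0 => hψ.2.2.1 ?_, heq⟩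
  rw [heq, ← h0, zero_smul]

namespace IsGraphNear

variable [InnerProductSpace ℝ E] {Ω V : Set E} {v : E} {φ : E → ℝ}

theorem fderiv_apply (h : IsGraphNear Ω V v φ) (x : E) : fderiv ℝ φ x v = 1 := by
  have hline : HasDerivAt (fun t : ℝ => x + t • v) v 0 := by
    simpa using ((hasDerivAt_id (0 : ℝ)).smul_const v).const_add x
  have h1 : HasFDerivAt φ (fderiv ℝ φ x) (x + (0 : ℝ) • v) := by
    simpa using (h.contDiff.differentiable (by simp) x).hasFDerivAt
  have h2 := h1.comp_hasDerivAt 0 hline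
  have h3 : HasDerivAt (fun t : ℝ => φ x + t) 1 0 := (hasDerivAt_id 0).const_add _
  refine h2.unique (h3.congr_of_eventuallyEq (Eventually.of_forall fun t => ?_))
  exact h.add_smul x t

theorem isLocalDefining (h : IsGraphNear Ω V v φ) {x : E} (hx : x ∈ V) (h0 : φ x = 0) :
    IsLocalDefining Ω x φ := by
  refine ⟨h.contDiff.contDiffAt, h0, fun hd => ?_, ?_⟩
  · have := h.fderiv_apply x
    simp [hd] at this
  · filter_upwards [h.isOpen.mem_nhds hx] with y hy using h.mem_iff y hy

theorem mem_closure_iff (h : IsGraphNear Ω V v φ) {x : E} (hx : x ∈ V) :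
    x ∈ closure Ω ↔ φ x ≤ 0 := by
  constructor
  · intro hc
    by_contra! hpos
    have h1 : ∀ᶠ y in 𝓝 x, y ∈ V ∧ 0 < φ y :=
      (h.isOpen.eventually_mem hx).and
        (h.contDiff.continuous.continuousAt.eventually (lt_mem_nhds hpos))
    obtain ⟨y, hy, hyΩ⟩ := mem_closure_iff_nhds.1 hc _ h1
    exact absurd ((h.mem_iff y hy.1).1 hyΩ) (not_lt.2 hy.2.le)
  · intro hle
    have hc : Continuous fun t : ℝ => x + t • v := by fun_prop
    have ht : Tendsto (fun t : ℝ => x + t • v) (𝓝[<] 0) (𝓝 x) := by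
      have := hc.tendsto 0
      simp only [zero_smul, add_zero] at this
      exact this.mono_left nhdsWithin_le_nhds
    refine mem_closure_of_tendsto ht ?_
    filter_upwards [ht.eventually (h.isOpen.eventually_mem hx), self_mem_nhdsWithin]
      with t h1 (h2 : t < 0)
    rw [h.mem_iff _ h1, h.add_smul]
    linarith

theorem mem_frontier_iff (h : IsGraphNear Ω V v φ) (hΩ : IsOpen Ω) {x : E} (hx : x ∈ V) :
    x ∈ frontier Ω ↔ φ x = 0 := by
  rw [hΩ.frontier_eq, Set.mem_sdiff, h.mem_closure_iff hx, h.mem_iff x hx, not_lt]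
  exact ⟨fun h => le_antisymm h.1 h.2, fun h => ⟨h.le, h.ge⟩⟩

end IsGraphNear

end DefiningFunctions

/-! ### The Riemannian normal in terms of a defining function. -/

namespace StepTwoCarnot

variable {𝔤 : Type*} [NormedAddCommGroup 𝔤] [InnerProductSpace ℝ 𝔤] {m k : ℕ}

/-- The length of the Riemannian gradient of `φ`. -/
noncomputable def gradNorm (C : StepTwoCarnot 𝔤 m k) (φ : 𝔤 → ℝ) (p : 𝔤) : ℝ :=
  Real.sqrt (∑ a, fderiv ℝ φ p (C.frame a p) ^ 2)

/-- The differential of the left translation by `g`, as a linear map. -/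
noncomputable def dLeftL (C : StepTwoCarnot 𝔤 m k) (g : 𝔤) : 𝔤 →ₗ[ℝ] 𝔤 :=
  LinearMap.id + (1 / 2 : ℝ) • C.bracket g

theorem dLeft_eq_dLeftL (C : StepTwoCarnot 𝔤 m k) (g h v : 𝔤) :
    C.dLeft g h v = C.dLeftL g v := C.dLeft_eq g h v

theorem dLeftL_neg_apply (C : StepTwoCarnot 𝔤 m k) (g v : 𝔤) :
    C.dLeftL (-g) (C.dLeftL g v) = v := by
  simp [dLeftL, C.bracket_bracket]

theorem dLeftL_apply_neg (C : StepTwoCarnot 𝔤 m k) (g v : 𝔤) :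
    C.dLeftL g (C.dLeftL (-g) v) = v := by
  simp [dLeftL, C.bracket_bracket]

theorem metric_gradient (C : StepTwoCarnot 𝔤 m k) (φ : 𝔤 → ℝ) (p w : 𝔤) :
    C.metric p (C.gradient φ p) w = fderiv ℝ φ p w := by
  have h1 : C.dLeft (-p) p (C.gradient φ p) = ∑ a, fderiv ℝ φ p (C.frame a p) • C.basis a := by
    simp only [gradient, dLeft_eq_dLeftL, frame, map_sum, map_smul, dLeftL_neg_apply]
  have h2 : w = C.dLeftL p (C.dLeft (-p) p w) := by
    rw [dLeft_eq_dLeftL, dLeftL_apply_neg]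
  rw [metric, h1, sum_inner]
  conv_rhs => rw [h2, ← C.basis.sum_repr (C.dLeft (-p) p w)]
  simp only [map_sum, map_smul, inner_smul_left, frame, dLeft_eq_dLeftL C p, smul_eq_mul,
    OrthonormalBasis.repr_apply_apply, conj_trivial, mul_comm]

theorem metric_gradient_self (C : StepTwoCarnot 𝔤 m k) (φ : 𝔤 → ℝ) (p : 𝔤) :
    C.metric p (C.gradient φ p) (C.gradient φ p) = ∑ a, fderiv ℝ φ p (C.frame a p) ^ 2 := by
  rw [metric_gradient, gradient, map_sum]
  exact Finset.sum_congr rfl fun a _ => by rw [map_smul, smul_eq_mul, sq]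

theorem metric_smul_left (C : StepTwoCarnot 𝔤 m k) (p : 𝔤) (c : ℝ) (x y : 𝔤) :
    C.metric p (c • x) y = c * C.metric p x y := by
  rw [metric, metric, dLeft_eq, dLeft_eq C (-p) p x, map_smul, smul_comm, ← smul_add,
    inner_smul_left]
  simp

/-- The positive factor between the defining function chosen in `normal` and the given one cancels
after normalization. -/
theorem metric_normal (C : StepTwoCarnot 𝔤 m k) {Ω : Set 𝔤} {p : 𝔤} {φ : 𝔤 → ℝ}
    (h : IsLocalDefining Ω p φ) (w : 𝔤) :
    C.metric p (C.normal Ω p) w = (C.gradNorm φ p)⁻¹ * fderiv ℝ φ p w := by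
  have hex : ∃ φ : 𝔤 → ℝ, IsLocalDefining Ω p φ := ⟨φ, h⟩
  obtain ⟨c, hc, hcφ⟩ := exists_fderiv_eq_smul_of_isLocalDefining h hex.choose_spec
  rw [normal, dif_pos hex, metric_smul_left, metric_gradient_self, metric_gradient, gradNorm, hcφ]
  simp only [_root_.smul_apply, smul_eq_mul, mul_pow, ← Finset.mul_sum]
  rw [Real.sqrt_mul (sq_nonneg c), Real.sqrt_sq hc.le, mul_inv]
  field_simp

theorem gradNorm_pos (C : StepTwoCarnot 𝔤 m k) {φ : 𝔤 → ℝ} {p : 𝔤} (h : fderiv ℝ φ p ≠ 0) :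
    0 < C.gradNorm φ p := by
  rw [gradNorm, Real.sqrt_pos, ← metric_gradient_self]
  refine lt_of_le_of_ne real_inner_self_nonneg fun h0 => h ?_
  have h1 : C.dLeft (-p) p (C.gradient φ p) = 0 := inner_self_eq_zero.1 h0.symm
  ext w
  rw [← metric_gradient, metric, h1, inner_zero_left]
  rfl

theorem horizontalNormal_apply (C : StepTwoCarnot 𝔤 m k) {Ω : Set 𝔤} {p : 𝔤} {φ : 𝔤 → ℝ}
    (h : IsLocalDefining Ω p φ) (j : Fin m) :
    C.horizontalNormal Ω p j = (C.gradNorm φ p)⁻¹ * C.D j φ p := by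
  rw [C.D_eq_fderiv j (h.1.differentiableAt (by simp)), ← C.metric_normal h]
  rfl

theorem metric_normal_sum (C : StepTwoCarnot 𝔤 m k) {Ω : Set 𝔤} {p : 𝔤} {φ : 𝔤 → ℝ}
    (h : IsLocalDefining Ω p φ) (e : Fin m → ℝ) :
    C.metric p (C.normal Ω p) (∑ j, e j • C.X j p) = ∑ j, e j * C.horizontalNormal Ω p j := by
  rw [C.metric_normal h, map_sum, Finset.mul_sum]
  refine Finset.sum_congr rfl fun j _ => ?_
  rw [C.horizontalNormal_apply h, C.D_eq_fderiv j (h.1.differentiableAt (by simp)), map_smul,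
    smul_eq_mul]
  ring

end StepTwoCarnot

/-! ### Horizontal curves in the boundary and boundary relations. -/

namespace StepTwoCarnot

variable {𝔤 : Type*} [NormedAddCommGroup 𝔤] [InnerProductSpace ℝ 𝔤] {m k : ℕ}
  [FiniteDimensional ℝ 𝔤]

/-- Project the constant coefficients τ orthogonally to the horizontal gradient of φ and integrate
the resulting `C¹` field. Its integral curves stay in a level set of φ, and at p the projection
leaves τ unchanged. -/
theorem exists_horizontal_curve_of_tangent (C : StepTwoCarnot 𝔤 m k) {φ : 𝔤 → ℝ} {p : 𝔤}
    (hφ : ContDiff ℝ 2 φ) (hp : ∑ i, C.D i φ p ^ 2 ≠ 0) {τ : Fin m → ℝ}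
    (hτ : ∑ i, τ i * C.D i φ p = 0) :
    ∃ (γ : ℝ → 𝔤) (c : ℝ → Fin m → ℝ) (δ : ℝ), 0 < δ ∧ γ 0 = p ∧ c 0 = τ ∧
      ContinuousOn c (Ioo (-δ) δ) ∧
      ∀ t ∈ Ioo (-δ) δ, HasDerivAt γ (∑ j, c t j • C.X j (γ t)) t ∧ φ (γ t) = φ p := by
  let S : 𝔤 → ℝ := fun g => ∑ i, C.D i φ g ^ 2
  let b : 𝔤 → Fin m → ℝ := fun g j => τ j - (∑ i, τ i * C.D i φ g) / S g * C.D j φ g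
  have hD : ∀ i, ContDiff ℝ 1 (C.D i φ) := fun i => C.contDiff_D (n := 1) i hφ
  have hS : ContDiff ℝ 1 S := ContDiff.sum fun i _ => (hD i).pow 2
  have hb : ∀ g, S g ≠ 0 → ContDiffAt ℝ 1 b g := by
    intro g hg
    rw [contDiffAt_pi]
    intro j
    exact contDiffAt_const.sub ((((ContDiff.sum fun i _ =>
      contDiff_const.mul (hD i)).contDiffAt).div hS.contDiffAt hg).mul (hD j).contDiffAt)
  have hF : ContDiffAt ℝ 1 (fun g => ∑ j, b g j • C.X j g) p :=
    ContDiffAt.sum fun j _ => (contDiffAt_pi.1 (hb p hp) j).smul (C.contDiff_X j).contDiffAt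
  obtain ⟨γ, hγ0, ε, hε, hγ⟩ :=
    hF.exists_forall_mem_closedBall_exists_eq_forall_mem_Ioo_hasDerivAt₀ 0
  simp only [zero_sub, zero_add] at hγ
  have hγc : ContinuousAt γ 0 := (hγ 0 ⟨by linarith, hε⟩).continuousAt
  have hev : ∀ᶠ t in 𝓝 (0 : ℝ), S (γ t) ≠ 0 :=
    (hS.continuous.continuousAt.comp hγc).eventually_ne (by rw [Function.comp, hγ0]; exact hp)
  obtain ⟨δ', hδ', hδS⟩ := Metric.eventually_nhds_iff.1 hev
  have hmem : ∀ t ∈ Ioo (-min ε δ') (min ε δ'), t ∈ Ioo (-ε) ε ∧ S (γ t) ≠ 0 := by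
    intro t ht
    have h1 := abs_lt.2 ht
    refine ⟨abs_lt.1 (h1.trans_le (min_le_left _ _)), hδS ?_⟩
    rw [Real.dist_eq, sub_zero]
    exact h1.trans_le (min_le_right _ _)
  refine ⟨γ, fun t => b (γ t), min ε δ', lt_min hε hδ', hγ0, ?_, ?_,
    fun t ht => ⟨hγ t (hmem t ht).1, ?_⟩⟩
  · funext j
    simp [b, hγ0, hτ]
  · intro t ht
    exact ((hb _ (hmem t ht).2).continuousAt.comp
      (hγ t (hmem t ht).1).continuousAt).continuousWithinAt
  · have hd : ∀ t ∈ Ioo (-min ε δ') (min ε δ'), HasDerivAt (fun t => φ (γ t)) 0 t := by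
      intro t ht
      have h1 := (hφ.differentiable (by simp) (γ t)).hasFDerivAt.comp_hasDerivAt t
        (hγ t (hmem t ht).1)
      refine HasDerivAt.congr_deriv h1 ?_
      have hS0 := (hmem t ht).2
      have h2 : ∀ j, fderiv ℝ φ (γ t) (C.X j (γ t)) = C.D j φ (γ t) := fun j =>
        (C.D_eq_fderiv j (hφ.differentiable (by simp) _)).symm
      simp only [map_sum, map_smul, h2, smul_eq_mul, b, sub_mul, Finset.sum_sub_distrib]
      simp only [_root_.mul_assoc, ← Finset.mul_sum, ← sq]
      rw [div_mul_cancel₀ _ hS0, sub_self]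
    have h0 : (0 : ℝ) ∈ Ioo (-min ε δ') (min ε δ') :=
      ⟨by have := lt_min hε hδ'; linarith, lt_min hε hδ'⟩
    have := isOpen_Ioo.is_const_of_deriv_eq_zero isPreconnected_Ioo
      (f := fun t => φ (γ t))
      (fun t ht => (hd t ht).differentiableAt.differentiableWithinAt)
      (fun t ht => (hd t ht).deriv) ht h0
    simpa [hγ0] using this

/-- Left translations push points of a hypersurface into its interior side. -/
theorem eventually_mul_smul_mem (C : StepTwoCarnot 𝔤 m k) {Ω V : Set 𝔤} {v : 𝔤} {φ : 𝔤 → ℝ}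
    (h : IsGraphNear Ω V v φ) {p : 𝔤} (hp : p ∈ V) :
    ∃ ξ : 𝔤, ∃ δ > 0, ∀ s ∈ Ioo 0 δ, ∀ x ∈ Metric.ball p δ, φ x = 0 → C.mul (s • ξ) x ∈ Ω := by
  -- The curve s ↦ (s ξ) x has velocity ζ(x) = ξ + ½[ξ, x]. The correction ½[v, p] makes this
  -- velocity at p equal to −v, which points into Ω.
  let ξ : 𝔤 := -v + (1 / 2 : ℝ) • C.bracket v p
  let ζ : 𝔤 → 𝔤 := fun x => ξ + (1 / 2 : ℝ) • C.bracketL ξ x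
  have hζp : ζ p = -v := by
    change ξ + (1 / 2 : ℝ) • C.bracket ξ p = -v
    simp only [ξ, map_add, map_neg, map_smul, LinearMap.add_apply,
      LinearMap.neg_apply, LinearMap.smul_apply, C.bracket_left_of_mem_V₂ (C.bracket_mem v p)]
    module
  have hmul : ∀ (s : ℝ) x, C.mul (s • ξ) x = x + s • ζ x := by
    intro s x
    simp only [mul, ζ, bracketL_apply, map_smul, LinearMap.smul_apply]
    module
  have hζ : Continuous ζ := by fun_prop
  have e1 : ∀ᶠ x in 𝓝 p, fderiv ℝ φ p (ζ x) < -3 / 4 := by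
    refine ((fderiv ℝ φ p).continuous.comp hζ).continuousAt.eventually (gt_mem_nhds ?_)
    simp only [Function.comp, hζp, map_neg, h.fderiv_apply]
    norm_num
  have e2 : ∀ᶠ x in 𝓝 p, ‖ζ x‖ < 2 := by
    refine hζ.norm.continuousAt.eventually (gt_mem_nhds ?_)
    simp only [hζp, norm_neg, h.norm_eq]
    norm_num
  have hc : Continuous fun q : ℝ × 𝔤 => (q.2 + q.1 • ζ q.2, q.2) := by fun_prop
  have ht : Tendsto (fun q : ℝ × 𝔤 => (q.2 + q.1 • ζ q.2, q.2)) (𝓝 (0, p)) (𝓝 (p, p)) := by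
    have := hc.tendsto (0, p)
    simpa using this
  -- With dφ(ζ) < −3/4, |ζ| < 2 and relative error 1/4, the translated point has φ < −3s/4 + s/2 <
  -- 0, uniformly for boundary points near p.
  have hstrict := (h.contDiff.contDiffAt.hasStrictFDerivAt (x := p) (by simp)).isLittleO.def
    (c := 1 / 4) (by norm_num)
  have e3 : ∀ᶠ q : ℝ × 𝔤 in 𝓝 (0, p), fderiv ℝ φ p (ζ q.2) < -3 / 4 ∧ ‖ζ q.2‖ < 2 ∧
      q.2 + q.1 • ζ q.2 ∈ V ∧ ‖φ (q.2 + q.1 • ζ q.2) - φ q.2 -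
        fderiv ℝ φ p (q.2 + q.1 • ζ q.2 - q.2)‖ ≤ 1 / 4 * ‖q.2 + q.1 • ζ q.2 - q.2‖ := by
    have hsnd : Tendsto (fun q : ℝ × 𝔤 => q.2) (𝓝 (0, p)) (𝓝 p) := continuous_snd.tendsto _
    filter_upwards [hsnd.eventually e1, hsnd.eventually e2, ht.eventually hstrict,
      ht.eventually (((continuous_fst (X := 𝔤) (Y := 𝔤)).tendsto (p, p)).eventually
        (h.isOpen.eventually_mem hp))]
      with q h1 h2 h3 h4
    exact ⟨h1, h2, h4, h3⟩
  obtain ⟨δ, hδ, hb⟩ := Metric.eventually_nhds_iff.1 e3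
  refine ⟨ξ, δ, hδ, fun s hs x hx hφx => ?_⟩
  obtain ⟨h1, h2, h3, h4⟩ := hb (y := (s, x)) (by
    rw [Prod.dist_eq, max_lt_iff]
    refine ⟨?_, hx⟩
    rw [Real.dist_eq, sub_zero, abs_of_pos hs.1]
    exact hs.2)
  rw [hmul, h.mem_iff _ h3]
  simp only [hφx, sub_zero, add_sub_cancel_left, map_smul, smul_eq_mul, norm_smul,
    Real.norm_eq_abs, abs_of_pos hs.1] at h4
  have h5 := (abs_le.1 h4).2
  nlinarith [hs.1, mul_lt_mul_of_pos_left h1 hs.1, mul_lt_mul_of_pos_left h2 hs.1]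

variable [MeasurableSpace 𝔤] [BorelSpace 𝔤]

/-- Functions of class `Γ¹` up to the boundary can be differentiated along a horizontal curve in
the boundary with any prescribed horizontal tangent direction. -/
theorem exists_boundary_curve (C : StepTwoCarnot 𝔤 m k) {Ω V : Set 𝔤} {v : 𝔤} {φ : 𝔤 → ℝ}
    (hΩ : IsOpen Ω) (h : IsGraphNear Ω V v φ) {p : 𝔤} (hp : p ∈ V) (h0 : φ p = 0)
    (hnc : ∑ i, C.D i φ p ^ 2 ≠ 0) {τ : Fin m → ℝ} (hτ : ∑ i, τ i * C.D i φ p = 0) :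
    ∃ γ : ℝ → 𝔤, γ 0 = p ∧ HasDerivAt γ (∑ j, τ j • C.X j p) 0 ∧
      (∀ᶠ t in 𝓝 (0 : ℝ), φ (γ t) = 0) ∧
      ∀ (w w₀ : 𝔤 → ℝ) (w₁ : Fin m → 𝔤 → ℝ), C.Gamma Ω 1 w → Continuous w₀ →
        (∀ j, Continuous (w₁ j)) → EqOn w₀ w Ω → (∀ j, EqOn (w₁ j) (C.D j w) Ω) →
        HasDerivAt (fun t => w₀ (γ t)) (∑ j, τ j * w₁ j p) 0 := by
  obtain ⟨γ, c, δ, hδ, hγ0, hc0, hc, hγ⟩ := C.exists_horizontal_curve_of_tangent h.contDiff hnc hτ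
  obtain ⟨ξ, δ', hδ', hpush⟩ := C.eventually_mul_smul_mem h hp
  have hz : (0 : ℝ) ∈ Ioo (-δ) δ := ⟨by linarith, hδ⟩
  have hd0 : HasDerivAt γ (∑ j, τ j • C.X j p) 0 := by
    have := (hγ 0 hz).1
    rwa [hγ0, hc0] at this
  have hball : ∀ᶠ t in 𝓝 (0 : ℝ), γ t ∈ Metric.ball p δ' := by
    have := hd0.continuousAt.tendsto
    rw [hγ0] at this
    exact this.eventually (Metric.ball_mem_nhds p hδ')
  obtain ⟨δ₁, hδ₁, hb⟩ := Metric.eventually_nhds_iff.1 hball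
  have hpos : 0 < min δ (min δ' δ₁) := lt_min hδ (lt_min hδ' hδ₁)
  have hsub : Ioo (-min δ (min δ' δ₁)) (min δ (min δ' δ₁)) ⊆ Ioo (-δ) δ :=
    Ioo_subset_Ioo (neg_le_neg (min_le_left _ _)) (min_le_left _ _)
  refine ⟨γ, hγ0, hd0, ?_, fun w w₀ w₁ hw hw₀ hw₁ e₀ e₁ => ?_⟩
  · filter_upwards [isOpen_Ioo.mem_nhds hz] with t ht
    rw [(hγ t ht).2, h0]
  · have := hw.hasDerivAt_of_push hΩ hw₀ hw₁ e₀ e₁ hpos (γ := γ) (c := c) (ξ := ξ)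
      (fun t ht => (hγ t (hsub ht)).1) (hc.mono hsub) (fun s hs t ht => by
        refine hpush s ⟨hs.1, hs.2.trans_le ((min_le_right _ _).trans (min_le_left _ _))⟩ _
          (hb ?_) (by rw [(hγ t (hsub ht)).2, h0])
        rw [Real.dist_eq, sub_zero]
        exact (abs_lt.2 ht).trans_le ((min_le_right _ _).trans (min_le_right _ _)))
    rwa [hγ0, hc0] at this

/-- The horizontal gradient of a function vanishing on the boundary is normal. -/
theorem sum_mul_grad_eq_zero (C : StepTwoCarnot 𝔤 m k) {Ω V : Set 𝔤} {v : 𝔤} {φ : 𝔤 → ℝ}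
    (hΩ : IsOpen Ω) (h : IsGraphNear Ω V v φ) {p : 𝔤} (hp : p ∈ V) (h0 : φ p = 0)
    (hnc : ∑ i, C.D i φ p ^ 2 ≠ 0) {τ : Fin m → ℝ} (hτ : ∑ i, τ i * C.D i φ p = 0)
    {u u₀ : 𝔤 → ℝ} {u₁ : Fin m → 𝔤 → ℝ} (hu : C.Gamma Ω 1 u) (hu₀ : Continuous u₀)
    (hu₁ : ∀ j, Continuous (u₁ j)) (e₀ : EqOn u₀ u Ω) (e₁ : ∀ j, EqOn (u₁ j) (C.D j u) Ω)
    (hb : ∀ x ∈ frontier Ω, u₀ x = 0) : ∑ j, τ j * u₁ j p = 0 := by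
  obtain ⟨γ, hγ0, hγ, hφγ, hw⟩ := C.exists_boundary_curve hΩ h hp h0 hnc hτ
  have h1 := hw u u₀ u₁ hu hu₀ hu₁ e₀ e₁
  refine h1.unique ((hasDerivAt_const (0 : ℝ) (0 : ℝ)).congr_of_eventuallyEq ?_)
  have hV : ∀ᶠ t in 𝓝 (0 : ℝ), γ t ∈ V :=
    hγ.continuousAt.eventually (by rw [hγ0]; exact h.isOpen.mem_nhds hp)
  filter_upwards [hφγ, hV] with t h2 h3
  exact hb _ ((h.mem_frontier_iff hΩ h3).2 h2)

/-- The second order relation along the boundary. -/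
theorem second_order_boundary (C : StepTwoCarnot 𝔤 m k) {Ω V : Set 𝔤} {v : 𝔤} {φ : 𝔤 → ℝ}
    (hΩ : IsOpen Ω) (h : IsGraphNear Ω V v φ) {p : 𝔤} (hp : p ∈ V) (h0 : φ p = 0)
    (hnc : ∑ i, C.D i φ p ^ 2 ≠ 0) {e : 𝔤 → EuclideanSpace ℝ (Fin m)} (he : ContDiffAt ℝ 1 e p)
    (hort : ∀ᶠ g in 𝓝[frontier Ω] p, ∑ j, e g j * C.D j φ g = 0)
    {u u₀ : 𝔤 → ℝ} {u₁ : Fin m → 𝔤 → ℝ} {u₂ : Fin m → Fin m → 𝔤 → ℝ} (hu : C.Gamma Ω 2 u)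
    (hu₀ : Continuous u₀) (hu₁ : ∀ j, Continuous (u₁ j)) (hu₂ : ∀ i j, Continuous (u₂ i j))
    (e₀ : EqOn u₀ u Ω) (e₁ : ∀ j, EqOn (u₁ j) (C.D j u) Ω)
    (e₂ : ∀ i j, EqOn (u₂ i j) (C.D i (C.D j u)) Ω) (hb : ∀ x ∈ frontier Ω, u₀ x = 0) :
    ∑ j, C.connection e e p j * u₁ j p + ∑ i, ∑ j, e p i * e p j * u₂ i j p = 0 := by
  have hpf : p ∈ frontier Ω := (h.mem_frontier_iff hΩ hp).2 h0
  obtain ⟨γ, hγ0, hγ, hφγ, hw⟩ := C.exists_boundary_curve hΩ h hp h0 hnc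
    (τ := e p) (hort.self_of_nhdsWithin hpf)
  have hγt : Tendsto γ (𝓝 0) (𝓝 p) := by
    have := hγ.continuousAt.tendsto
    rwa [hγ0] at this
  have hd1 : ∀ j, HasDerivAt (fun t => u₁ j (γ t)) (∑ i, e p i * u₂ i j p) 0 := fun j =>
    hw (C.D j u) (u₁ j) (fun i => u₂ i j) (hu.2 j).2 (hu₁ j) (fun i => hu₂ i j) (e₁ j)
      (fun i => e₂ i j)
  have hd2 : ∀ j, HasDerivAt (fun t => e (γ t) j) (C.connection e e p j) 0 := by
    intro j
    have h1 : HasFDerivAt e (fderiv ℝ e p) (γ 0) := by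
      rw [hγ0]; exact (he.differentiableAt (by simp)).hasFDerivAt
    exact (EuclideanSpace.proj (𝕜 := ℝ) j).hasFDerivAt.comp_hasDerivAt 0 (h1.comp_hasDerivAt 0 hγ)
  have hsum := HasDerivAt.fun_sum (u := Finset.univ) fun j _ => (hd2 j).mul (hd1 j)
  -- Noncharacteristic points form an open set, so ∇_H u is normal at all points of the curve near p
  -- and the sum vanishes identically. Its derivative by the product rule is the asserted relation.
  have hzero : (fun t => ∑ j, e (γ t) j * u₁ j (γ t)) =ᶠ[𝓝 0] fun _ => 0 := by
    have hcD : Continuous fun g => ∑ i, C.D i φ g ^ 2 := continuous_finsetSum _ fun i _ =>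
      (C.contDiff_D (n := 0) i (h.contDiff.of_le (by norm_num))).continuous.pow 2
    filter_upwards [hφγ, hγt.eventually (h.isOpen.mem_nhds hp),
      hγt.eventually (eventually_nhdsWithin_iff.1 hort),
      hγt.eventually (hcD.continuousAt.eventually_ne hnc)] with t h1 h2 h3 h4
    exact C.sum_mul_grad_eq_zero hΩ h h2 h1 h4 (h3 ((h.mem_frontier_iff hΩ h2).2 h1)) hu.of_succ
      hu₀ hu₁ e₀ e₁ hb
  have := hsum.unique ((hasDerivAt_const (0 : ℝ) (0 : ℝ)).congr_of_eventuallyEq hzero)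
  rw [← this, Finset.sum_add_distrib]
  simp only [hγ0]
  congr 1
  rw [Finset.sum_comm]
  simp only [Finset.mul_sum]
  exact Finset.sum_congr rfl fun j _ => Finset.sum_congr rfl fun i _ => by ring

end StepTwoCarnot

/-! ### Horizontal tangent frames and the normal flux. -/

/-- A `C¹` field of unit vectors can be completed locally by a `C¹` orthonormal frame. -/
theorem exists_contDiffAt_orthonormal_frame {E F : Type*} [NormedAddCommGroup E] [NormedSpace ℝ E]
    [NormedAddCommGroup F] [InnerProductSpace ℝ F] [FiniteDimensional ℝ F] {d : ℕ}
    (hd : Module.finrank ℝ F = d + 1) {n : E → F} {p : E} (hn : ContDiffAt ℝ 1 n p)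
    (h1 : ∀ᶠ g in 𝓝 p, ‖n g‖ = 1) :
    ∃ e : Fin d → E → F, (∀ a, ContDiffAt ℝ 1 (e a) p) ∧
      ∀ᶠ g in 𝓝 p, Orthonormal ℝ (fun a => e a g) ∧ ∀ a, inner ℝ (e a g) (n g) = 0 := by
  have hp := h1.self_of_nhds
  have hp0 : n p ≠ 0 := by
    intro h0
    simp [h0] at hp
  have : Fact (Module.finrank ℝ F = d + 1) := ⟨hd⟩
  let f₀ := (stdOrthonormalBasis ℝ (ℝ ∙ n p)ᗮ).reindex
    (finCongr (Submodule.finrank_orthogonal_span_singleton (𝕜 := ℝ) (n := d) hp0))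
  let f : Fin d → F := fun a => (f₀ a : F)
  have hf : Orthonormal ℝ f := f₀.orthonormal.comp_linearIsometry (ℝ ∙ n p)ᗮ.subtypeₗᵢ
  have hfn : ∀ a, inner ℝ (n p) (f a) = 0 := fun a =>
    Submodule.mem_orthogonal_singleton_iff_inner_right.1 (f₀ a).2
  -- The reflection in the hyperplane orthogonal to n(p) + n(g) maps n(p) to −n(g). Applied to a
  -- fixed basis of the orthogonal complement of n(p), it gives a frame orthogonal to n(g); it is
  -- regular near p because w(p) = 2 n(p).
  let w : E → F := fun g => n p + n g
  have hw : ContDiffAt ℝ 1 w p := contDiffAt_const.add hn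
  have hwp : inner ℝ (w p) (w p) ≠ (0 : ℝ) := by
    rw [inner_self_ne_zero]
    simp only [w, ← two_smul ℝ]
    exact smul_ne_zero two_ne_zero hp0
  have hww : ContDiffAt ℝ 1 (fun g => inner ℝ (w g) (w g)) p := hw.inner ℝ hw
  refine ⟨fun a g => f a - (2 * inner ℝ (w g) (f a) / inner ℝ (w g) (w g)) • w g, fun a => ?_, ?_⟩
  · exact contDiffAt_const.sub (((contDiffAt_const.mul (hw.inner ℝ contDiffAt_const)).div hww
      hwp).smul hw)
  · filter_upwards [h1, hww.continuousAt.eventually_ne hwp] with g hg hg0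
    constructor
    · rw [orthonormal_iff_ite] at hf ⊢
      intro a b
      rw [← hf a b]
      simp only [inner_sub_left, inner_sub_right, inner_smul_left, inner_smul_right, conj_trivial,
        real_inner_comm (w g) (f a)]
      field_simp
      ring
    · intro a
      have e1 : inner ℝ (w g) (w g) = 2 * inner ℝ (w g) (n g) := by
        simp only [w, inner_add_left, inner_add_right, real_inner_self_eq_norm_sq, hp, hg,
          real_inner_comm (n g) (n p)]
        ring
      have e2 : inner ℝ (w g) (f a) = inner ℝ (f a) (n g) := by
        simp only [w, inner_add_left, hfn, zero_add, real_inner_comm]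
      have e3 : inner ℝ (w g) (n g) ≠ (0 : ℝ) := by
        intro h0; rw [e1, h0] at hg0; simp at hg0
      simp only [inner_sub_left, inner_smul_left, conj_trivial]
      rw [e1, e2]
      field_simp
      ring

/-- Together with N/|N| the m − 1 vectors form an orthonormal basis, and the claim is its
completeness relation. It converts traces over the tangent frame into full traces minus the normal
entry. -/
theorem sum_orthonormal_mul {m : ℕ} {e : Fin (m - 1) → EuclideanSpace ℝ (Fin m)}
    (he : Orthonormal ℝ e) {N : EuclideanSpace ℝ (Fin m)} (hN : N ≠ 0)
    (heN : ∀ a, inner ℝ (e a) N = 0) (i j : Fin m) :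
    ∑ a, e a i * e a j = (if i = j then 1 else 0) - N i * N j / ‖N‖ ^ 2 := by
  have hm : m ≠ 0 := by
    rintro rfl
    exact i.elim0
  have hn0 : ‖N‖ ≠ 0 := norm_ne_zero_iff.2 hN
  let w : Fin (m - 1) ⊕ Unit → EuclideanSpace ℝ (Fin m) := Sum.elim e fun _ => ‖N‖⁻¹ • N
  have hw : Orthonormal ℝ w := by
    rw [orthonormal_iff_ite] at he ⊢
    rintro (a | a) (b | b)
    · simp [w, he]
    · simp [w, inner_smul_right, heN]
    · simp [w, inner_smul_left, (real_inner_comm _ _).trans (heN b)]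
    · simp only [w, Sum.elim_inr, inner_smul_left, inner_smul_right, conj_trivial,
        real_inner_self_eq_norm_sq]
      field_simp
      simp
  have hspan := hw.linearIndependent.span_eq_top_of_card_eq_finrank' (by
    simp only [Fintype.card_sum, Fintype.card_fin, Fintype.card_unit, finrank_euclideanSpace]
    omega)
  have h := (OrthonormalBasis.mk hw hspan.ge).sum_inner_mul_inner
    (EuclideanSpace.single i (1 : ℝ)) (EuclideanSpace.single j (1 : ℝ))
  simp only [OrthonormalBasis.coe_mk, Fintype.sum_sum_type, Finset.univ_unique,
    Finset.sum_singleton, w, Sum.elim_inl, Sum.elim_inr, EuclideanSpace.inner_single_left,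
    EuclideanSpace.inner_single_right, map_one, one_mul, PiLp.smul_apply, smul_eq_mul,
    conj_trivial, PiLp.single_apply, eq_comm (a := j)] at h
  rw [eq_sub_iff_add_eq, ← h]
  congr 1
  field_simp

namespace StepTwoCarnot

variable {𝔤 : Type*} [NormedAddCommGroup 𝔤] [InnerProductSpace ℝ 𝔤] {m k : ℕ}

theorem angle_sq (C : StepTwoCarnot 𝔤 m k) (Ω : Set 𝔤) (p : 𝔤) :
    C.angle Ω p ^ 2 = ∑ i, C.horizontalNormal Ω p i ^ 2 := by
  rw [angle, EuclideanSpace.norm_sq_eq]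
  simp

theorem sum_sq_D_ne_zero (C : StepTwoCarnot 𝔤 m k) {Ω : Set 𝔤} {p : 𝔤} {φ : 𝔤 → ℝ}
    (h : IsLocalDefining Ω p φ) (hW : C.angle Ω p ≠ 0) : ∑ i, C.D i φ p ^ 2 ≠ 0 := by
  intro h0
  apply hW
  rw [← sq_eq_zero_iff, angle_sq]
  simp only [C.horizontalNormal_apply h, mul_pow, ← Finset.mul_sum, h0, MulZeroClass.mul_zero]

variable [FiniteDimensional ℝ 𝔤]

theorem exists_isTangentFrame (C : StepTwoCarnot 𝔤 m k) {Ω V : Set 𝔤} {v : 𝔤} {φ : 𝔤 → ℝ}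
    (hΩ : IsOpen Ω) (h : IsGraphNear Ω V v φ) {p : 𝔤} (hp : p ∈ V)
    (hnc : ∑ i, C.D i φ p ^ 2 ≠ 0) : ∃ e, C.IsTangentFrame Ω p e := by
  have hm : m ≠ 0 := by
    rintro rfl
    simp at hnc
  let N : 𝔤 → EuclideanSpace ℝ (Fin m) := fun g => WithLp.toLp 2 fun j => C.D j φ g
  have hN : ContDiff ℝ 1 N := by
    rw [contDiff_euclidean]
    exact fun j => C.contDiff_D (n := 1) j h.contDiff
  have hNp : N p ≠ 0 := by
    intro h0
    apply hnc
    refine Finset.sum_eq_zero fun i _ => ?_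
    have : N p i = 0 := by rw [h0]; rfl
    have h2 : C.D i φ p = 0 := this
    simp [h2]
  have hn : ContDiffAt ℝ 1 (fun g => ‖N g‖⁻¹ • N g) p :=
    ((hN.contDiffAt.norm ℝ hNp).inv (norm_ne_zero_iff.2 hNp)).smul hN.contDiffAt
  obtain ⟨e, he, heo⟩ := exists_contDiffAt_orthonormal_frame (d := m - 1)
    (by rw [finrank_euclideanSpace, Fintype.card_fin]; omega) hn
    ((hN.continuous.continuousAt.eventually_ne hNp).mono fun g hg => norm_smul_inv_norm hg)
  refine ⟨e, he, ?_⟩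
  filter_upwards [nhdsWithin_le_nhds heo, nhdsWithin_le_nhds (h.isOpen.mem_nhds hp),
    nhdsWithin_le_nhds (hN.continuous.continuousAt.eventually_ne hNp), self_mem_nhdsWithin]
    with g h1 h2 h3 h4
  have hld := h.isLocalDefining h2 ((h.mem_frontier_iff hΩ h2).1 h4)
  refine ⟨h1.1, fun a => ?_⟩
  have h5 := h1.2 a
  rw [inner_smul_right, mul_eq_zero, or_iff_right (inv_ne_zero (norm_ne_zero_iff.2 h3)),
    PiLp.inner_apply] at h5
  have h6 : ∑ j, e a g j * C.D j φ g = 0 := by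
    rw [← h5]
    exact Finset.sum_congr rfl fun j _ => by simp [N, mul_comm]
  rw [C.metric_normal_sum hld (fun j => e a g j)]
  simp only [C.horizontalNormal_apply hld]
  calc _ = (C.gradNorm φ g)⁻¹ * ∑ j, e a g j * C.D j φ g := by
        rw [Finset.mul_sum]
        exact Finset.sum_congr rfl fun j _ => by ring
    _ = 0 := by rw [h6, MulZeroClass.mul_zero]

variable [MeasurableSpace 𝔤] [BorelSpace 𝔤]

/-- The normal component of the flux at a noncharacteristic boundary point. -/
theorem sum_horizontalNormal_mul_flux (C : StepTwoCarnot 𝔤 m k) {Ω V : Set 𝔤} {v : 𝔤} {φ : 𝔤 → ℝ}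
    (hΩ : IsOpen Ω) (h : IsGraphNear Ω V v φ) {p : 𝔤} (hp : p ∈ V) (hpf : p ∈ frontier Ω)
    (hW : C.angle Ω p ≠ 0)
    {u u₀ : 𝔤 → ℝ} {u₁ : Fin m → 𝔤 → ℝ} {u₂ : Fin m → Fin m → 𝔤 → ℝ} (hu : C.Gamma Ω 2 u)
    (hu₀ : Continuous u₀) (hu₁ : ∀ j, Continuous (u₁ j)) (hu₂ : ∀ i j, Continuous (u₂ i j))
    (e₀ : EqOn u₀ u Ω) (e₁ : ∀ j, EqOn (u₁ j) (C.D j u) Ω)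
    (e₂ : ∀ i j, EqOn (u₂ i j) (C.D i (C.D j u)) Ω) (hb : ∀ x ∈ frontier Ω, u₀ x = 0) :
    ∑ j, C.horizontalNormal Ω p j * flux (fun i => u₁ i p) (fun i j => u₂ i j p) j =
      -(C.angle Ω p * (C.meanCurvatureAux Ω p * ∑ j, u₁ j p ^ 2)) := by
  have h0 : φ p = 0 := (h.mem_frontier_iff hΩ hp).1 hpf
  have hld := h.isLocalDefining hp h0
  have hnc := C.sum_sq_D_ne_zero hld hW
  have hex := C.exists_isTangentFrame hΩ h hp hnc
  rw [meanCurvatureAux, dif_pos hex]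
  obtain ⟨he, heo⟩ := hex.choose_spec
  generalize hex.choose = e at he heo
  set N := C.horizontalNormal Ω p with hNdef
  have hN0 : N ≠ 0 := norm_ne_zero_iff.1 hW
  have hW2 : C.angle Ω p ^ 2 = ∑ i, N i ^ 2 := C.angle_sq Ω p
  have hgp := C.gradNorm_pos hld.2.2.1
  have hND : ∀ j, C.D j φ p = C.gradNorm φ p * N j := fun j => by
    rw [hNdef, C.horizontalNormal_apply hld, mul_inv_cancel_left₀ hgp.ne']
  have hort : ∀ a, ∀ᶠ g in 𝓝[frontier Ω] p, ∑ j, e a g j * C.D j φ g = 0 := by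
    intro a
    filter_upwards [heo, nhdsWithin_le_nhds (h.isOpen.mem_nhds hp), self_mem_nhdsWithin]
      with g h1 h2 h3
    have hldg := h.isLocalDefining h2 ((h.mem_frontier_iff hΩ h2).1 h3)
    have hg := (C.gradNorm_pos hldg.2.2.1).ne'
    have h4 := h1.2 a
    rw [C.metric_normal_sum hldg (fun j => e a g j)] at h4
    simp only [C.horizontalNormal_apply hldg] at h4
    have h5 : (C.gradNorm φ g)⁻¹ * ∑ j, e a g j * C.D j φ g = 0 := by
      rw [← h4, Finset.mul_sum]
      exact Finset.sum_congr rfl fun j _ => by ring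
    exact (mul_eq_zero.1 h5).resolve_left (inv_ne_zero hg)
  obtain ⟨heon, -⟩ := heo.self_of_nhdsWithin hpf
  have hinner : ∀ x : EuclideanSpace ℝ (Fin m), inner ℝ x N = ∑ j, x j * N j := fun x => by
    rw [PiLp.inner_apply]
    exact Finset.sum_congr rfl fun j _ => by simp [mul_comm]
  have heN : ∀ a, inner ℝ (e a p) N = 0 := by
    intro a
    have h1 := (hort a).self_of_nhdsWithin hpf
    simp only [hND] at h1
    have h2 : C.gradNorm φ p * ∑ j, e a p j * N j = 0 := by
      rw [← h1, Finset.mul_sum]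
      exact Finset.sum_congr rfl fun j _ => by ring
    rw [hinner]
    exact (mul_eq_zero.1 h2).resolve_left hgp.ne'
  have htr := sum_orthonormal_mul heon hN0 heN
  have hnorm : ‖N‖ ^ 2 = C.angle Ω p ^ 2 := rfl
  -- the horizontal gradient is normal
  obtain ⟨l, hl⟩ : ∃ l : ℝ, ∀ j, u₁ j p = l * N j := by
    refine ⟨(∑ i, u₁ i p * N i) / C.angle Ω p ^ 2, ?_⟩
    -- Chosen so that τ = ∇_H u − l N is orthogonal to N. Then u has zero derivative along τ, which
    -- makes |τ|² vanish.
    set l := (∑ i, u₁ i p * N i) / C.angle Ω p ^ 2 with hl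
    have hτN : ∑ i, (u₁ i p - l * N i) * N i = 0 := by
      simp only [sub_mul, Finset.sum_sub_distrib, _root_.mul_assoc, ← Finset.mul_sum, ← sq]
      rw [← hW2, hl, div_mul_cancel₀ _ (pow_ne_zero 2 hW), sub_self]
    have h1 := C.sum_mul_grad_eq_zero hΩ h hp h0 hnc (τ := fun i => u₁ i p - l * N i) (by
      simp only [hND, mul_left_comm, ← Finset.mul_sum]
      rw [hτN, MulZeroClass.mul_zero]) hu.of_succ hu₀ hu₁ e₀ e₁ hb
    have h2 : ∑ i, (u₁ i p - l * N i) ^ 2 = 0 := by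
      have : ∀ i, (u₁ i p - l * N i) ^ 2 = (u₁ i p - l * N i) * u₁ i p -
        l * ((u₁ i p - l * N i) * N i) := fun i => by ring
      simp only [this, Finset.sum_sub_distrib, ← Finset.mul_sum, hτN]
      rw [h1]; simp
    intro j
    have h3 := (Finset.sum_eq_zero_iff_of_nonneg (fun i _ => sq_nonneg _)).1 h2 j
      (Finset.mem_univ j)
    have := pow_eq_zero_iff (two_ne_zero) |>.1 h3
    linarith
  have hsecond : ∀ a, ∑ i, ∑ j, e a p i * e a p j * u₂ i j p =
      -(l * inner ℝ (C.connection (e a) (e a) p) N) := by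
    intro a
    have h1 := C.second_order_boundary hΩ h hp h0 hnc (he a) (hort a) hu hu₀ hu₁ hu₂ e₀ e₁ e₂ hb
    rw [hinner, Finset.mul_sum]
    simp only [hl] at h1
    have h2 : ∑ j, C.connection (e a) (e a) p j * (l * N j) =
      ∑ j, l * (C.connection (e a) (e a) p j * N j) :=
        Finset.sum_congr rfl fun j _ => by ring
    linarith
  have htrace : ∑ a, ∑ i, ∑ j, e a p i * e a p j * u₂ i j p =
      ∑ i, u₂ i i p - (∑ i, ∑ j, N i * N j * u₂ i j p) / C.angle Ω p ^ 2 := by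
    rw [Finset.sum_comm]
    have h1 : ∀ i, ∑ a, ∑ j, e a p i * e a p j * u₂ i j p =
        u₂ i i p - (∑ j, N i * N j * u₂ i j p) / C.angle Ω p ^ 2 := by
      intro i
      rw [Finset.sum_comm]
      simp only [← Finset.sum_mul, htr, hnorm, sub_mul, Finset.sum_sub_distrib, ite_mul, one_mul,
        MulZeroClass.zero_mul, Finset.sum_ite_eq, Finset.mem_univ, if_true, Finset.sum_div]
      congr 1
      exact Finset.sum_congr rfl fun j _ => by ring
    simp only [h1, Finset.sum_sub_distrib, Finset.sum_div]
  -- Once ∇_H u = l N, the weights N_i N_j are symmetric, so 2 A_ij − A_ji contributes like A_ij and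
  -- the commutators disappear.
  have hflux : ∑ j, N j * flux (fun i => u₁ i p) (fun i j => u₂ i j p) j =
      l * (∑ i, ∑ j, N i * N j * u₂ i j p) - l * C.angle Ω p ^ 2 * ∑ i, u₂ i i p := by
    simp only [flux, hl, mul_sub, Finset.sum_sub_distrib, Finset.mul_sum]
    have h1 : ∑ j, ∑ i, N j * (l * N i * (2 * u₂ i j p)) - ∑ j, ∑ i, N j * (l * N i * u₂ j i p) =
        ∑ i, ∑ j, l * (N i * N j * u₂ i j p) := by
      have h2 : ∑ j, ∑ i, N j * (l * N i * (2 * u₂ i j p)) =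
          ∑ i, ∑ j, N j * (l * N i * (2 * u₂ i j p)) := Finset.sum_comm
      rw [h2, ← Finset.sum_sub_distrib]
      refine Finset.sum_congr rfl fun i _ => ?_
      rw [← Finset.sum_sub_distrib]
      exact Finset.sum_congr rfl fun j _ => by ring
    rw [h1, hW2]
    congr 1
    simp only [Finset.sum_mul, Finset.mul_sum]
    rw [Finset.sum_comm]
    exact Finset.sum_congr rfl fun j _ => Finset.sum_congr rfl fun i _ => by ring
  have hgauss : ∀ a, inner ℝ (C.connection (e a) (e a) p) (C.gaussMap Ω p) =
      (C.angle Ω p)⁻¹ * inner ℝ (C.connection (e a) (e a) p) N := fun a => by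
    rw [gaussMap, inner_smul_right]
  have hsum : ∑ j, u₁ j p ^ 2 = l ^ 2 * C.angle Ω p ^ 2 := by
    simp only [hl, mul_pow, ← Finset.mul_sum, hW2]
  simp only [hsecond, Finset.sum_neg_distrib, ← Finset.mul_sum] at htrace
  rw [hflux, hsum]
  simp only [hgauss, ← Finset.mul_sum]
  set K := ∑ a, inner ℝ (C.connection (e a) (e a) p) N
  set Q := ∑ i, ∑ j, N i * N j * u₂ i j p
  set T := ∑ i, u₂ i i p
  have h3 : Q = C.angle Ω p ^ 2 * (T + l * K) := by
    field_simp at htrace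
    linarith
  rw [h3]
  field_simp
  ring

end StepTwoCarnot

/-! ### Coordinates over a hyperplane, Gram determinants and graphs. -/

section Splitting

variable {F : Type*} [NormedAddCommGroup F] [InnerProductSpace ℝ F]

/-- The isometric embedding of Euclidean space spanned by a part of an orthonormal basis. -/
noncomputable def hyperplaneEmbedding {n : ℕ} (β : OrthonormalBasis (Fin n ⊕ Unit) ℝ F) :
    EuclideanSpace ℝ (Fin n) →L[ℝ] F :=
  ∑ a, (EuclideanSpace.proj (𝕜 := ℝ) a).smulRight (β (Sum.inl a))

/-- The orthogonal projection which is left inverse to `hyperplaneEmbedding`. -/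
noncomputable def hyperplaneProj {n : ℕ} (β : OrthonormalBasis (Fin n ⊕ Unit) ℝ F) :
    F →L[ℝ] EuclideanSpace ℝ (Fin n) :=
  ∑ a, (innerSL ℝ (β (Sum.inl a))).smulRight (EuclideanSpace.single a (1 : ℝ))

variable {n : ℕ} (β : OrthonormalBasis (Fin n ⊕ Unit) ℝ F)

theorem hyperplaneEmbedding_apply (y : EuclideanSpace ℝ (Fin n)) :
    hyperplaneEmbedding β y = ∑ a, y a • β (Sum.inl a) := by
  simp [hyperplaneEmbedding]

theorem hyperplaneProj_apply (x : F) (a : Fin n) :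
    hyperplaneProj β x a = inner ℝ (β (Sum.inl a)) x := by
  simp [hyperplaneProj, Pi.single_apply]

theorem hyperplaneProj_embedding (y : EuclideanSpace ℝ (Fin n)) :
    hyperplaneProj β (hyperplaneEmbedding β y) = y := by
  ext a
  simp [hyperplaneProj_apply, hyperplaneEmbedding_apply, OrthonormalBasis.inner_eq_ite]

theorem hyperplaneProj_inr : hyperplaneProj β (β (Sum.inr ())) = 0 := by
  ext a
  simp [hyperplaneProj_apply]

theorem hyperplaneEmbedding_proj (x : F) :
    hyperplaneEmbedding β (hyperplaneProj β x) + inner ℝ (β (Sum.inr ())) x • β (Sum.inr ()) =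
      x := by
  conv_rhs => rw [← β.sum_repr x]
  simp [hyperplaneProj_apply, hyperplaneEmbedding_apply, OrthonormalBasis.repr_apply_apply]

theorem norm_hyperplaneEmbedding_add_sq (y : EuclideanSpace ℝ (Fin n)) (t : ℝ) :
    ‖hyperplaneEmbedding β y + t • β (Sum.inr ())‖ ^ 2 = ‖y‖ ^ 2 + ‖t‖ ^ 2 := by
  have h : ∀ s, β.repr (hyperplaneEmbedding β y + t • β (Sum.inr ())) s =
      Sum.elim (fun a => y a) (fun _ => t) s := by
    rintro (a | a)
    · simp [hyperplaneEmbedding_apply, Pi.single_apply]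
    · simp [hyperplaneEmbedding_apply]
  rw [← β.repr.norm_map, EuclideanSpace.norm_sq_eq, EuclideanSpace.norm_sq_eq]
  simp only [h, Fintype.sum_sum_type]
  simp

theorem measurePreserving_hyperplane [FiniteDimensional ℝ F] [MeasurableSpace F] [BorelSpace F] :
    MeasurePreserving (fun q : EuclideanSpace ℝ (Fin n) × ℝ =>
      hyperplaneEmbedding β q.1 + q.2 • β (Sum.inr ())) volume volume := by
  let J : WithLp 2 (EuclideanSpace ℝ (Fin n) × ℝ) →ₗᵢ[ℝ] F :=
    { toFun := fun q => hyperplaneEmbedding β q.fst + q.snd • β (Sum.inr ())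
      map_add' := fun p q => by simp; module
      map_smul' := fun c q => by simp; module
      norm_map' := fun q => by
        refine (sq_eq_sq₀ (norm_nonneg _) (norm_nonneg _)).1 ?_
        rw [WithLp.prod_norm_sq_eq_of_L2]
        exact norm_hyperplaneEmbedding_add_sq β _ _ }
  have hfin : Module.finrank ℝ (WithLp 2 (EuclideanSpace ℝ (Fin n) × ℝ)) = Module.finrank ℝ F := by
    rw [Module.finrank_eq_card_basis β.toBasis, (WithLp.linearEquiv 2 ℝ _).finrank_eq]
    simp
  have h := (J.toLinearIsometryEquiv hfin).measurePreserving.comp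
    (WithLp.volume_preserving_toLp (U := EuclideanSpace ℝ (Fin n)) (V := ℝ))
  exact h

theorem exists_orthonormalBasis_inr [FiniteDimensional ℝ F] {v : F}
    (hv : ‖v‖ = 1) (hn : Module.finrank ℝ F = n + 1) :
    ∃ β : OrthonormalBasis (Fin n ⊕ Unit) ℝ F, β (Sum.inr ()) = v := by
  have ho : Orthonormal ℝ (({Sum.inr ()} : Set (Fin n ⊕ Unit)).domRestrict fun _ => v) := by
    constructor
    · intro i; exact hv
    · intro i j hij
      exact absurd (Subsingleton.elim i j) hij
  obtain ⟨β, hβ⟩ := ho.exists_orthonormalBasis_extension_of_card_eq (by simp [hn])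
  exact ⟨β, hβ _ rfl⟩

/-- The Gram matrix is Mᵀ M, where M is the matrix of T in the orthonormal basis. -/
theorem det_gram_eq {ι : Type*} [Fintype ι] [DecidableEq ι] (β : OrthonormalBasis ι ℝ F)
    (T : F →ₗ[ℝ] F) :
    Matrix.det (Matrix.of fun s t => (inner ℝ (T (β s)) (T (β t)) : ℝ)) = LinearMap.det T ^ 2 := by
  have h : (Matrix.of fun s t => (inner ℝ (T (β s)) (T (β t)) : ℝ)) =
      (LinearMap.toMatrix β.toBasis β.toBasis T).transpose *
        LinearMap.toMatrix β.toBasis β.toBasis T := by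
    ext s t
    rw [Matrix.mul_apply, Matrix.of_apply, ← β.sum_inner_mul_inner]
    refine Finset.sum_congr rfl fun r _ => ?_
    simp [LinearMap.toMatrix_apply, OrthonormalBasis.repr_apply_apply, real_inner_comm]
  rw [h, Matrix.det_mul, Matrix.det_transpose, LinearMap.det_toMatrix, sq]

end Splitting

/-- The local parametrization of the hypersurface `{φ = 0}` as a graph. -/
noncomputable def graphMap {F : Type*} [NormedAddCommGroup F] [InnerProductSpace ℝ F] {n : ℕ}
    (β : OrthonormalBasis (Fin n ⊕ Unit) ℝ F) (φ : F → ℝ) (y : EuclideanSpace ℝ (Fin n)) : F :=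
  hyperplaneEmbedding β y - φ (hyperplaneEmbedding β y) • β (Sum.inr ())

namespace IsGraphNear

variable {F : Type*} [NormedAddCommGroup F] [InnerProductSpace ℝ F] {n : ℕ}
  {β : OrthonormalBasis (Fin n ⊕ Unit) ℝ F} {Ω V : Set F} {φ : F → ℝ}

theorem contDiff_graphMap (h : IsGraphNear Ω V (β (Sum.inr ())) φ) :
    ContDiff ℝ 2 (graphMap β φ) :=
  (hyperplaneEmbedding β).contDiff.sub
    ((h.contDiff.comp (hyperplaneEmbedding β).contDiff).smul contDiff_const)

theorem apply_graphMap_add (h : IsGraphNear Ω V (β (Sum.inr ())) φ)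
    (y : EuclideanSpace ℝ (Fin n)) (s : ℝ) : φ (graphMap β φ y + s • β (Sum.inr ())) = s := by
  rw [graphMap, sub_eq_add_neg, ← neg_smul, h.add_smul, h.add_smul]
  ring

theorem apply_graphMap (h : IsGraphNear Ω V (β (Sum.inr ())) φ)
    (y : EuclideanSpace ℝ (Fin n)) : φ (graphMap β φ y) = 0 := by
  simpa using h.apply_graphMap_add y 0

theorem hyperplaneProj_graphMap (φ : F → ℝ) (y : EuclideanSpace ℝ (Fin n)) :
    hyperplaneProj β (graphMap β φ y) = y := by
  rw [graphMap, map_sub, map_smul, hyperplaneProj_inr, hyperplaneProj_embedding, smul_zero,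
    sub_zero]

theorem graphMap_hyperplaneProj (h : IsGraphNear Ω V (β (Sum.inr ())) φ) {x : F} (hx : φ x = 0) :
    graphMap β φ (hyperplaneProj β x) = x := by
  have h1 : hyperplaneEmbedding β (hyperplaneProj β x) =
      x + (-inner ℝ (β (Sum.inr ())) x) • β (Sum.inr ()) := by
    rw [neg_smul, ← sub_eq_add_neg, eq_sub_iff_add_eq, hyperplaneEmbedding_proj]
  rw [graphMap, h1, h.add_smul, hx]
  module

theorem hyperplaneProj_fderiv_graphMap (h : IsGraphNear Ω V (β (Sum.inr ())) φ)
    (y w : EuclideanSpace ℝ (Fin n)) : hyperplaneProj β (fderiv ℝ (graphMap β φ) y w) = w := by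
  have h1 := (hyperplaneProj β).hasFDerivAt.comp y
    (h.contDiff_graphMap.differentiable (by simp) y).hasFDerivAt
  have h2 : hyperplaneProj β ∘ graphMap β φ = id := funext (hyperplaneProj_graphMap φ)
  rw [h2] at h1
  have := congrArg (fun L => L w) (h1.unique (hasFDerivAt_id y))
  simpa using this

theorem fderiv_fderiv_graphMap (h : IsGraphNear Ω V (β (Sum.inr ())) φ)
    (y w : EuclideanSpace ℝ (Fin n)) :
    fderiv ℝ φ (graphMap β φ y) (fderiv ℝ (graphMap β φ) y w) = 0 := by
  have h1 := (h.contDiff.differentiable (by simp) (graphMap β φ y)).hasFDerivAt.comp y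
    (h.contDiff_graphMap.differentiable (by simp) y).hasFDerivAt
  have h2 : φ ∘ graphMap β φ = fun _ => 0 := funext h.apply_graphMap
  rw [h2] at h1
  have := congrArg (fun L => L w) (h1.unique (hasFDerivAt_const 0 y))
  simpa using this

end IsGraphNear

namespace StepTwoCarnot

variable {𝔤 : Type*} [NormedAddCommGroup 𝔤] [InnerProductSpace ℝ 𝔤] {m k : ℕ}

theorem metric_eq (C : StepTwoCarnot 𝔤 m k) (p x y : 𝔤) :
    C.metric p x y = inner ℝ (C.dLeftL (-p) x) (C.dLeftL (-p) y) := by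
  rw [metric, dLeft_eq_dLeftL, dLeft_eq_dLeftL]

theorem metric_comm (C : StepTwoCarnot 𝔤 m k) (p x y : 𝔤) : C.metric p x y = C.metric p y x :=
  real_inner_comm _ _

theorem metric_gradient_gradNorm (C : StepTwoCarnot 𝔤 m k) (φ : 𝔤 → ℝ) (p : 𝔤) :
    C.metric p (C.gradient φ p) (C.gradient φ p) = C.gradNorm φ p ^ 2 := by
  rw [metric_gradient_self, gradNorm, Real.sq_sqrt (Finset.sum_nonneg fun a _ => sq_nonneg _)]

/-- The Gram matrix changes by congruence with the matrix of T. This gives the transformation law of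
the area element. -/
theorem det_metric_comp {n : ℕ} (C : StepTwoCarnot 𝔤 m k) (p : 𝔤)
    (D : EuclideanSpace ℝ (Fin n) →L[ℝ] 𝔤)
    (T : EuclideanSpace ℝ (Fin n) →L[ℝ] EuclideanSpace ℝ (Fin n)) :
    Matrix.det (Matrix.of fun a b : Fin n => C.metric p (D (T (EuclideanSpace.single a 1)))
      (D (T (EuclideanSpace.single b 1)))) = T.det ^ 2 *
    Matrix.det (Matrix.of fun a b : Fin n => C.metric p (D (EuclideanSpace.single a 1))
      (D (EuclideanSpace.single b 1))) := by
  let b := (EuclideanSpace.basisFun (Fin n) ℝ).toBasis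
  let M := LinearMap.toMatrix b b (T : EuclideanSpace ℝ (Fin n) →ₗ[ℝ] EuclideanSpace ℝ (Fin n))
  have hT : ∀ a, T (EuclideanSpace.single a 1) =
      ∑ c, M c a • EuclideanSpace.single c (1 : ℝ) := by
    intro a
    have := b.sum_repr (T (EuclideanSpace.single a 1))
    rw [← this]
    refine Finset.sum_congr rfl fun c _ => ?_
    simp [M, b, LinearMap.toMatrix_apply]
  have h : (Matrix.of fun a b : Fin n => C.metric p (D (T (EuclideanSpace.single a 1)))
      (D (T (EuclideanSpace.single b 1)))) = M.transpose *
      (Matrix.of fun a b : Fin n => C.metric p (D (EuclideanSpace.single a 1))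
      (D (EuclideanSpace.single b 1))) * M := by
    ext a b
    simp only [Matrix.mul_apply, Matrix.of_apply, Matrix.transpose_apply, hT, metric_eq, map_sum,
      map_smul, sum_inner, inner_sum, inner_smul_left, inner_smul_right, conj_trivial,
      Finset.sum_mul, Finset.mul_sum]
    exact Finset.sum_congr rfl fun c _ => Finset.sum_congr rfl fun d _ => by ring
  rw [h, Matrix.det_mul, Matrix.det_mul, Matrix.det_transpose]
  have hM : M.det = T.det := LinearMap.det_toMatrix b _
  rw [hM]
  ring

variable [FiniteDimensional ℝ 𝔤]

/-- Adjoin the gradient Z to the tangent vectors and evaluate the enlarged Gram determinant twice.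
Orthogonality of Z to the w a gives det G · |Z|². As the square of a determinant it is |Z|⁴, since
left translations have determinant one and the matrix of the vectors has determinant dφ(Z) = |Z|².
Divide by |Z|². -/
theorem det_metric_tangent {n : ℕ} (C : StepTwoCarnot 𝔤 m k)
    (β : OrthonormalBasis (Fin n ⊕ Unit) ℝ 𝔤) {φ : 𝔤 → ℝ} {p : 𝔤}
    (hv : fderiv ℝ φ p (β (Sum.inr ())) = 1) {w : Fin n → 𝔤}
    (hw : ∀ a, hyperplaneProj β (w a) = EuclideanSpace.single a 1)
    (hφw : ∀ a, fderiv ℝ φ p (w a) = 0) :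
    Matrix.det (Matrix.of fun a b : Fin n => C.metric p (w a) (w b)) = C.gradNorm φ p ^ 2 := by
  set Z := C.gradient φ p with hZ
  set G := Matrix.of fun a b : Fin n => C.metric p (w a) (w b)
  have hG0 : C.gradNorm φ p ^ 2 ≠ 0 := by
    refine pow_ne_zero 2 (C.gradNorm_pos fun h0 => ?_).ne'
    rw [h0] at hv
    simp at hv
  have hφZ : fderiv ℝ φ p Z = C.gradNorm φ p ^ 2 := by
    rw [← metric_gradient, ← metric_gradient_gradNorm]
  let ww : Fin n ⊕ Unit → 𝔤 := Sum.elim w fun _ => Z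
  let W : 𝔤 →ₗ[ℝ] 𝔤 := β.toBasis.constr ℝ ww
  have hW : ∀ s, W (β s) = ww s := fun s => by
    rw [← β.coe_toBasis]; exact β.toBasis.constr_basis ℝ ww s
  have h1 : Matrix.det (Matrix.of fun s t => (inner ℝ ((C.dLeftL (-p) ∘ₗ W) (β s))
      ((C.dLeftL (-p) ∘ₗ W) (β t)) : ℝ)) = G.det * C.gradNorm φ p ^ 2 := by
    have hb : (Matrix.of fun s t => (inner ℝ ((C.dLeftL (-p) ∘ₗ W) (β s))
        ((C.dLeftL (-p) ∘ₗ W) (β t)) : ℝ)) = Matrix.fromBlocks G 0 0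
          (Matrix.of fun _ _ : Unit => C.gradNorm φ p ^ 2) := by
      ext s t
      rw [Matrix.of_apply]
      simp only [LinearMap.comp_apply, hW, ← metric_eq]
      rcases s with a | a <;> rcases t with b | b
      · simp [ww, G]
      · simp only [ww, Sum.elim_inl, Sum.elim_inr, Matrix.fromBlocks_apply₁₂, Matrix.zero_apply]
        rw [metric_comm, hZ, metric_gradient, hφw]
      · simp only [ww, Sum.elim_inl, Sum.elim_inr, Matrix.fromBlocks_apply₂₁, Matrix.zero_apply]
        rw [hZ, metric_gradient, hφw]
      · simp only [ww, Sum.elim_inr, Matrix.fromBlocks_apply₂₂, Matrix.of_apply]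
        rw [hZ, metric_gradient_gradNorm]
    rw [hb, Matrix.det_fromBlocks_zero₂₁]
    simp
  have hdA : LinearMap.det (C.dLeftL (-p)) = 1 :=
    C.det_one_add (fun x => C.V₂.smul_mem _ (C.bracket_mem _ _))
      (fun z hz => by simp [C.bracket_V₂ _ hz])
  have hwexp : ∀ a, w a = β (Sum.inl a) + inner ℝ (β (Sum.inr ())) (w a) • β (Sum.inr ()) := by
    intro a
    conv_lhs => rw [← hyperplaneEmbedding_proj β (w a), hw a]
    simp [hyperplaneEmbedding_apply, PiLp.single_apply]
  have hφβ : ∀ a, fderiv ℝ φ p (β (Sum.inl a)) = -inner ℝ (β (Sum.inr ())) (w a) := by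
    intro a
    have := hφw a
    rw [hwexp a, map_add, map_smul, hv, smul_eq_mul, mul_one] at this
    linarith
  have hdW : LinearMap.det W = C.gradNorm φ p ^ 2 := by
    rw [← LinearMap.det_toMatrix β.toBasis, ← hφZ]
    have hb : LinearMap.toMatrix β.toBasis β.toBasis W = Matrix.fromBlocks 1
        (Matrix.of fun a (_ : Unit) => inner ℝ (β (Sum.inl a)) Z)
        (Matrix.of fun (_ : Unit) a => inner ℝ (β (Sum.inr ())) (w a))
        (Matrix.of fun (_ _ : Unit) => inner ℝ (β (Sum.inr ())) Z) := by
      ext s t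
      rw [LinearMap.toMatrix_apply, β.coe_toBasis, hW, β.coe_toBasis_repr_apply,
        OrthonormalBasis.repr_apply_apply]
      rcases s with a | a <;> rcases t with b | b
      · simp only [ww, Sum.elim_inl, Matrix.fromBlocks_apply₁₁, ← hyperplaneProj_apply, hw,
          PiLp.single_apply, Matrix.one_apply]
      · simp [ww]
      · simp [ww]
      · simp [ww]
    -- The Schur complement of the identity block is the expansion of dφ(Z) in the basis β.
    rw [hb, Matrix.det_fromBlocks_one₁₁]
    have hZe := β.sum_repr Z
    conv_rhs => rw [← hZe]
    simp only [Matrix.det_unique, Matrix.sub_apply, Matrix.of_apply, Matrix.mul_apply]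
    rw [map_sum, Fintype.sum_sum_type]
    simp only [map_smul, smul_eq_mul, hφβ, hv, OrthonormalBasis.repr_apply_apply,
      Finset.univ_unique, Finset.sum_singleton, mul_one]
    rw [add_comm, sub_eq_add_neg, ← Finset.sum_neg_distrib]
    congr 1
    exact Finset.sum_congr rfl fun a _ => by ring
  rw [det_gram_eq, LinearMap.det_comp, hdA, hdW, one_mul, sq] at h1
  exact (mul_right_cancel₀ hG0 h1).symm

end StepTwoCarnot

/-! ### The surface measure. -/

namespace StepTwoCarnot

variable {𝔤 : Type*} [NormedAddCommGroup 𝔤] [InnerProductSpace ℝ 𝔤] {m k : ℕ}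

theorem isParametrization_graphMap (C : StepTwoCarnot 𝔤 m k)
    {β : OrthonormalBasis (Fin (m + k - 1) ⊕ Unit) ℝ 𝔤} {Ω V : Set 𝔤} {φ : 𝔤 → ℝ}
    (hΩ : IsOpen Ω) (h : IsGraphNear Ω V (β (Sum.inr ())) φ) :
    C.IsParametrization (frontier Ω) (graphMap β φ ⁻¹' V) (graphMap β φ) :=
  ⟨h.isOpen.preimage h.contDiff_graphMap.continuous,
    (h.contDiff_graphMap.of_le (by norm_num)).contDiffOn,
    (Function.LeftInverse.injective (IsGraphNear.hyperplaneProj_graphMap φ)).injOn,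
    fun y hy => (h.mem_frontier_iff hΩ hy).2 (h.apply_graphMap y),
    fun y _ => Function.LeftInverse.injective (h.hyperplaneProj_fderiv_graphMap y)⟩

theorem areaElement_graphMap [FiniteDimensional ℝ 𝔤] (C : StepTwoCarnot 𝔤 m k)
    {β : OrthonormalBasis (Fin (m + k - 1) ⊕ Unit) ℝ 𝔤} {Ω V : Set 𝔤} {φ : 𝔤 → ℝ}
    (h : IsGraphNear Ω V (β (Sum.inr ())) φ) (y : EuclideanSpace ℝ (Fin (m + k - 1))) :
    C.areaElement (graphMap β φ) y = C.gradNorm φ (graphMap β φ y) := by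
  rw [areaElement, C.det_metric_tangent β (h.fderiv_apply _)
    (fun a => h.hyperplaneProj_fderiv_graphMap y _) (fun a => h.fderiv_fderiv_graphMap y _),
    Real.sqrt_sq (show 0 ≤ C.gradNorm φ (graphMap β φ y) from Real.sqrt_nonneg _)]

theorem areaElement_comp (C : StepTwoCarnot 𝔤 m k)
    {ψ ψ' : EuclideanSpace ℝ (Fin (m + k - 1)) → 𝔤}
    {τ : EuclideanSpace ℝ (Fin (m + k - 1)) → EuclideanSpace ℝ (Fin (m + k - 1))}
    {y : EuclideanSpace ℝ (Fin (m + k - 1))} (hψ : DifferentiableAt ℝ ψ (τ y))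
    (hτ : DifferentiableAt ℝ τ y) (he : ψ' =ᶠ[𝓝 y] ψ ∘ τ) :
    C.areaElement ψ' y = |(fderiv ℝ τ y).det| * C.areaElement ψ (τ y) := by
  have hd : ∀ w, fderiv ℝ ψ' y w = fderiv ℝ ψ (τ y) (fderiv ℝ τ y w) := by
    intro w
    rw [he.fderiv_eq, fderiv_comp _ hψ hτ]
    rfl
  simp only [areaElement, hd, he.eq_of_nhds, Function.comp]
  rw [C.det_metric_comp, Real.sqrt_mul (sq_nonneg _), Real.sqrt_sq_eq_abs]

variable [MeasurableSpace 𝔤]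

theorem le_surfaceMeasure (C : StepTwoCarnot 𝔤 m k) {S : Set 𝔤}
    {U : Set (EuclideanSpace ℝ (Fin (m + k - 1)))} {ψ : EuclideanSpace ℝ (Fin (m + k - 1)) → 𝔤}
    (h : C.IsParametrization S U ψ) :
    Measure.map ψ ((volume.restrict U).withDensity fun x => ENNReal.ofReal (C.areaElement ψ x)) ≤
      C.surfaceMeasure S :=
  le_iSup_of_le U (le_iSup_of_le ψ (le_iSup_of_le h le_rfl))

/-- The measure ν plus infinite mass off V dominates every push-forward, hence their supremum;
restricting to V removes the infinite part. This avoids evaluating a supremum of measures on sets.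
-/
theorem surfaceMeasure_le (C : StepTwoCarnot 𝔤 m k) {S V : Set 𝔤} (hV : MeasurableSet V)
    {ν : Measure 𝔤}
    (hν : ∀ U ψ, C.IsParametrization S U ψ → ∀ B ⊆ V, MeasurableSet B →
      Measure.map ψ ((volume.restrict U).withDensity fun x =>
        ENNReal.ofReal (C.areaElement ψ x)) B ≤ ν B) :
    (C.surfaceMeasure S).restrict V ≤ ν := by
  have h1 : C.surfaceMeasure S ≤ ν + (⊤ : Measure 𝔤).restrict Vᶜ := by
    refine iSup_le fun U => iSup_le fun ψ => iSup_le fun hψ => Measure.le_iff.2 fun B hB => ?_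
    rw [← measure_inter_add_sdiff B hV, Measure.add_apply, Measure.restrict_apply hB]
    refine add_le_add ((hν U ψ hψ _ inter_subset_right (hB.inter hV)).trans
      (measure_mono inter_subset_left)) ?_
    exact Measure.le_iff.1 le_top _ (hB.diff hV)
  refine (Measure.restrict_mono_measure h1 V).trans ?_
  rw [Measure.restrict_add, Measure.restrict_restrict hV, inter_compl_self, Measure.restrict_empty,
    add_zero]
  exact Measure.restrict_le_self

variable [BorelSpace 𝔤]

theorem map_areaElement_apply (C : StepTwoCarnot 𝔤 m k) {S : Set 𝔤}
    {U : Set (EuclideanSpace ℝ (Fin (m + k - 1)))} {ψ : EuclideanSpace ℝ (Fin (m + k - 1)) → 𝔤}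
    (h : C.IsParametrization S U ψ) {B : Set 𝔤} (hB : MeasurableSet B) :
    MeasurableSet (ψ ⁻¹' B ∩ U) ∧ Measure.map ψ ((volume.restrict U).withDensity fun x =>
      ENNReal.ofReal (C.areaElement ψ x)) B =
      ∫⁻ x in ψ ⁻¹' B ∩ U, ENNReal.ofReal (C.areaElement ψ x) := by
  have hc := h.2.1.continuousOn
  have hm : MeasurableSet (ψ ⁻¹' B ∩ U) := by
    have h1 : MeasurableSet ((U.domRestrict ψ) ⁻¹' B) :=
      (continuousOn_iff_continuous_domRestrict.1 hc).measurable hB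
    have h2 := (MeasurableEmbedding.subtype_coe h.1.measurableSet).measurableSet_image.2 h1
    convert h2 using 1
    ext x
    exact ⟨fun hx => ⟨⟨x, hx.2⟩, hx.1, rfl⟩, by rintro ⟨z, hz, rfl⟩; exact ⟨hz, z.2⟩⟩
  have hae : AEMeasurable ψ ((volume.restrict U).withDensity fun x =>
      ENNReal.ofReal (C.areaElement ψ x)) :=
    (hc.aemeasurable h.1.measurableSet).mono_ac (withDensity_absolutelyContinuous _ _)
  refine ⟨hm, ?_⟩
  rw [Measure.map_apply_of_aemeasurable hae hB, withDensity_apply',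
    Measure.restrict_restrict' h.1.measurableSet]

theorem surfaceMeasure_compl (C : StepTwoCarnot 𝔤 m k) {S : Set 𝔤} (hS : MeasurableSet S) :
    C.surfaceMeasure S Sᶜ = 0 := by
  have h := C.surfaceMeasure_le (S := S) (V := Sᶜ) hS.compl (ν := 0) fun U ψ hψ B hBS hB => by
    rw [(C.map_areaElement_apply hψ hB).2]
    have : ψ ⁻¹' B ∩ U = ∅ := by
      rw [eq_empty_iff_forall_notMem]
      exact fun x hx => hBS hx.1 (hψ.2.2.2.1 hx.2)
    simp [this]
  have h2 := Measure.le_iff'.1 h Sᶜ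
  rw [Measure.restrict_apply_self] at h2
  simpa using h2

variable [FiniteDimensional ℝ 𝔤]

/-- Near a boundary point the surface measure is given by a graph parametrization. -/
theorem surfaceMeasure_restrict (C : StepTwoCarnot 𝔤 m k)
    {β : OrthonormalBasis (Fin (m + k - 1) ⊕ Unit) ℝ 𝔤} {Ω V : Set 𝔤} {φ : 𝔤 → ℝ}
    (hΩ : IsOpen Ω) (h : IsGraphNear Ω V (β (Sum.inr ())) φ) :
    (C.surfaceMeasure (frontier Ω)).restrict V =
      Measure.map (graphMap β φ) ((volume.restrict (graphMap β φ ⁻¹' V)).withDensity fun y =>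
        ENNReal.ofReal (C.gradNorm φ (graphMap β φ y))) := by
  have hpar := C.isParametrization_graphMap hΩ h
  have harea : (fun y => ENNReal.ofReal (C.gradNorm φ (graphMap β φ y))) =
      fun y => ENNReal.ofReal (C.areaElement (graphMap β φ) y) :=
    funext fun y => by rw [C.areaElement_graphMap h]
  rw [harea]
  refine le_antisymm (C.surfaceMeasure_le h.isOpen.measurableSet fun U ψ hψ B hBV hB => ?_) ?_
  · obtain ⟨hm, he⟩ := C.map_areaElement_apply hψ hB
    rw [he, (C.map_areaElement_apply hpar hB).2]
    -- The transition map from an arbitrary parametrization to the graph. It is injective on the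
    -- preimage of B, so the change of variables formula compares the two areas.
    let τ := fun y => hyperplaneProj β (ψ y)
    obtain ⟨hU, hc, hinj, hmaps, -⟩ := hψ
    have hψd : ∀ y ∈ U, DifferentiableAt ℝ ψ y := fun y hy =>
      (hc.contDiffAt (hU.mem_nhds hy)).differentiableAt (by simp)
    have hτd : ∀ y ∈ U, DifferentiableAt ℝ τ y := fun y hy =>
      (hyperplaneProj β).differentiableAt.comp y (hψd y hy)
    have hgτ : ∀ y ∈ U, ψ y ∈ V → graphMap β φ (τ y) = ψ y := fun y hy hyV =>
      h.graphMap_hyperplaneProj ((h.mem_frontier_iff hΩ hyV).1 (hmaps hy))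
    have hev : ∀ y ∈ ψ ⁻¹' B ∩ U, ψ =ᶠ[𝓝 y] graphMap β φ ∘ τ := by
      intro y hy
      filter_upwards [hU.mem_nhds hy.2,
        (hψd y hy.2).continuousAt.eventually (h.isOpen.mem_nhds (hBV hy.1))] with z hz hzV
      exact (hgτ z hz hzV).symm
    have hτinj : InjOn τ (ψ ⁻¹' B ∩ U) := by
      intro y hy z hz hyz
      refine hinj hy.2 hz.2 ?_
      rw [← hgτ y hy.2 (hBV hy.1), ← hgτ z hz.2 (hBV hz.1), hyz]
    calc ∫⁻ x in ψ ⁻¹' B ∩ U, ENNReal.ofReal (C.areaElement ψ x)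
        = ∫⁻ x in ψ ⁻¹' B ∩ U, ENNReal.ofReal |(fderiv ℝ τ x).det| *
            ENNReal.ofReal (C.areaElement (graphMap β φ) (τ x)) := by
          refine setLIntegral_congr_fun hm fun y hy => ?_
          rw [C.areaElement_comp (h.contDiff_graphMap.differentiable (by simp) _)
            (hτd y hy.2) (hev y hy), ENNReal.ofReal_mul (abs_nonneg _)]
      _ = ∫⁻ x in τ '' (ψ ⁻¹' B ∩ U), ENNReal.ofReal (C.areaElement (graphMap β φ) x) :=
          (lintegral_image_eq_lintegral_abs_det_fderiv_mul volume hm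
            (fun y hy => (hτd y hy.2).hasFDerivAt.hasFDerivWithinAt) hτinj
            (fun x => ENNReal.ofReal (C.areaElement (graphMap β φ) x))).symm
      _ ≤ _ := by
          refine lintegral_mono_set ?_
          rintro _ ⟨y, hy, rfl⟩
          have := hgτ y hy.2 (hBV hy.1)
          refine ⟨?_, ?_⟩
          · rw [mem_preimage, this]; exact hy.1
          · rw [mem_preimage, this]; exact hBV hy.1
  · refine Measure.le_iff.2 fun B hB => ?_
    rw [Measure.restrict_apply hB]
    refine le_trans (le_of_eq ?_) (Measure.le_iff.1 (C.le_surfaceMeasure hpar) _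
      (hB.inter h.isOpen.measurableSet))
    rw [(C.map_areaElement_apply hpar hB).2,
      (C.map_areaElement_apply hpar (hB.inter h.isOpen.measurableSet)).2]
    congr 2
    ext y
    simp

end StepTwoCarnot

/-! ### Integrals over thin layers below a graph. -/

theorem integral_prod_comp_mul_left {α : Type*} [MeasureSpace α] [SFinite (volume : Measure α)]
    (f : α × ℝ → ℝ) {c : ℝ} (hc : c ≠ 0) :
    ∫ q : α × ℝ, f (q.1, c * q.2) = |c|⁻¹ * ∫ q, f q := by
  have hm : Measure.map (fun q : α × ℝ => (q.1, c * q.2)) volume =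
      ENNReal.ofReal |c⁻¹| • (volume : Measure (α × ℝ)) := by
    have h := Measure.map_prod_map (volume : Measure α) (volume : Measure ℝ) measurable_id
      (measurable_const_mul c)
    rw [Real.map_volume_mul_left hc, Measure.map_id, Measure.prod_smul_right] at h
    exact h.symm
  have he := integral_map_equiv ((MeasurableEquiv.refl α).prodCongr (MeasurableEquiv.mulLeft₀ c hc))
    (μ := volume) f
  have hm' : Measure.map ((MeasurableEquiv.refl α).prodCongr (MeasurableEquiv.mulLeft₀ c hc))
      volume = ENNReal.ofReal |c⁻¹| • (volume : Measure (α × ℝ)) := hm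
  rw [hm', integral_smul_measure, ENNReal.toReal_ofReal (abs_nonneg _), abs_inv] at he
  exact he.symm

/-- A smooth function which increases from zero to one between one and two. -/
theorem exists_contDiff_step : ∃ Θ : ℝ → ℝ, ContDiff ℝ 1 Θ ∧ (∀ r, 0 ≤ Θ r ∧ Θ r ≤ 1) ∧
    (∀ r ≤ 1, Θ r = 0) ∧ (∀ r, 2 ≤ r → Θ r = 1) ∧ HasCompactSupport (deriv Θ) ∧
    (∀ r ≤ 0, deriv Θ r = 0) ∧ ∫ r, deriv Θ r = 1 := by
  let Θ : ℝ → ℝ := fun r => Real.smoothTransition (r - 1)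
  have hΘ : ContDiff ℝ 1 Θ := Real.smoothTransition.contDiff.comp (contDiff_id.sub contDiff_const)
  have h0 : ∀ r ≤ 1, Θ r = 0 := fun r hr => Real.smoothTransition.zero_of_nonpos (by linarith)
  have h1 : ∀ r, 2 ≤ r → Θ r = 1 := fun r hr => Real.smoothTransition.one_of_one_le (by linarith)
  have d0 : ∀ r < 1, deriv Θ r = 0 := fun r hr => by
    have : Θ =ᶠ[𝓝 r] fun _ => 0 := by
      filter_upwards [Iio_mem_nhds hr] with s hs using h0 s hs.le
    rw [this.deriv_eq, deriv_const]
  have d1 : ∀ r, 2 < r → deriv Θ r = 0 := fun r hr => by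
    have : Θ =ᶠ[𝓝 r] fun _ => 1 := by
      filter_upwards [Ioi_mem_nhds hr] with s hs using h1 s hs.le
    rw [this.deriv_eq, deriv_const]
  have hc : HasCompactSupport (deriv Θ) :=
    HasCompactSupport.intro (isCompact_Icc (a := (1 : ℝ)) (b := 2)) fun r hr => by
      by_cases h : r < 1
      · exact d0 r h
      · exact d1 r (by by_contra h'; exact hr ⟨not_lt.1 h, not_lt.1 h'⟩)
  have hcd : Continuous (deriv Θ) := hΘ.continuous_deriv le_rfl
  refine ⟨Θ, hΘ, fun r => ⟨Real.smoothTransition.nonneg _, Real.smoothTransition.le_one _⟩, h0, h1,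
    hc, fun r hr => d0 r (by linarith), ?_⟩
  have hbot : Tendsto Θ atBot (𝓝 0) := tendsto_const_nhds.congr' (by
    filter_upwards [eventually_le_atBot 1] with r hr using (h0 r hr).symm)
  have htop : Tendsto Θ atTop (𝓝 1) := tendsto_const_nhds.congr' (by
    filter_upwards [eventually_ge_atTop 2] with r hr using (h1 r hr).symm)
  rw [integral_of_hasDerivAt_of_tendsto
    (fun r => (hΘ.differentiable (by simp) r).hasDerivAt)
    (hcd.integrable_of_hasCompactSupport hc) hbot htop, sub_zero]

namespace IsGraphNear

variable {F : Type*} [NormedAddCommGroup F] [InnerProductSpace ℝ F] {n : ℕ}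
  {β : OrthonormalBasis (Fin n ⊕ Unit) ℝ F} {Ω V : Set F} {φ : F → ℝ}

theorem isClosedEmbedding_graphMap (h : IsGraphNear Ω V (β (Sum.inr ())) φ) :
    IsClosedEmbedding (graphMap β φ) :=
  Function.LeftInverse.isClosedEmbedding (f := hyperplaneProj β)
    (fun y => hyperplaneProj_graphMap φ y) (hyperplaneProj β).continuous
    h.contDiff_graphMap.continuous

variable [FiniteDimensional ℝ F] [MeasurableSpace F] [BorelSpace F]

theorem measurePreserving_graphMap_add (h : IsGraphNear Ω V (β (Sum.inr ())) φ) :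
    MeasurePreserving (fun q : EuclideanSpace ℝ (Fin n) × ℝ =>
      graphMap β φ q.1 + q.2 • β (Sum.inr ())) volume volume := by
  have hc : Continuous fun q : EuclideanSpace ℝ (Fin n) × ℝ =>
      -φ (hyperplaneEmbedding β q.1) + q.2 :=
    ((h.contDiff.continuous.comp (hyperplaneEmbedding β).continuous).comp continuous_fst).neg.add
      continuous_snd
  have hs : MeasurePreserving (fun q : EuclideanSpace ℝ (Fin n) × ℝ =>
      (q.1, -φ (hyperplaneEmbedding β q.1) + q.2)) volume volume :=
    (MeasurePreserving.id (volume : Measure (EuclideanSpace ℝ (Fin n)))).skew_product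
      (μc := (volume : Measure ℝ)) (μd := (volume : Measure ℝ))
      (g := fun y s => -φ (hyperplaneEmbedding β y) + s) hc.measurable
      (Eventually.of_forall fun y => map_add_left_eq_self volume _)
  have := (measurePreserving_hyperplane β).comp hs
  convert this using 2 with q
  simp only [Function.comp, graphMap]
  module

/-- Integrals over thin layers under a graph converge to an integral over the graph. -/
theorem tendsto_integral_layer (h : IsGraphNear Ω V (β (Sum.inr ())) φ) {θ : ℝ → ℝ} {K : F → ℝ}
    (hθ : Continuous θ) (hθc : HasCompactSupport θ) (hK : Continuous K)
    (hKc : HasCompactSupport K) :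
    Tendsto (fun ε : ℝ => ∫ x, ε⁻¹ * θ (-φ x / ε) * K x) (𝓝[>] 0)
      (𝓝 ((∫ r, θ r) * ∫ y, K (graphMap β φ y))) := by
  let Φ : EuclideanSpace ℝ (Fin n) × ℝ → F := fun q => graphMap β φ q.1 + q.2 • β (Sum.inr ())
  have hΦ : Continuous Φ := (h.contDiff_graphMap.continuous.comp continuous_fst).add
    (continuous_snd.smul continuous_const)
  have hpr : ∀ q, hyperplaneProj β (Φ q) = q.1 := fun q => by
    simp only [Φ]
    rw [map_add, map_smul, hyperplaneProj_inr, smul_zero, add_zero, hyperplaneProj_graphMap]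
  -- In the volume-preserving coordinates (y, s) the function φ is s. The substitution s = −ε r
  -- absorbs the factor 1/ε and freezes the profile θ.
  have hscale : ∀ ε : ℝ, 0 < ε → ∫ x, ε⁻¹ * θ (-φ x / ε) * K x =
      ∫ q : EuclideanSpace ℝ (Fin n) × ℝ, θ q.2 * K (Φ (q.1, -ε * q.2)) := by
    intro ε hε
    have hc : Continuous fun x => ε⁻¹ * θ (-φ x / ε) * K x :=
      (continuous_const.mul (hθ.comp (h.contDiff.continuous.neg.div_const ε))).mul hK
    have hmp := h.measurePreserving_graphMap_add
    have h1 : ∫ x, ε⁻¹ * θ (-φ x / ε) * K x =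
        ∫ q, ε⁻¹ * θ (-φ (Φ q) / ε) * K (Φ q) := by
      have := integral_map hmp.aemeasurable (f := fun x => ε⁻¹ * θ (-φ x / ε) * K x)
        hc.aestronglyMeasurable
      rwa [hmp.map_eq] at this
    have h2 := integral_prod_comp_mul_left
      (fun q : EuclideanSpace ℝ (Fin n) × ℝ => ε⁻¹ * θ (-φ (Φ q) / ε) * K (Φ q))
      (neg_ne_zero.2 hε.ne')
    rw [abs_neg, abs_of_pos hε] at h2
    rw [h1, ← mul_inv_cancel_left₀ hε.ne' (∫ q, ε⁻¹ * θ (-φ (Φ q) / ε) * K (Φ q)), ← h2,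
      ← integral_const_mul]
    refine integral_congr_ae (Eventually.of_forall fun q => ?_)
    simp only [Φ, h.apply_graphMap_add]
    have : -(-ε * q.2) / ε = q.2 := by field_simp
    rw [this]
    field_simp
  obtain ⟨M, hM⟩ := hK.bounded_above_of_compact_support hKc
  obtain ⟨M', hM'⟩ := hθ.bounded_above_of_compact_support hθc
  have hM0 : 0 ≤ M := (norm_nonneg _).trans (hM 0)
  have hM0' : 0 ≤ M' := (norm_nonneg _).trans (hM' 0)
  let L : Set (EuclideanSpace ℝ (Fin n) × ℝ) := (hyperplaneProj β '' tsupport K) ×ˢ tsupport θ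
  have hL : IsCompact L :=
    (IsCompact.image hKc (hyperplaneProj β).continuous).prod hθc
  have hlim : Tendsto (fun ε : ℝ => ∫ q : EuclideanSpace ℝ (Fin n) × ℝ,
      θ q.2 * K (Φ (q.1, -ε * q.2))) (𝓝[>] 0)
      (𝓝 (∫ q : EuclideanSpace ℝ (Fin n) × ℝ, θ q.2 * K (Φ (q.1, 0)))) := by
    refine tendsto_integral_filter_of_dominated_convergence (L.indicator fun _ => M' * M)
      (Eventually.of_forall fun ε => ?_) (Eventually.of_forall fun ε =>
        Eventually.of_forall fun q => ?_) ?_ (Eventually.of_forall fun q => ?_)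
    · exact ((hθ.comp continuous_snd).mul (hK.comp (hΦ.comp (continuous_fst.prodMk
        (continuous_const.mul continuous_snd))))).aestronglyMeasurable
    · by_cases hq : q ∈ L
      · rw [indicator_of_mem hq, norm_mul]
        exact mul_le_mul (hM' _) (hM _) (norm_nonneg _) hM0'
      · rw [indicator_of_notMem hq]
        have : θ q.2 * K (Φ (q.1, -ε * q.2)) = 0 := by
          by_contra hne
          refine hq ⟨⟨_, subset_tsupport K (right_ne_zero_of_mul hne), hpr _⟩,
            subset_tsupport θ (left_ne_zero_of_mul hne)⟩
        rw [this, norm_zero]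
    · exact (integrable_indicator_iff hL.measurableSet).2
        (integrableOn_const hL.measure_lt_top.ne)
    · have hcont : Continuous fun ε : ℝ => θ q.2 * K (Φ (q.1, -ε * q.2)) :=
        continuous_const.mul (hK.comp (hΦ.comp (continuous_const.prodMk
          (continuous_id.neg.mul continuous_const))))
      have := (hcont.tendsto 0).mono_left (nhdsWithin_le_nhds (s := Ioi 0))
      simpa using this
  have hprod : ∫ q : EuclideanSpace ℝ (Fin n) × ℝ, θ q.2 * K (Φ (q.1, 0)) =
      (∫ r, θ r) * ∫ y, K (graphMap β φ y) := by
    have := integral_prod_mul (μ := (volume : Measure (EuclideanSpace ℝ (Fin n))))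
      (ν := (volume : Measure ℝ)) (fun y => K (graphMap β φ y)) θ
    rw [mul_comm, ← this]
    refine integral_congr_ae (Eventually.of_forall fun q => ?_)
    simp [Φ, mul_comm]
  rw [← hprod]
  refine hlim.congr' ?_
  filter_upwards [self_mem_nhdsWithin] with ε hε using (hscale ε hε).symm

end IsGraphNear

/-! ### The Gauss-Green formula. -/

namespace StepTwoCarnot

variable {𝔤 : Type*} [NormedAddCommGroup 𝔤] [InnerProductSpace ℝ 𝔤] {m k : ℕ}

theorem ae_mem_frontier [MeasurableSpace 𝔤] [BorelSpace 𝔤]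
    (C : StepTwoCarnot 𝔤 m k) (Ω : Set 𝔤) :
    ∀ᵐ p ∂C.surfaceMeasure (frontier Ω), p ∈ frontier Ω :=
  C.surfaceMeasure_compl isClosed_frontier.measurableSet

variable [FiniteDimensional ℝ 𝔤]

theorem continuous_D (C : StepTwoCarnot 𝔤 m k) (j : Fin m) {χ : 𝔤 → ℝ} (hχ : ContDiff ℝ 1 χ) :
    Continuous (C.D j χ) :=
  (C.contDiff_D (n := 0) j (by simpa using hχ)).continuous

theorem continuous_gradNorm (C : StepTwoCarnot 𝔤 m k) {φ : 𝔤 → ℝ} (hφ : ContDiff ℝ 1 φ) :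
    Continuous (C.gradNorm φ) := by
  have hf : ∀ a, Continuous (C.frame a) := fun a => by
    have h : C.frame a = fun g => C.basis a + (1 / 2 : ℝ) • C.bracket.flip (C.basis a) g :=
      funext fun g => C.dLeft_eq g 0 _
    rw [h]
    exact continuous_const.add
      ((LinearMap.continuous_of_finiteDimensional _).const_smul (1 / 2 : ℝ))
  exact Real.continuous_sqrt.comp (continuous_finsetSum _ fun a _ =>
    ((hφ.continuous_fderiv one_ne_zero).clm_apply (hf a)).pow 2)

/-- The normal is defined through a choice at each point, but near a boundary point a single
defining function computes it. -/
theorem continuousOn_horizontalNormal (C : StepTwoCarnot 𝔤 m k)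
    {Ω : Set 𝔤} (hΩ : IsOpen Ω) (hΩ₂ : IsC2Domain Ω) (j : Fin m) :
    ContinuousOn (fun p => C.horizontalNormal Ω p j) (frontier Ω) := by
  intro p hp
  obtain ⟨f, hf⟩ := hΩ₂ p hp
  obtain ⟨V, v, φ, h, hpV, -⟩ := hf.exists_isGraphNear
  have hφ : ContDiff ℝ 1 φ := h.contDiff.of_le (by norm_num)
  have hc : ContinuousAt (fun x => (C.gradNorm φ x)⁻¹ * C.D j φ x) p :=
    ((C.continuous_gradNorm hφ).continuousAt.inv₀
      (C.gradNorm_pos fun h0 => by have := h.fderiv_apply p; simp [h0] at this).ne').mul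
      (C.continuous_D j hφ).continuousAt
  have he : ∀ x ∈ frontier Ω ∩ V,
      C.horizontalNormal Ω x j = (C.gradNorm φ x)⁻¹ * C.D j φ x := fun x hx =>
    C.horizontalNormal_apply (h.isLocalDefining hx.2 ((h.mem_frontier_iff hΩ hx.2).1 hx.1)) j
  refine hc.continuousWithinAt.congr_of_eventuallyEq ?_ (he p ⟨hp, hpV⟩)
  filter_upwards [self_mem_nhdsWithin, mem_nhdsWithin_of_mem_nhds (h.isOpen.mem_nhds hpV)]
    with x h1 h2 using he x ⟨h1, h2⟩

variable [MeasurableSpace 𝔤] [BorelSpace 𝔤]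

/-- The weak divergence identity, tested near a piece of the boundary, in the limit where the test
functions do not vanish on the boundary. -/
theorem integral_weak_divergence_graph (C : StepTwoCarnot 𝔤 m k)
    {n : ℕ} {β : OrthonormalBasis (Fin n ⊕ Unit) ℝ 𝔤} {Ω V : Set 𝔤} {φ : 𝔤 → ℝ}
    (hΩ : IsOpen Ω) (h : IsGraphNear Ω V (β (Sum.inr ())) φ) {q : 𝔤 → ℝ} {G : Fin m → 𝔤 → ℝ}
    (hq : Continuous q) (hG : ∀ j, Continuous (G j))
    (hweak : ∀ η : 𝔤 → ℝ, ContDiff ℝ 1 η → HasCompactSupport η → tsupport η ⊆ Ω →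
      ∫ g in Ω, (η g * q g + ∑ j, C.D j η g * G j g) = 0)
    {χ : 𝔤 → ℝ} (hχ : ContDiff ℝ 1 χ) (hχc : HasCompactSupport χ) (hχV : tsupport χ ⊆ V) :
    ∫ g in Ω, (χ g * q g + ∑ j, C.D j χ g * G j g) =
      ∫ y, χ (graphMap β φ y) * ∑ j, C.D j φ (graphMap β φ y) * G j (graphMap β φ y) := by
  obtain ⟨Θ, hΘ, hΘ01, hΘ0, hΘ1, hθc, hθ0, hθ1⟩ := exists_contDiff_step
  have hφ : ContDiff ℝ 1 φ := h.contDiff.of_le (by norm_num)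
  have hDχ : ∀ j, Continuous (C.D j χ) := fun j => C.continuous_D j hχ
  have hDφ : ∀ j, Continuous (C.D j φ) := fun j => C.continuous_D j hφ
  have hθ : Continuous (deriv Θ) := hΘ.continuous_deriv le_rfl
  have hχ0 : ∀ x, x ∉ V → χ x = 0 := fun x hx =>
    image_eq_zero_of_notMem_tsupport fun h' => hx (hχV h')
  have hDχ0 : ∀ j x, x ∉ tsupport χ → C.D j χ x = 0 := fun j x hx =>
    image_eq_zero_of_notMem_tsupport fun h' => hx (C.tsupport_D_subset j χ h')
  let K : 𝔤 → ℝ := fun x => χ x * ∑ j, C.D j φ x * G j x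
  let P : 𝔤 → ℝ := fun x => χ x * q x + ∑ j, C.D j χ x * G j x
  have hK : Continuous K :=
    hχ.continuous.mul (continuous_finsetSum _ fun j _ => (hDφ j).mul (hG j))
  have hKc : HasCompactSupport K := hχc.mul_right
  have hP : Continuous P := (hχ.continuous.mul hq).add
    (continuous_finsetSum _ fun j _ => (hDχ j).mul (hG j))
  have hP0 : ∀ x, x ∉ tsupport χ → P x = 0 := fun x hx => by
    simp [P, hDχ0 _ x hx, image_eq_zero_of_notMem_tsupport hx]
  have hPc : HasCompactSupport P := HasCompactSupport.intro hχc hP0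
  have hPi : Integrable P := hP.integrable_of_hasCompactSupport hPc
  let s : ℝ → 𝔤 → ℝ := fun ε x => -φ x / ε
  have hs : ∀ ε, ContDiff ℝ 1 (s ε) := fun ε => hφ.neg.div_const ε
  have hη : ∀ ε, ContDiff ℝ 1 fun x => χ x * Θ (s ε x) := fun ε => hχ.mul (hΘ.comp (hs ε))
  have hDη : ∀ ε j x, C.D j (fun x => χ x * Θ (s ε x)) x =
      Θ (s ε x) * C.D j χ x - ε⁻¹ * deriv Θ (s ε x) * (χ x * C.D j φ x) := by
    intro ε j x
    have d1 := (hχ.differentiable (by simp) x).hasFDerivAt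
    have d2 := (hφ.differentiable (by simp) x).hasFDerivAt
    have d3 : HasFDerivAt (s ε) (-(ε⁻¹ • fderiv ℝ φ x)) x := by
      have := (d2.const_mul ε⁻¹).neg
      refine this.congr_of_eventuallyEq (Eventually.of_forall fun z => ?_)
      simp only [s, Pi.neg_apply]
      ring
    have d4 := d1.mul ((hΘ.differentiable (by simp) (s ε x)).hasDerivAt.comp_hasFDerivAt x d3)
    rw [C.D_eq_fderiv j ((hη ε).differentiable (by simp) x),
      C.D_eq_fderiv j d1.differentiableAt, C.D_eq_fderiv j d2.differentiableAt]
    have d5 : fderiv ℝ (fun x => χ x * Θ (s ε x)) x = _ := d4.fderiv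
    rw [d5]
    simp
    ring
  have hηc : ∀ ε, HasCompactSupport fun x => χ x * Θ (s ε x) := fun ε => hχc.mul_right
  -- Since Θ vanishes up to 1, the support lies in {φ ≤ −ε}, strictly inside Ω; this makes the
  -- function admissible in the weak identity.
  have hηΩ : ∀ ε, 0 < ε → tsupport (fun x => χ x * Θ (s ε x)) ⊆ Ω := by
    intro ε hε x hx
    have h1 : x ∈ tsupport χ := tsupport_mul_subset_left hx
    have h2 : tsupport (fun x => χ x * Θ (s ε x)) ⊆ {x | 1 ≤ s ε x} := by
      refine closure_minimal (fun z hz => ?_) (isClosed_le continuous_const (hs ε).continuous)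
      by_contra hlt
      exact hz (by simp [hΘ0 _ (not_le.1 hlt).le])
    refine (h.mem_iff x (hχV h1)).2 ?_
    have h3 : 1 ≤ -φ x / ε := h2 hx
    rw [le_div_iff₀ hε] at h3
    linarith
  have hkey : ∀ ε, 0 < ε → ∫ g in Ω, Θ (s ε g) * P g =
      ∫ x, ε⁻¹ * deriv Θ (-φ x / ε) * K x := by
    intro ε hε
    have h0 := hweak _ (hη ε) (hηc ε) (hηΩ ε hε)
    have hc1 : Continuous fun g => Θ (s ε g) * P g := (hΘ.comp (hs ε)).continuous.mul hP
    have hc2 : Continuous fun g => ε⁻¹ * deriv Θ (s ε g) * K g :=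
      (continuous_const.mul (hθ.comp (hs ε).continuous)).mul hK
    have hi1 : Integrable fun g => Θ (s ε g) * P g :=
      hc1.integrable_of_hasCompactSupport hPc.mul_left
    have hi2 : Integrable fun g => ε⁻¹ * deriv Θ (s ε g) * K g :=
      hc2.integrable_of_hasCompactSupport hKc.mul_left
    have he : ∀ g, χ g * Θ (s ε g) * q g + ∑ j, C.D j (fun x => χ x * Θ (s ε x)) g * G j g =
        Θ (s ε g) * P g - ε⁻¹ * deriv Θ (s ε g) * K g := by
      intro g
      simp only [hDη, P, K, sub_mul, Finset.sum_sub_distrib, Finset.mul_sum, mul_add]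
      have e1 : ∀ j, Θ (s ε g) * C.D j χ g * G j g = Θ (s ε g) * (C.D j χ g * G j g) :=
        fun j => by ring
      have e2 : ∀ j, ε⁻¹ * deriv Θ (s ε g) * (χ g * C.D j φ g) * G j g =
          ε⁻¹ * deriv Θ (s ε g) * (χ g * (C.D j φ g * G j g)) := fun j => by ring
      simp only [e1, e2]
      ring
    simp only [he] at h0
    rw [integral_sub hi1.integrableOn hi2.integrableOn, sub_eq_zero] at h0
    rw [h0]
    refine setIntegral_eq_integral_of_forall_compl_eq_zero fun x hx => ?_
    by_cases hxV : x ∈ V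
    · have h1 : 0 ≤ φ x := not_lt.1 fun h' => hx ((h.mem_iff x hxV).2 h')
      have h2 : s ε x ≤ 0 := div_nonpos_of_nonpos_of_nonneg (neg_nonpos.2 h1) hε.le
      rw [hθ0 _ h2]
      ring
    · simp [K, hχ0 x hxV]
  -- At a fixed point of Ω ∩ V the cutoff is one as soon as 2ε < −φ, so only the layer term of the
  -- derivative retains a trace of the boundary.
  have hlim1 : Tendsto (fun ε => ∫ g in Ω, Θ (s ε g) * P g) (𝓝[>] 0) (𝓝 (∫ g in Ω, P g)) := by
    refine tendsto_integral_filter_of_dominated_convergence (fun g => ‖P g‖)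
      (Eventually.of_forall fun ε =>
        (((hΘ.comp (hs ε)).continuous.mul hP).aestronglyMeasurable))
      (Eventually.of_forall fun ε => Eventually.of_forall fun g => ?_) hPi.norm.integrableOn ?_
    · rw [norm_mul, Real.norm_of_nonneg (hΘ01 _).1]
      exact mul_le_of_le_one_left (norm_nonneg _) (hΘ01 _).2
    · filter_upwards [ae_restrict_mem hΩ.measurableSet] with g hg
      refine tendsto_const_nhds.congr' ?_
      by_cases hgV : g ∈ V
      · have hneg : φ g < 0 := (h.mem_iff g hgV).1 hg
        have : Ioo 0 (-φ g / 2) ∈ 𝓝[>] (0 : ℝ) := Ioo_mem_nhdsGT (by linarith)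
        filter_upwards [this] with ε hε
        rw [hΘ1, one_mul]
        rw [le_div_iff₀ hε.1]
        linarith [hε.2]
      · refine Eventually.of_forall fun ε => ?_
        simp [hP0 g fun h' => hgV (hχV h')]
  have hlim2 := h.tendsto_integral_layer hθ hθc hK hKc
  rw [hθ1, one_mul] at hlim2
  refine tendsto_nhds_unique (hlim1.congr' ?_) hlim2
  filter_upwards [self_mem_nhdsWithin] with ε hε using hkey ε hε

/-- The density |∇φ| of σ over the graph cancels the normalization of ν in ⟨ν, X_j⟩ = X_j φ / |∇φ|,
so the layer limit is a surface integral. -/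
theorem integral_gaussGreen_local (C : StepTwoCarnot 𝔤 m k)
    {β : OrthonormalBasis (Fin (m + k - 1) ⊕ Unit) ℝ 𝔤} {Ω V : Set 𝔤} {φ : 𝔤 → ℝ}
    (hΩ : IsOpen Ω) (h : IsGraphNear Ω V (β (Sum.inr ())) φ) {q : 𝔤 → ℝ} {G : Fin m → 𝔤 → ℝ}
    (hq : Continuous q) (hG : ∀ j, Continuous (G j))
    (hweak : ∀ η : 𝔤 → ℝ, ContDiff ℝ 1 η → HasCompactSupport η → tsupport η ⊆ Ω →
      ∫ g in Ω, (η g * q g + ∑ j, C.D j η g * G j g) = 0)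
    {χ : 𝔤 → ℝ} (hχ : ContDiff ℝ 1 χ) (hχc : HasCompactSupport χ) (hχV : tsupport χ ⊆ V) :
    Integrable (fun p => χ p * ∑ j, C.horizontalNormal Ω p j * G j p)
      (C.surfaceMeasure (frontier Ω)) ∧
    ∫ g in Ω, (χ g * q g + ∑ j, C.D j χ g * G j g) =
      ∫ p, χ p * ∑ j, C.horizontalNormal Ω p j * G j p ∂C.surfaceMeasure (frontier Ω) := by
  have hφ : ContDiff ℝ 1 φ := h.contDiff.of_le (by norm_num)
  have hχ0 : ∀ x, x ∉ V → χ x = 0 := fun x hx =>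
    image_eq_zero_of_notMem_tsupport fun h' => hx (hχV h')
  let K : 𝔤 → ℝ := fun x => χ x * ∑ j, C.D j φ x * G j x
  have hK : Continuous K :=
    hχ.continuous.mul (continuous_finsetSum _ fun j _ => (C.continuous_D j hφ).mul (hG j))
  have hKc : HasCompactSupport K := hχc.mul_right
  have hpos : ∀ x, 0 < C.gradNorm φ x := fun x =>
    C.gradNorm_pos fun h0 => by have := h.fderiv_apply x; simp [h0] at this
  have hgn := C.continuous_gradNorm hφ
  have hf : Continuous fun x => (C.gradNorm φ x)⁻¹ * K x :=
    (hgn.inv₀ fun x => (hpos x).ne').mul hK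
  have hγ := h.contDiff_graphMap.continuous
  have hae : (fun p => χ p * ∑ j, C.horizontalNormal Ω p j * G j p)
      =ᵐ[C.surfaceMeasure (frontier Ω)] fun x => (C.gradNorm φ x)⁻¹ * K x := by
    filter_upwards [C.ae_mem_frontier Ω] with p hp
    by_cases hpV : p ∈ V
    · have hld := h.isLocalDefining hpV ((h.mem_frontier_iff hΩ hpV).1 hp)
      simp only [C.horizontalNormal_apply hld, K, Finset.mul_sum]
      exact Finset.sum_congr rfl fun j _ => by ring
    · simp [K, hχ0 p hpV]
  have hsupp : Function.support (fun x => (C.gradNorm φ x)⁻¹ * K x) ⊆ V := fun x hx => by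
    by_contra hxV
    exact hx (by simp [K, hχ0 x hxV])
  have hdens : Measurable fun y => ENNReal.ofReal (C.gradNorm φ (graphMap β φ y)) :=
    (ENNReal.continuous_ofReal.comp (hgn.comp hγ)).measurable
  have hcancel : (fun y => (ENNReal.ofReal (C.gradNorm φ (graphMap β φ y))).toReal •
      ((C.gradNorm φ (graphMap β φ y))⁻¹ * K (graphMap β φ y))) =
      fun y => K (graphMap β φ y) := by
    funext y
    rw [ENNReal.toReal_ofReal (hpos _).le, smul_eq_mul, mul_inv_cancel_left₀ (hpos _).ne']
  have hKγ : Integrable fun y => K (graphMap β φ y) :=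
    (hK.comp hγ).integrable_of_hasCompactSupport
      (hKc.comp_isClosedEmbedding h.isClosedEmbedding_graphMap)
  constructor
  · rw [integrable_congr hae, ← integrableOn_iff_integrable_of_support_subset hsupp, IntegrableOn,
      C.surfaceMeasure_restrict hΩ h, integrable_map_measure hf.aestronglyMeasurable
      hγ.aemeasurable, integrable_withDensity_iff_integrable_smul' hdens (by simp)]
    simp only [Function.comp]
    rw [hcancel]
    exact hKγ.restrict
  · rw [C.integral_weak_divergence_graph hΩ h hq hG hweak hχ hχc hχV, integral_congr_ae hae,
      ← setIntegral_eq_integral_of_forall_compl_eq_zero (s := V) fun x hx => by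
        by_contra h'; exact hx (hsupp h'),
      C.surfaceMeasure_restrict hΩ h, integral_map hγ.aemeasurable hf.aestronglyMeasurable,
      integral_withDensity_eq_integral_toReal_smul hdens (by simp), hcancel,
      setIntegral_eq_integral_of_forall_compl_eq_zero fun y hy => by simp [K, hχ0 _ hy]]

end StepTwoCarnot

/-- A finite `C¹` partition of unity with compact supports, subordinate to a family of open sets
which contain the points of a compact set. -/
theorem exists_finite_partition {E : Type*} [NormedAddCommGroup E] [NormedSpace ℝ E]
    [FiniteDimensional ℝ E] {K : Set E} (hK : IsCompact K) {W : E → Set E}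
    (hW : ∀ x ∈ K, IsOpen (W x) ∧ x ∈ W x) :
    ∃ (t : Finset E) (χ : E → E → ℝ), (∀ x ∈ t, x ∈ K ∧ ContDiff ℝ 1 (χ x) ∧
      HasCompactSupport (χ x) ∧ tsupport (χ x) ⊆ W x) ∧ ∀ y ∈ K, ∑ x ∈ t, χ x y = 1 := by
  classical
  obtain ⟨t, htK, ht⟩ := hK.elim_nhds_subcover (fun x => W x ∩ Metric.ball x 1) fun x hx =>
    Filter.inter_mem ((hW x hx).1.mem_nhds (hW x hx).2) (Metric.ball_mem_nhds x one_pos)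
  obtain ⟨f, hf⟩ := SmoothPartitionOfUnity.exists_isSubordinate (modelWithCornersSelf ℝ E)
    hK.isClosed (fun x : t => W x ∩ Metric.ball (x : E) 1)
    (fun x => (hW x (htK x x.2)).1.inter Metric.isOpen_ball)
    (fun y hy => by
      obtain ⟨x, hx, hyx⟩ := mem_iUnion₂.1 (ht hy)
      exact mem_iUnion.2 ⟨⟨x, hx⟩, hyx⟩)
  refine ⟨t, fun x => if hx : x ∈ t then f ⟨x, hx⟩ else 0, fun x hx => ?_, fun y hy => ?_⟩
  · simp only [dif_pos hx]
    have h := hf ⟨x, hx⟩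
    refine ⟨htK x hx, (f ⟨x, hx⟩).contMDiff.contDiff.of_le (by norm_cast), ?_,
      h.trans inter_subset_left⟩
    exact Metric.isCompact_of_isClosed_isBounded (isClosed_tsupport _)
      (Metric.isBounded_ball.subset (h.trans inter_subset_right))
  · rw [← f.sum_eq_one hy, finsum_eq_sum_of_fintype, ← Finset.sum_attach]
    exact Finset.sum_congr rfl fun x _ => by simp

namespace StepTwoCarnot

variable {𝔤 : Type*} [NormedAddCommGroup 𝔤] [InnerProductSpace ℝ 𝔤] {m k : ℕ}
variable [FiniteDimensional ℝ 𝔤]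

theorem exists_isGraphNear_basis (C : StepTwoCarnot 𝔤 m k) {Ω : Set 𝔤} (hΩ₂ : IsC2Domain Ω)
    {p : 𝔤} (hp : p ∈ frontier Ω) :
    ∃ (V : Set 𝔤) (β : OrthonormalBasis (Fin (m + k - 1) ⊕ Unit) ℝ 𝔤) (φ : 𝔤 → ℝ),
      IsGraphNear Ω V (β (Sum.inr ())) φ ∧ p ∈ V := by
  obtain ⟨f, hf⟩ := hΩ₂ p hp
  obtain ⟨V, v, φ, h, hpV, -⟩ := hf.exists_isGraphNear
  have hrank : Module.finrank ℝ 𝔤 = m + k := by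
    simp [Module.finrank_eq_card_basis C.basis.toBasis]
  have hpos : 0 < Module.finrank ℝ 𝔤 :=
    Module.finrank_pos_iff_exists_ne_zero.2 ⟨v, fun h0 => by have := h.norm_eq; simp [h0] at this⟩
  obtain ⟨β, hβ⟩ := exists_orthonormalBasis_inr (n := m + k - 1) h.norm_eq (by omega)
  exact ⟨V, β, φ, hβ ▸ h, hpV⟩

variable [MeasurableSpace 𝔤] [BorelSpace 𝔤]

/-- The Gauss-Green formula for a horizontal vector field with a weak divergence. -/
theorem integral_gaussGreen (C : StepTwoCarnot 𝔤 m k) {Ω : Set 𝔤} (hΩ : IsOpen Ω)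
    (hΩb : Bornology.IsBounded Ω) (hΩ₂ : IsC2Domain Ω) {q : 𝔤 → ℝ} {G : Fin m → 𝔤 → ℝ}
    (hq : Continuous q) (hG : ∀ j, Continuous (G j))
    (hweak : ∀ η : 𝔤 → ℝ, ContDiff ℝ 1 η → HasCompactSupport η → tsupport η ⊆ Ω →
      ∫ g in Ω, (η g * q g + ∑ j, C.D j η g * G j g) = 0) :
    Integrable (fun p => ∑ j, C.horizontalNormal Ω p j * G j p) (C.surfaceMeasure (frontier Ω)) ∧
    ∫ g in Ω, q g =
      ∫ p, ∑ j, C.horizontalNormal Ω p j * G j p ∂C.surfaceMeasure (frontier Ω) := by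
  classical
  have hloc : ∀ x ∈ closure Ω, ∃ W : Set 𝔤, (IsOpen W ∧ x ∈ W) ∧
      ∀ χ : 𝔤 → ℝ, ContDiff ℝ 1 χ → HasCompactSupport χ → tsupport χ ⊆ W →
      Integrable (fun p => χ p * ∑ j, C.horizontalNormal Ω p j * G j p)
        (C.surfaceMeasure (frontier Ω)) ∧
      ∫ g in Ω, (χ g * q g + ∑ j, C.D j χ g * G j g) =
        ∫ p, χ p * ∑ j, C.horizontalNormal Ω p j * G j p ∂C.surfaceMeasure (frontier Ω) := by
    intro x hx
    by_cases hxΩ : x ∈ Ω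
    · refine ⟨Ω, ⟨hΩ, hxΩ⟩, fun χ hχ hχc hχΩ => ?_⟩
      have h0 : (fun p => χ p * ∑ j, C.horizontalNormal Ω p j * G j p)
          =ᵐ[C.surfaceMeasure (frontier Ω)] fun _ => 0 := by
        filter_upwards [C.ae_mem_frontier Ω] with p hp
        rw [hΩ.frontier_eq] at hp
        rw [image_eq_zero_of_notMem_tsupport fun h => hp.2 (hχΩ h), MulZeroClass.zero_mul]
      rw [integrable_congr h0, integral_congr_ae h0, integral_zero, hweak χ hχ hχc hχΩ]
      exact ⟨integrable_zero _ _ _, rfl⟩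
    · obtain ⟨V, β, φ, h, hxV⟩ := C.exists_isGraphNear_basis hΩ₂ (p := x)
        (hΩ.frontier_eq ▸ ⟨hx, hxΩ⟩)
      exact ⟨V, ⟨h.isOpen, hxV⟩, fun χ hχ hχc hχV =>
        C.integral_gaussGreen_local hΩ h hq hG hweak hχ hχc hχV⟩
  choose! W hW hWχ using hloc
  obtain ⟨t, χ, hχ, hsum⟩ := exists_finite_partition hΩb.isCompact_closure hW
  have hloc : ∀ x ∈ t, _ := fun x hx =>
    hWχ x (hχ x hx).1 (χ x) (hχ x hx).2.1 (hχ x hx).2.2.1 (hχ x hx).2.2.2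
  have hae : (fun p => ∑ j, C.horizontalNormal Ω p j * G j p)
      =ᵐ[C.surfaceMeasure (frontier Ω)]
      fun p => ∑ x ∈ t, χ x p * ∑ j, C.horizontalNormal Ω p j * G j p := by
    filter_upwards [C.ae_mem_frontier Ω] with p hp
    rw [← Finset.sum_mul, hsum p (frontier_subset_closure hp), one_mul]
  have hint : ∀ x ∈ t, Integrable fun g => χ x g * q g + ∑ j, C.D j (χ x) g * G j g := by
    intro x hx
    obtain ⟨-, h1, h2, -⟩ := hχ x hx
    refine Continuous.integrable_of_hasCompactSupport ((h1.continuous.mul hq).add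
      (continuous_finsetSum _ fun j _ => (C.continuous_D j h1).mul (hG j)))
      (HasCompactSupport.intro h2 fun g hg => ?_)
    have : ∀ j, C.D j (χ x) g = 0 := fun j =>
      image_eq_zero_of_notMem_tsupport fun h' => hg (C.tsupport_D_subset j _ h')
    simp [this, image_eq_zero_of_notMem_tsupport hg]
  refine ⟨(integrable_congr hae).2 (integrable_finsetSum _ fun x hx => (hloc x hx).1), ?_⟩
  rw [integral_congr_ae hae, integral_finsetSum _ fun x hx => (hloc x hx).1,
    ← Finset.sum_congr rfl fun x hx => (hloc x hx).2,
    ← integral_finsetSum _ fun x hx => (hint x hx).integrableOn]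
  refine setIntegral_congr_fun hΩ.measurableSet fun g hg => ?_
  -- The partition functions add up to one on the open set Ω, so their derivatives add up to zero
  -- there and the terms with derivatives of cutoffs disappear.
  have hD : ∀ j, ∑ x ∈ t, C.D j (χ x) g = 0 := by
    intro j
    have hd : ∀ x ∈ t, DifferentiableAt ℝ (χ x) g := fun x hx =>
      (hχ x hx).2.1.differentiable (by simp) g
    have h1 : ∀ x ∈ t, C.D j (χ x) g = fderiv ℝ (χ x) g (C.X j g) := fun x hx =>
      C.D_eq_fderiv j (hd x hx)
    have h2 : (fun y => ∑ x ∈ t, χ x y) =ᶠ[𝓝 g] fun _ => 1 := by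
      filter_upwards [hΩ.mem_nhds hg] with y hy using hsum y (subset_closure hy)
    have h3 := h2.fderiv_eq (𝕜 := ℝ)
    rw [fderiv_fun_sum hd, fderiv_fun_const] at h3
    rw [Finset.sum_congr rfl h1, ← _root_.sum_apply, h3]
    rfl
  have hDG : ∑ x ∈ t, ∑ j, C.D j (χ x) g * G j g = 0 := by
    rw [Finset.sum_comm]
    exact Finset.sum_eq_zero fun j _ => by rw [← Finset.sum_mul, hD, MulZeroClass.zero_mul]
  rw [Finset.sum_add_distrib, ← Finset.sum_mul, hsum g (subset_closure hg), one_mul, hDG, add_zero]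

end StepTwoCarnot

/-! ### Assembling the integral identities. -/

theorem exists_continuous_eqOn_closure {X : Type*} [TopologicalSpace X] [NormalSpace X]
    {Ω : Set X} {v : X → ℝ} (hv : ContinuousOn v (closure Ω)) :
    ∃ w : X → ℝ, Continuous w ∧ EqOn w v (closure Ω) := by
  obtain ⟨w, hw⟩ := ContinuousMap.exists_restrict_eq isClosed_closure
    (⟨(closure Ω).domRestrict v, hv.domRestrict⟩ : C(closure Ω, ℝ))
  exact ⟨w, w.continuous, fun x hx => DFunLike.congr_fun hw ⟨x, hx⟩⟩

namespace StepTwoCarnot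

variable {𝔤 : Type*} [NormedAddCommGroup 𝔤] [InnerProductSpace ℝ 𝔤] {m k : ℕ}

theorem ExtendsUpTo.gamma {C : StepTwoCarnot 𝔤 m k} {Ω : Set 𝔤} {n : ℕ} {u : 𝔤 → ℝ}
    (h : C.ExtendsUpTo Ω n u) : C.Gamma Ω n u := by
  have hc : ∀ {w : 𝔤 → ℝ}, (∃ v, ContinuousOn v (closure Ω) ∧ EqOn v w Ω) → ContinuousOn w Ω :=
    fun ⟨v, hv, he⟩ => (hv.mono subset_closure).congr he.symm
  induction n generalizing u with
  | zero => exact hc h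
  | succ n ih => exact ⟨hc h.1, fun i => ⟨(h.2 i).1, ih (h.2 i).2⟩⟩

/-- Boundary values are limits from inside Ω, which any continuous extension computes. -/
theorem horizontalGradientSq_eq (C : StepTwoCarnot 𝔤 m k) {Ω : Set 𝔤} {u : 𝔤 → ℝ}
    {u₁ : Fin m → 𝔤 → ℝ} (h₁ : ∀ j, Continuous (u₁ j)) (e₁ : ∀ j, EqOn (u₁ j) (C.D j u) Ω)
    {p : 𝔤} (hp : p ∈ closure Ω) : C.horizontalGradientSq Ω u p = ∑ j, u₁ j p ^ 2 := by
  refine Finset.sum_congr rfl fun j _ => ?_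
  rw [extendFrom_eq hp]
  refine ((h₁ j).tendsto p |>.mono_left nhdsWithin_le_nhds).congr' ?_
  filter_upwards [self_mem_nhdsWithin] with x hx using e₁ j hx

variable [FiniteDimensional ℝ 𝔤] [MeasurableSpace 𝔤] [BorelSpace 𝔤]

theorem aemeasurable_angle (C : StepTwoCarnot 𝔤 m k) {Ω : Set 𝔤} (hΩ : IsOpen Ω)
    (hΩ₂ : IsC2Domain Ω) : AEMeasurable (C.angle Ω) (C.surfaceMeasure (frontier Ω)) := by
  have hc : ContinuousOn (C.angle Ω) (frontier Ω) := by
    have h : C.angle Ω = fun p => Real.sqrt (∑ j, C.horizontalNormal Ω p j ^ 2) :=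
      funext fun p => by simp [angle, EuclideanSpace.norm_eq]
    rw [h]
    exact (continuousOn_finsetSum _ fun j _ =>
      (C.continuousOn_horizontalNormal hΩ hΩ₂ j).pow 2).sqrt
  have h := hc.aemeasurable (μ := C.surfaceMeasure (frontier Ω)) isClosed_frontier.measurableSet
  rwa [Measure.restrict_eq_self_of_ae_mem (C.ae_mem_frontier Ω)] at h

/-- The integrated form of `hessianNormSq_eq`. -/
theorem integral_hessianNormSq (C : StepTwoCarnot 𝔤 m k) {Ω : Set 𝔤} (hΩ : IsOpen Ω)
    (hΩb : Bornology.IsBounded Ω) {u : 𝔤 → ℝ} {u₂ : Fin m → Fin m → 𝔤 → ℝ}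
    (h₂ : ∀ i j, Continuous (u₂ i j)) (e₂ : ∀ i j, EqOn (u₂ i j) (C.D i (C.D j u)) Ω) :
    IntegrableOn (C.hessianNormSq u) Ω ∧
    IntegrableOn (fun g => C.laplacian u g ^ 2) Ω ∧
    (∀ i j, IntegrableOn (fun g => C.comm i j u g ^ 2) Ω) ∧
    ∫ g in Ω, C.hessianNormSq u g = (∫ g in Ω, divSource (C.hess u g)) +
      (∫ g in Ω, C.laplacian u g ^ 2) + 3 / 4 * ∑ i, ∑ j, ∫ g in Ω, C.comm i j u g ^ 2 := by
  have hint : ∀ {f w : 𝔤 → ℝ}, Continuous w → EqOn w f Ω → IntegrableOn f Ω := fun hw he =>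
    ((hw.continuousOn.integrableOn_compact hΩb.isCompact_closure).mono_set
      subset_closure).congr_fun he hΩ.measurableSet
  have hlap : IntegrableOn (fun g => C.laplacian u g ^ 2) Ω :=
    hint (w := fun g => (∑ i, u₂ i i g) ^ 2)
      ((continuous_finsetSum _ fun i _ => h₂ i i).pow 2) fun g hg => by
        simp only [laplacian, e₂ _ _ hg]
  have hcomm : ∀ i j, IntegrableOn (fun g => C.comm i j u g ^ 2) Ω := fun i j =>
    hint (w := fun g => (u₂ i j g - u₂ j i g) ^ 2) (((h₂ i j).sub (h₂ j i)).pow 2) fun g hg => by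
      simp only [comm, e₂ _ _ hg]
  have hdiv : IntegrableOn (fun g => divSource (C.hess u g)) Ω :=
    hint (w := fun g => divSource fun i j => u₂ i j g)
      (continuous_divSource.comp (continuous_pi fun i => continuous_pi fun j => h₂ i j))
      fun g hg => by
        have : (fun i j => u₂ i j g) = C.hess u g := funext fun i => funext fun j => e₂ i j hg
        simp only [this]
  have hsum : IntegrableOn (fun g => 3 / 4 * ∑ i, ∑ j, C.comm i j u g ^ 2) Ω :=
    (integrable_finsetSum _ fun i _ => integrable_finsetSum _ fun j _ => hcomm i j).const_mul _
  have he : C.hessianNormSq u = fun g => divSource (C.hess u g) + C.laplacian u g ^ 2 +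
      3 / 4 * ∑ i, ∑ j, C.comm i j u g ^ 2 := funext fun g => C.hessianNormSq_eq u g
  refine ⟨he ▸ (hdiv.add hlap).add hsum, hlap, hcomm, ?_⟩
  have h1 : ∫ g in Ω, C.hessianNormSq u g = ∫ g in Ω, (divSource (C.hess u g) +
      C.laplacian u g ^ 2 + 3 / 4 * ∑ i, ∑ j, C.comm i j u g ^ 2) := by rw [he]
  have hdl : IntegrableOn (fun g => divSource (C.hess u g) + C.laplacian u g ^ 2) Ω :=
    hdiv.add hlap
  rw [h1, integral_add hdl hsum, integral_add hdiv hlap, integral_const_mul,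
    integral_finsetSum _ fun i _ => integrable_finsetSum _ fun j _ => hcomm i j]
  simp only [integral_finsetSum _ fun j _ => hcomm _ j]

/-- On O the test function is constant, and off O the second derivatives of u vanish. So the flux
term of the weak identity is zero everywhere. -/
theorem integral_divSource_of_compact (C : StepTwoCarnot 𝔤 m k) {Ω : Set 𝔤} (hΩ : IsOpen Ω)
    {u η : 𝔤 → ℝ} (hu : C.Gamma Ω 2 u) (hη : ContDiff ℝ 1 η) (hηc : HasCompactSupport η)
    (hηΩ : tsupport η ⊆ Ω) {O : Set 𝔤} (hO : IsOpen O) (huO : tsupport u ⊆ O)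
    (hη1 : EqOn η 1 O) : ∫ g in Ω, divSource (C.hess u g) = 0 := by
  rw [← C.integral_divSource_eq_zero hΩ hu hη hηc hηΩ]
  congr 1
  funext g
  by_cases hg : g ∈ O
  · have h0 : ∀ j, C.D j η g = 0 := fun j => by
      have : η =ᶠ[𝓝 g] fun _ => 1 := by
        filter_upwards [hO.mem_nhds hg] with x hx using hη1 hx
      rw [C.D_congr this, D, deriv_const]
    simp [h0, hη1 hg]
  · have h1 : ∀ j, g ∉ tsupport (C.D j u) := fun j h => hg (huO (C.tsupport_D_subset j u h))
    have h2 : ∀ i j, C.D i (C.D j u) g = 0 := fun i j =>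
      image_eq_zero_of_notMem_tsupport fun h => h1 j (C.tsupport_D_subset i _ h)
    simp [flux, divSource, grad, hess, h2]

/-- The boundary term of the integral identity. -/
theorem integral_divSource_eq_boundary (C : StepTwoCarnot 𝔤 m k) {Ω : Set 𝔤} (hΩ : IsOpen Ω)
    (hΩb : Bornology.IsBounded Ω) (hΩ₂ : IsC2Domain Ω)
    {u u₀ : 𝔤 → ℝ} {u₁ : Fin m → 𝔤 → ℝ} {u₂ : Fin m → Fin m → 𝔤 → ℝ} (hu : C.Gamma Ω 2 u)
    (hu₀ : Continuous u₀) (hu₁ : ∀ j, Continuous (u₁ j)) (hu₂ : ∀ i j, Continuous (u₂ i j))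
    (e₀ : EqOn u₀ u Ω) (e₁ : ∀ j, EqOn (u₁ j) (C.D j u) Ω)
    (e₂ : ∀ i j, EqOn (u₂ i j) (C.D i (C.D j u)) Ω) (hb : ∀ x ∈ frontier Ω, u₀ x = 0) :
    Integrable (fun g => C.meanCurvature Ω g * C.horizontalGradientSq Ω u g)
      (C.perimeterMeasure Ω) ∧
    ∫ g in Ω, divSource (C.hess u g) =
      -∫ g, C.meanCurvature Ω g * C.horizontalGradientSq Ω u g ∂C.perimeterMeasure Ω := by
  have h1 : ∀ g ∈ Ω, (fun i => u₁ i g) = C.grad u g := fun g hg => funext fun i => e₁ i hg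
  have h2 : ∀ g ∈ Ω, (fun i j => u₂ i j g) = C.hess u g := fun g hg =>
    funext fun i => funext fun j => e₂ i j hg
  have c1 : Continuous fun g => fun i => u₁ i g := continuous_pi hu₁
  have c2 : Continuous fun g => fun i j => u₂ i j g :=
    continuous_pi fun i => continuous_pi fun j => hu₂ i j
  obtain ⟨hi, hgg⟩ := C.integral_gaussGreen hΩ hΩb hΩ₂
    (q := fun g => divSource fun i j => u₂ i j g)
    (G := fun j g => flux (fun i => u₁ i g) (fun i j => u₂ i j g) j)
    (continuous_divSource.comp c2) (fun j => (continuous_flux j).comp (c1.prodMk c2))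
    fun η hη hηc hηΩ => by
      rw [← C.integral_divSource_eq_zero hΩ hu hη hηc hηΩ]
      exact setIntegral_congr_fun hΩ.measurableSet fun g hg => by simp only [h1 g hg, h2 g hg]
  have hpt : (fun p => ∑ j, C.horizontalNormal Ω p j *
      flux (fun i => u₁ i p) (fun i j => u₂ i j p) j) =ᵐ[C.surfaceMeasure (frontier Ω)]
      fun p => -((ENNReal.ofReal (C.angle Ω p)).toReal •
        (C.meanCurvature Ω p * C.horizontalGradientSq Ω u p)) := by
    filter_upwards [C.ae_mem_frontier Ω] with p hp
    rw [ENNReal.toReal_ofReal (show 0 ≤ C.angle Ω p from norm_nonneg _),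
      C.horizontalGradientSq_eq hu₁ e₁ (frontier_subset_closure hp)]
    -- At characteristic points both integrands vanish, whatever value the mean curvature has there.
    by_cases hW : C.angle Ω p = 0
    · have hN : C.horizontalNormal Ω p = 0 := norm_eq_zero.1 hW
      simp [hW, hN]
    · have hc : p ∉ C.characteristicSet Ω := fun h => hW h.2
      obtain ⟨V, β, φ, h, hpV⟩ := C.exists_isGraphNear_basis hΩ₂ hp
      rw [C.sum_horizontalNormal_mul_flux hΩ h hpV hp hW hu hu₀ hu₁ hu₂ e₀ e₁ e₂ hb,
        meanCurvature, if_neg hc, smul_eq_mul]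
  have hW : AEMeasurable (fun p => ENNReal.ofReal (C.angle Ω p))
      (C.surfaceMeasure (frontier Ω)) := (C.aemeasurable_angle hΩ hΩ₂).ennreal_ofReal
  constructor
  · rw [perimeterMeasure, integrable_withDensity_iff_integrable_smul₀' hW (by simp)]
    simpa using ((integrable_congr hpt).1 hi).neg
  · rw [perimeterMeasure, integral_withDensity_eq_integral_toReal_smul₀ hW (by simp),
      ← integral_neg, ← integral_congr_ae hpt, ← hgg]
    exact setIntegral_congr_fun hΩ.measurableSet fun g hg => by simp only [h2 g hg]

end StepTwoCarnot

theorem corollaryC {𝔤 : Type*} [NormedAddCommGroup 𝔤] [InnerProductSpace ℝ 𝔤]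
    [FiniteDimensional ℝ 𝔤] [MeasurableSpace 𝔤] [BorelSpace 𝔤] {m k : ℕ}
    (C : StepTwoCarnot 𝔤 m k) (Ω : Set 𝔤)
    (hΩ_open : IsOpen Ω) (hΩ_bdd : Bornology.IsBounded Ω) (hΩ_C2 : IsC2Domain Ω) :
    (∀ u : 𝔤 → ℝ, C.GammaClosure Ω 2 u → (∀ g ∈ Ω, u g ≤ 0) → (∀ g ∈ frontier Ω, u g = 0) →
      IntegrableOn (C.hessianNormSq u) Ω ∧
      IntegrableOn (fun g => (C.laplacian u g) ^ 2) Ω ∧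
      (∀ i j, IntegrableOn (fun g => (C.comm i j u g) ^ 2) Ω) ∧
      Integrable (fun g => C.meanCurvature Ω g * C.horizontalGradientSq Ω u g)
        (C.perimeterMeasure Ω) ∧
      (∫ g in Ω, C.hessianNormSq u g) =
        (∫ g in Ω, (C.laplacian u g) ^ 2)
          + 3 / 4 * (∑ i, ∑ j, ∫ g in Ω, (C.comm i j u g) ^ 2)
          - (∫ g, C.meanCurvature Ω g * C.horizontalGradientSq Ω u g ∂(C.perimeterMeasure Ω))) ∧
    (∀ u : 𝔤 → ℝ, C.GammaCompact Ω 2 u →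
      IntegrableOn (C.hessianNormSq u) Ω ∧
      IntegrableOn (fun g => (C.laplacian u g) ^ 2) Ω ∧
      (∀ i j, IntegrableOn (fun g => (C.comm i j u g) ^ 2) Ω) ∧
      (∫ g in Ω, C.hessianNormSq u g) =
        (∫ g in Ω, (C.laplacian u g) ^ 2)
          + 3 / 4 * (∑ i, ∑ j, ∫ g in Ω, (C.comm i j u g) ^ 2)) := by
  constructor
  · rintro u ⟨huc, hu⟩ - hb
    obtain ⟨u₀, hu₀, e₀⟩ := exists_continuous_eqOn_closure huc
    have h1 : ∀ j, ∃ w, Continuous w ∧ EqOn w (C.D j u) Ω := fun j => by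
      obtain ⟨v, hv, he⟩ := (hu.2 j).2.1
      obtain ⟨w, hw, hwv⟩ := exists_continuous_eqOn_closure hv
      exact ⟨w, hw, (hwv.mono subset_closure).trans he⟩
    have h2 : ∀ i j, ∃ w, Continuous w ∧ EqOn w (C.D i (C.D j u)) Ω := fun i j => by
      obtain ⟨v, hv, he⟩ := ((hu.2 j).2.2 i).2
      obtain ⟨w, hw, hwv⟩ := exists_continuous_eqOn_closure hv
      exact ⟨w, hw, (hwv.mono subset_closure).trans he⟩
    choose u₁ hu₁ e₁ using h1
    choose u₂ hu₂ e₂ using h2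
    obtain ⟨i1, i2, i3, hint⟩ := C.integral_hessianNormSq hΩ_open hΩ_bdd hu₂ e₂
    obtain ⟨i4, hdiv⟩ := C.integral_divSource_eq_boundary hΩ_open hΩ_bdd hΩ_C2 hu.gamma hu₀ hu₁
      hu₂ (e₀.mono subset_closure) e₁ e₂
      fun x hx => (e₀ (frontier_subset_closure hx)).trans (hb x hx)
    refine ⟨i1, i2, i3, i4, ?_⟩
    rw [hint, hdiv]
    ring
  · rintro u ⟨hu, hc, hs⟩
    obtain ⟨η, hη, hηc, hηΩ, O, hO, huO, hη1⟩ := exists_contDiff_cutoff hc hΩ_open hs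
    -- The second derivatives of u vanish outside its support, so multiplication by the cutoff
    -- leaves them unchanged in Ω and makes them continuous on the whole group.
    have hu₂ : ∀ i j, Continuous fun g => η g * C.D i (C.D j u) g := fun i j =>
      StepTwoCarnot.continuous_mul_of_tsupport_subset hΩ_open (hη 1).continuous hηΩ
        ((hu.2 j).2.2 i).2
    have e₂ : ∀ i j, EqOn (fun g => η g * C.D i (C.D j u) g) (C.D i (C.D j u)) Ω := by
      intro i j g _
      by_cases hg : g ∈ O
      · simp [hη1 hg]
      · have : C.D i (C.D j u) g = 0 := image_eq_zero_of_notMem_tsupport fun h =>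
          hg (huO (C.tsupport_D_subset j u (C.tsupport_D_subset i _ h)))
        simp [this]
    obtain ⟨i1, i2, i3, hint⟩ := C.integral_hessianNormSq hΩ_open hΩ_bdd hu₂ e₂
    refine ⟨i1, i2, i3, ?_⟩
    rw [hint, C.integral_divSource_of_compact hΩ_open hu (hη 1) hηc hηΩ hO huO hη1, zero_add]
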